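/- **Setting.** Let $M$ be a smooth manifold of dimension $n\ge 2$, $E=\mathbb R\times M\to\mathbb R$ the trivial bundle and $J^k(E)$ the manifold of $k$-jets of its local (smooth) sections, with projections $\pi^k_r:J^k(E)\to J^r(E)$, $\pi^k_0:J^k(E)\to E$ and adapted coordinates $(t,y^i,y^i_{(1)},\dots,y^i_{(k)})$. For a section $\gamma$ on an open interval $I$ let $\gamma^{(k)}(t)=j^k_t(\gamma)$. The holonomic distribution $\mathcal D$ is spanned at $u$ by the velocities at $u$ of all lifts $\gamma^{(k)}$ through $u$. A $p$-form ($p\ge1$) is *holonomic* if its contractions with all vectors of $\mathcal D$ vanish, a holonomic $0$-form is $0$; two $p$-forms on an open set are *variationally equivalent* if their difference is $\lambda+d\mu$ with $\lambda,\mu$ holonomic, and $[\alpha]$ is the class of $\alpha$. A form is *of order $r$* if it is the pull-back by $\pi^k_r$ of a form on an open subset of $J^r(E)$. A $2$-form $\sigma$ is a *source form* if $\imath_V\sigma=0$ whenever $(\pi^k_0)_*V=0$. In adapted coordinates put $\frac{d}{dt}=\frac{\partial}{\partial t}+\sum_{a=0}^{k-1}y^i_{(a+1)}\frac{\partial}{\partial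 y^i_{(a)}}$ and $\omega^i_{(0)}=dy^i-y^i_{(1)}dt$. Let $\mathcal W\subset J^k(E)$ be open, $u_o\in\mathcal W$, and let $\alpha$ be a smooth $1$-form of order $r$ on $\mathcal W$ (any $r\le k$) that is locally variationally equivalent to $1$-forms $L\,dt$ of order $q$ with $2q\le k$. A section $\gamma:I\to E$ with $\gamma^{(k)}(I)\subset\mathcal W$ is a *solution* (it satisfies the variational principle of $\mathcal I_{[\alpha]}$) if $\frac{d}{ds}\big|_{s=0}\int_{(\gamma_s)^{(k)}([a,b])}\alpha=0$ for all $[a,b]\subset I$ and all smooth variations $\gamma_s$ of $\gamma|_{[a,b]}$, through sections with lifts in $\mathcal W$, whose $r$-jets at $a$ and $b$ are those of $\gamma$. A smooth function $f$ on an open set $\mathcal U$ is a *constant of motion* if $\frac{d}{dt}f(\gamma^{(k)}(t))=0$ for every solution $\gamma$ wherever $\gamma^{(k)}(t)\in\mathcal U$. Let $\mathfrak{ConstMot}$ be the vector space of germs at $u_o$ of constants of motion, and $\mathfrak{Null}$ the subspace of the germs of those that vanish at all points of lifts of solutions. Let $\alpha_o\in[\alpha]$ be a $1$-form on $\mathcal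 W$ of Poincaré–Cartan type, i.e. $d\alpha_o$ is the sum of a source form and a holonomic $2$-form, and let $\alpha_o$ be of order $r'\le k-1$. A vector field $X$ on an open set is an *infinitesimal symmetry* for $\mathcal I_{[\alpha]}$ if $[X,Y]$ is holonomic (takes values in $\mathcal D$) for every local holonomic vector field $Y$ and $\mathcal L_X\alpha$ is holonomic; it is an *$\alpha_o$-symmetry* if moreover $\mathcal L_X\alpha_o=0$. Let $\Sigma^{(\alpha_o)}$ be the set of germs at $u_o$ of $\alpha_o$-symmetries. **Proposition.** Assume in addition that on $\mathcal W$: (a) there is a source form $\sigma\in[d\alpha]$ of order $r_0\le k-1$ which in all adapted coordinates has the form $\sigma=\sigma_i\,\omega^i_{(0)}\wedge dt$, and which is regular: the map $F_\sigma=\big((\tfrac{d}{dt})^p\sigma_i\big)_{0\le p\le k-r_0,\ 1\le i\le n}$ is a submersion at all its zeros in $\mathcal W$; (b) $\alpha_o\left(\frac{d}{dt}\right)\neq0$ at all points of $\mathcal W$. Then $\Sigma^{(\alpha_o)}$ is a Lie subalgebra of the Lie algebra of germs at $u_o$ of smooth vector fields of $J^k(E)$, and $$\rho:\Sigma^{(\alpha_o)}\to\operatorname{Hom}\big(\mathfrak{ConstMot}/\mathfrak{Null},\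 \mathfrak{ConstMot}/\mathfrak{Null}\big),\qquad \rho(\underline X)\,[\underline f]=[\underline{X(f)}],$$ is well defined (in particular $X(f)$ is again a constant of motion) and is a linear representation of the Lie algebra $\Sigma^{(\alpha_o)}$: it is linear and $\rho([\underline X,\underline Y])=\rho(\underline X)\rho(\underline Y)-\rho(\underline Y)\rho(\underline X)$. -/

import Mathlib

open Set Filter Topology
open scoped Manifold ContDiff Topology

namespace JetNoether

noncomputable section

section Calculus

variable {H : Type*} [NormedAddCommGroup H] [NormedSpace ℝ H]
  {N : Type*} [TopologicalSpace N] [ChartedSpace H N]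
  {H' : Type*} [NormedAddCommGroup H'] [NormedSpace ℝ H']
  {N' : Type*} [TopologicalSpace N'] [ChartedSpace H' N']

variable (H N) in
/-- Vector fields on a manifold `N` (without regularity) modelled on `H`. -/
abbrev VField : Type _ := ∀ u : N, TangentSpace 𝓘(ℝ, H) u

/-- The vector field `X` is smooth at `u`. -/
def VField.SmoothAt [IsManifold 𝓘(ℝ, H) ∞ N] (X : VField H N) (u : N) : Prop :=
  ContMDiffAt 𝓘(ℝ, H) 𝓘(ℝ, H).tangent ∞ (fun w => (⟨w, X w⟩ : TangentBundle 𝓘(ℝ, H) N)) u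

/-- The function `X(f)`. -/
def VField.apply (X : VField H N) (f : N → ℝ) (u : N) : ℝ := mfderiv 𝓘(ℝ, H) 𝓘(ℝ, ℝ) f u (X u)

variable (H N) in
/-- Differential `p`-forms on `N` (without regularity). Every tangent space `TangentSpace 𝓘(ℝ, H) u`
is, by definition, a copy of `H`. -/
abbrev PForm (p : ℕ) : Type _ := N → H [⋀^Fin p]→L[ℝ] ℝ

namespace PForm

variable {p : ℕ}

/-- The pull-back `f^* θ`. -/
def pullback (f : N → N') (θ : PForm H' N' p) : PForm H N p := fun u =>
  let A : H →L[ℝ] H' := mfderiv 𝓘(ℝ, H) 𝓘(ℝ, H') f u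
  (θ (f u)).compContinuousLinearMap A

/-- The expression of `θ` in the preferred chart at `u`. -/
def inChart (θ : PForm H N p) (u : N) : PForm H H p :=
  pullback (extChartAt 𝓘(ℝ, H) u).symm θ

/-- The form `θ` is smooth at all points of `U`. -/
def SmoothOn (θ : PForm H N p) (U : Set N) : Prop :=
  ∀ u ∈ U, ContDiffAt ℝ ∞ (θ.inChart u) (extChartAt 𝓘(ℝ, H) u u)

/-- The exterior differential, computed at each `u` in the preferred chart at `u`. -/
def d (θ : PForm H N p) : PForm H N (p + 1) := fun u =>
  pullback (extChartAt 𝓘(ℝ, H) u) (extDeriv (θ.inChart u)) u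

/-- The interior product `ι_X θ`. -/
def interior (X : VField H N) (θ : PForm H N (p + 1)) : PForm H N p := fun u =>
  (θ u).curryLeft (X u)

/-- The Lie derivative `ℒ_X θ = d (ι_X θ) + ι_X (d θ)`. -/
def lieDeriv (X : VField H N) (θ : PForm H N (p + 1)) : PForm H N (p + 1) := fun u =>
  (interior X θ).d u + interior X θ.d u

end PForm

/-! Germs of smooth vector fields. -/

variable [IsManifold 𝓘(ℝ, H) ∞ N]

variable (H) in
/-- Vector fields that are smooth on a neighbourhood of `u₀`. -/
def smoothNear (u₀ : N) : Submodule ℝ (VField H N) where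
  carrier := {X | ∀ᶠ u in 𝓝 u₀, X.SmoothAt u}
  zero_mem' := Eventually.of_forall fun u =>
    (Bundle.contMDiff_zeroSection ℝ (TangentSpace 𝓘(ℝ, H) : N → Type _)) u
  add_mem' := fun {X Y} hX hY => by
    filter_upwards [hX, hY] with u h1 h2
    exact ContMDiffAt.add_section h1 h2
  smul_mem' := fun c X hX => by
    filter_upwards [hX] with u h1
    exact ContMDiffAt.const_smul_section h1

variable (H) in
/-- Smooth vector fields near `u₀` that vanish on a neighbourhood of `u₀`. -/
def vanishNear (u₀ : N) : Submodule ℝ (smoothNear H u₀) where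
  carrier := {X | ∀ᶠ u in 𝓝 u₀, X.1 u = 0}
  zero_mem' := Eventually.of_forall fun _ => rfl
  add_mem' := fun {X Y} hX hY => by
    filter_upwards [hX, hY] with u h1 h2
    show X.1 u + Y.1 u = 0
    rw [h1, h2, add_zero]
  smul_mem' := fun c X hX => by
    filter_upwards [hX] with u h1
    show c • X.1 u = 0
    rw [h1, smul_zero]

variable (H) in
/-- Germs at `u₀` of smooth vector fields. -/
def VFGerm (u₀ : N) : Type _ := smoothNear H u₀ ⧸ vanishNear H u₀

instance instAddCommGroupVFGerm (u₀ : N) : AddCommGroup (VFGerm H u₀) :=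
  inferInstanceAs (AddCommGroup (smoothNear H u₀ ⧸ vanishNear H u₀))

instance instModuleVFGerm (u₀ : N) : Module ℝ (VFGerm H u₀) :=
  inferInstanceAs (Module ℝ (smoothNear H u₀ ⧸ vanishNear H u₀))

/-- The germ at `u₀` of a vector field that is smooth near `u₀`. -/
def VFGerm.mk {u₀ : N} (X : smoothNear H u₀) : VFGerm H u₀ := (vanishNear H u₀).mkQ X

lemma VFGerm.mk_eq_mk {u₀ : N} {X Y : smoothNear H u₀} :
    VFGerm.mk X = VFGerm.mk Y ↔ ∀ᶠ u in 𝓝 u₀, X.1 u = Y.1 u := by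
  refine (Submodule.Quotient.eq (vanishNear H u₀)).trans ?_
  refine eventually_congr (Eventually.of_forall fun u => ?_)
  exact sub_eq_zero

lemma VFGerm.mk_surjective {u₀ : N} : Function.Surjective (VFGerm.mk (H := H) (u₀ := u₀)) :=
  Submodule.mkQ_surjective _

lemma VFGerm.mk_add {u₀ : N} (X Y : smoothNear H u₀) :
    VFGerm.mk (X + Y) = VFGerm.mk X + VFGerm.mk Y := rfl

lemma VFGerm.mk_smul {u₀ : N} (c : ℝ) (X : smoothNear H u₀) :
    VFGerm.mk (c • X) = c • VFGerm.mk X := rfl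

lemma VField.SmoothAt.mdiff {X : VField H N} {u : N} (hX : X.SmoothAt u) :
    MDifferentiableAt 𝓘(ℝ, H) 𝓘(ℝ, H).tangent
      (fun w => (⟨w, X w⟩ : TangentBundle 𝓘(ℝ, H) N)) u :=
  ContMDiffAt.mdifferentiableAt hX (by simp)

variable [CompleteSpace H]

lemma VField.SmoothAt.lie {X Y : VField H N} {u : N} (hX : X.SmoothAt u) (hY : Y.SmoothAt u) :
    VField.SmoothAt (VectorField.mlieBracket 𝓘(ℝ, H) X Y) u := by
  have : IsManifold 𝓘(ℝ, H) (((⊤ : ℕ∞) : WithTop ℕ∞) + 1) N := by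
    simpa using (inferInstance : IsManifold 𝓘(ℝ, H) ∞ N)
  have : IsManifold 𝓘(ℝ, H) (minSmoothness ℝ 2) N := by
    rw [minSmoothness_of_isRCLikeNormedField]
    exact IsManifold.of_le (n := ∞) ENat.LEInfty.out
  exact ContMDiffAt.mlieBracket_vectorField (m := ⊤) (n := ⊤) hX hY (by simp)

/-- The Lie bracket `[X, Y]` of two vector fields that are smooth near `u₀`. -/
def smoothNear.lie {u₀ : N} (X Y : smoothNear H u₀) : smoothNear H u₀ :=
  ⟨VectorField.mlieBracket 𝓘(ℝ, H) X.1 Y.1, by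
    filter_upwards [X.2, Y.2] with u h1 h2
    exact h1.lie h2⟩

/-- The Lie bracket of germs. -/
def VFGerm.lie {u₀ : N} (X Y : VFGerm H u₀) : VFGerm H u₀ :=
  Quotient.liftOn₂' X Y (fun X Y => VFGerm.mk (smoothNear.lie X Y)) (by
    intro X Y X' Y' hX hY
    have hX' := VFGerm.mk_eq_mk.1 (Quotient.sound' hX : VFGerm.mk X = VFGerm.mk X')
    have hY' := VFGerm.mk_eq_mk.1 (Quotient.sound' hY : VFGerm.mk Y = VFGerm.mk Y')
    exact VFGerm.mk_eq_mk.2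
      (Filter.EventuallyEq.mlieBracket_vectorField (I := 𝓘(ℝ, H)) hX' hY'))

instance instBracketVFGerm (u₀ : N) : Bracket (VFGerm H u₀) (VFGerm H u₀) := ⟨VFGerm.lie⟩

lemma VFGerm.lie_mk {u₀ : N} (X Y : smoothNear H u₀) :
    ⁅VFGerm.mk X, VFGerm.mk Y⁆ = VFGerm.mk (smoothNear.lie X Y) := rfl

instance instLieRingVFGerm (u₀ : N) : LieRing (VFGerm H u₀) where
  add_lie x y z := by
    obtain ⟨X, rfl⟩ := VFGerm.mk_surjective x
    obtain ⟨Y, rfl⟩ := VFGerm.mk_surjective y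
    obtain ⟨Z, rfl⟩ := VFGerm.mk_surjective z
    simp only [← VFGerm.mk_add, VFGerm.lie_mk]
    refine VFGerm.mk_eq_mk.2 ?_
    filter_upwards [X.2, Y.2] with u h1 h2
    exact VectorField.mlieBracket_add_left h1.mdiff h2.mdiff
  lie_add x y z := by
    obtain ⟨X, rfl⟩ := VFGerm.mk_surjective x
    obtain ⟨Y, rfl⟩ := VFGerm.mk_surjective y
    obtain ⟨Z, rfl⟩ := VFGerm.mk_surjective z
    simp only [← VFGerm.mk_add, VFGerm.lie_mk]
    refine VFGerm.mk_eq_mk.2 ?_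
    filter_upwards [Y.2, Z.2] with u h1 h2
    exact VectorField.mlieBracket_add_right h1.mdiff h2.mdiff
  lie_self x := by
    obtain ⟨X, rfl⟩ := VFGerm.mk_surjective x
    rw [VFGerm.lie_mk]
    refine (VFGerm.mk_eq_mk (Y := 0)).2 (Eventually.of_forall fun u => ?_)
    show VectorField.mlieBracket 𝓘(ℝ, H) X.1 X.1 u = 0
    rw [VectorField.mlieBracket_self]
    rfl
  leibniz_lie x y z := by
    obtain ⟨X, rfl⟩ := VFGerm.mk_surjective x
    obtain ⟨Y, rfl⟩ := VFGerm.mk_surjective y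
    obtain ⟨Z, rfl⟩ := VFGerm.mk_surjective z
    simp only [VFGerm.lie_mk, ← VFGerm.mk_add]
    refine VFGerm.mk_eq_mk.2 ?_
    have : IsManifold 𝓘(ℝ, H) (minSmoothness ℝ 3) N := by
      rw [minSmoothness_of_isRCLikeNormedField]
      exact IsManifold.of_le (n := ∞) ENat.LEInfty.out
    have hle : minSmoothness ℝ 2 ≤ ∞ := by
      rw [minSmoothness_of_isRCLikeNormedField]
      exact ENat.LEInfty.out
    filter_upwards [X.2, Y.2, Z.2] with u h1 h2 h3
    exact VectorField.leibniz_identity_mlieBracket_apply (ContMDiffAt.of_le h1 hle)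
      (ContMDiffAt.of_le h2 hle) (ContMDiffAt.of_le h3 hle)

instance instLieAlgebraVFGerm (u₀ : N) : LieAlgebra ℝ (VFGerm H u₀) where
  lie_smul c x y := by
    obtain ⟨X, rfl⟩ := VFGerm.mk_surjective x
    obtain ⟨Y, rfl⟩ := VFGerm.mk_surjective y
    simp only [← VFGerm.mk_smul, VFGerm.lie_mk]
    refine VFGerm.mk_eq_mk.2 ?_
    filter_upwards [Y.2] with u h2
    exact VectorField.mlieBracket_const_smul_right h2.mdiff

end Calculus

/-- The coordinate space `ℝ^{n(k+1)+1}` of the adapted coordinates `(t, y^i, y^i_(1), …, y^i_(k))`: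
the point `z` has `t = z.1` and `y^i_(a) = z.2 a i`. -/
abbrev JetModel (n k : ℕ) : Type := ℝ × (Fin (k + 1) → EuclideanSpace ℝ (Fin n))

section Jets

variable (n : ℕ) (M : Type*) [TopologicalSpace M] [ChartedSpace (EuclideanSpace ℝ (Fin n)) M]

/-- Pairs `(t, γ)` of a time and a curve in `M` (i.e. a section of `E = ℝ × M → ℝ`) smooth at `t`. -/
abbrev CurveAt : Type _ := {p : ℝ × (ℝ → M) // ContMDiffAt 𝓘(ℝ, ℝ) (𝓡 n) ∞ p.2 p.1}

/-- Two pairs `(t, γ)`, `(t', γ')` have the same `k`-jet if `t = t'`, `γ t = γ' t'` and, in all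
coordinates of `M` around this point, the derivatives up to order `k` coincide. -/
def jetSetoid (k : ℕ) : Setoid (CurveAt n M) where
  r p q := p.1.1 = q.1.1 ∧ p.1.2 p.1.1 = q.1.2 q.1.1 ∧
    ∀ φ ∈ IsManifold.maximalAtlas (𝓡 n) ∞ M, p.1.2 p.1.1 ∈ φ.source → ∀ a ≤ k,
      iteratedDeriv a (φ ∘ p.1.2) p.1.1 = iteratedDeriv a (φ ∘ q.1.2) q.1.1
  iseqv :=
    { refl := fun _ => ⟨rfl, rfl, fun _ _ _ _ _ => rfl⟩
      symm := fun h => ⟨h.1.symm, h.2.1.symm, fun φ hφ hx a ha =>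
        (h.2.2 φ hφ (by rw [h.2.1]; exact hx) a ha).symm⟩
      trans := fun h h' => ⟨h.1.trans h'.1, h.2.1.trans h'.2.1, fun φ hφ hx a ha =>
        (h.2.2 φ hφ hx a ha).trans (h'.2.2 φ hφ (by rw [← h.2.1]; exact hx) a ha)⟩ }

/-- The space `J^k(E)` of `k`-jets of local sections of `E = ℝ × M → ℝ`. -/
def Jet (k : ℕ) : Type _ := Quotient (jetSetoid n M k)

variable {n M}

/-- The jet `j^k_t(γ)` of a pair `(t, γ)`. -/
def Jet.mk (k : ℕ) (p : CurveAt n M) : Jet n M k := Quotient.mk (jetSetoid n M k) p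

/-- The projection `π^k_{-1} : J^k(E) → ℝ`. -/
def Jet.time {k : ℕ} : Jet n M k → ℝ :=
  Quotient.lift (fun p : CurveAt n M => p.1.1) fun _ _ h => h.1

/-- The `M`-component of the projection `π^k_0 : J^k(E) → E = ℝ × M`. -/
def Jet.point {k : ℕ} : Jet n M k → M :=
  Quotient.lift (fun p : CurveAt n M => p.1.2 p.1.1) fun _ _ h => h.2.1

/-- The projection `π^k_0 : J^k(E) → E = ℝ × M`. -/
def Jet.base {k : ℕ} (u : Jet n M k) : ℝ × M := (u.time, u.point)

/-- The projection `π^k_l : J^k(E) → J^l(E)`, for `l ≤ k`. -/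
def Jet.proj {k l : ℕ} (hlk : l ≤ k) : Jet n M k → Jet n M l :=
  Quotient.map' (s₁ := jetSetoid n M k) (s₂ := jetSetoid n M l) id fun _ _ h =>
    ⟨h.1, h.2.1, fun φ hφ hx a ha => h.2.2 φ hφ hx a (ha.trans hlk)⟩

open Classical in
/-- The lift `γ^(k) : t ↦ j^k_t(γ)` of a curve (with a junk value at times where `γ` is not
smooth). -/
def jetLift (n : ℕ) {M : Type*} [TopologicalSpace M] [ChartedSpace (EuclideanSpace ℝ (Fin n)) M]
    (k : ℕ) (γ : ℝ → M) (t : ℝ) : Jet n M k :=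
  if h : ContMDiffAt 𝓘(ℝ, ℝ) (𝓡 n) ∞ γ t then
    Jet.mk k ⟨(t, γ), h⟩
  else Jet.mk k ⟨(t, fun _ => γ t), contMDiffAt_const⟩

open Classical in
/-- The adapted coordinates `(t, y^i, y^i_(1), …, y^i_(k))` of a jet, associated with the coordinates
`φ = (y^i)` of `M`. -/
def jetCoord {k : ℕ} (φ : OpenPartialHomeomorph M (EuclideanSpace ℝ (Fin n)))
    (hφ : φ ∈ IsManifold.maximalAtlas (𝓡 n) ∞ M) : Jet n M k → JetModel n k :=
  Quotient.lift
    (fun p : CurveAt n M => (p.1.1, fun a : Fin (k + 1) =>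
      if p.1.2 p.1.1 ∈ φ.source then iteratedDeriv a (φ ∘ p.1.2) p.1.1 else 0))
    (by
      intro p q h
      refine Prod.ext h.1 (funext fun a => ?_)
      by_cases hp : p.1.2 p.1.1 ∈ φ.source
      · have hq : q.1.2 q.1.1 ∈ φ.source := by rw [← h.2.1]; exact hp
        simp only [if_pos hp, if_pos hq]
        exact h.2.2 φ hφ hp a (Nat.lt_succ_iff.mp a.2)
      · have hq : q.1.2 q.1.1 ∉ φ.source := by rw [← h.2.1]; exact hp
        simp only [if_neg hp, if_neg hq])

/-- The polynomial curve with prescribed derivatives `y_(0), …, y_(k)` at the time `t`. -/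
def taylorCurve {n k : ℕ} (z : JetModel n k) (s : ℝ) : EuclideanSpace ℝ (Fin n) :=
  ∑ a : Fin (k + 1), ((s - z.1) ^ (a : ℕ) / ((a : ℕ).factorial : ℝ)) • z.2 a

lemma contDiff_taylorCurve {n k : ℕ} :
    ContDiff ℝ ∞ (fun q : JetModel n k × ℝ => taylorCurve q.1 q.2) := by
  unfold taylorCurve
  fun_prop

lemma taylorCurve_self {n k : ℕ} (z : JetModel n k) : taylorCurve z z.1 = z.2 0 := by
  rw [taylorCurve, Finset.sum_eq_single 0]
  · simp
  · intro b _ hb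
    have : (b : ℕ) ≠ 0 := fun h => hb (Fin.ext h)
    simp [this]
  · simp

lemma iteratedDeriv_taylorCurve {n k : ℕ} (z : JetModel n k) (a : Fin (k + 1)) :
    iteratedDeriv a (taylorCurve z) z.1 = z.2 a := by
  have h1 : ∀ b : Fin (k + 1), ContDiffAt ℝ (a : ℕ)
      (fun s : ℝ => ((s - z.1) ^ (b : ℕ) / ((b : ℕ).factorial : ℝ)) • z.2 b) z.1 := by
    intro b
    fun_prop
  have h2 : taylorCurve z = fun s : ℝ =>
      ∑ b : Fin (k + 1), ((s - z.1) ^ (b : ℕ) / ((b : ℕ).factorial : ℝ)) • z.2 b := rfl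
  rw [h2, iteratedDeriv_fun_sum (fun b _ => h1 b)]
  have h3 : ∀ b : Fin (k + 1), iteratedDeriv (a : ℕ)
      (fun s : ℝ => ((s - z.1) ^ (b : ℕ) / ((b : ℕ).factorial : ℝ)) • z.2 b) z.1 =
      (if a = b then z.2 b else 0) := by
    intro b
    rw [iteratedDeriv_smul_const (by fun_prop)]
    have h4 : (fun s : ℝ => (s - z.1) ^ (b : ℕ) / ((b : ℕ).factorial : ℝ)) =
        fun s : ℝ => (((b : ℕ).factorial : ℝ)⁻¹) • (fun x : ℝ => x ^ (b : ℕ)) (s - z.1) := by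
      funext s
      simp [div_eq_inv_mul]
    rw [h4, iteratedDeriv_fun_const_smul_field,
      iteratedDeriv_comp_sub_const (a : ℕ) (fun x : ℝ => x ^ (b : ℕ)) z.1]
    simp only [sub_self, iteratedDeriv_fun_pow_zero]
    by_cases hab : a = b
    · subst hab
      have : ((a : ℕ).factorial : ℝ) ≠ 0 := by positivity
      simp [this]
    · have : (a : ℕ) ≠ (b : ℕ) := fun h => hab (Fin.ext h)
      simp [hab, this]
  simp [h3]

/-- The derivatives of `g ∘ c` up to order `k` depend only on those of `c`. -/
lemma iteratedDeriv_comp_congr {F G : Type*} [NormedAddCommGroup F] [NormedSpace ℝ F]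
    [NormedAddCommGroup G] [NormedSpace ℝ G] {g : F → G} {c c' : ℝ → F} {t : ℝ} {k : ℕ}
    (hg : ContDiffAt ℝ ∞ g (c t)) (hc : ContDiffAt ℝ ∞ c t) (hc' : ContDiffAt ℝ ∞ c' t)
    (h : ∀ a ≤ k, iteratedDeriv a c t = iteratedDeriv a c' t) :
    ∀ a ≤ k, iteratedDeriv a (g ∘ c) t = iteratedDeriv a (g ∘ c') t := by
  intro a ha
  have h0 : c t = c' t := by simpa using h 0 (Nat.zero_le _)
  have hF : ∀ b ≤ k, iteratedFDeriv ℝ b c t = iteratedFDeriv ℝ b c' t := by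
    intro b hb
    rw [iteratedFDeriv_eq_equiv_comp, iteratedFDeriv_eq_equiv_comp]
    simp [h b hb]
  have hle : ((a : ℕ) : WithTop ℕ∞) ≤ ∞ := by exact_mod_cast le_top
  rw [iteratedDeriv_eq_iteratedFDeriv, iteratedDeriv_eq_iteratedFDeriv,
    iteratedFDeriv_comp hg hc hle, iteratedFDeriv_comp (h0 ▸ hg) hc' hle, ← h0]
  congr 1
  simp only [FormalMultilinearSeries.taylorComp]
  refine Finset.sum_congr rfl fun P _ => ?_
  have hP : (fun m => ftaylorSeries ℝ c t (P.partSize m)) =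
      fun m => ftaylorSeries ℝ c' t (P.partSize m) :=
    funext fun m => hF _ ((P.partSize_le m).trans ha)
  refine ContinuousMultilinearMap.ext fun v => ?_
  rw [FormalMultilinearSeries.compAlongOrderedFinpartition_apply,
    FormalMultilinearSeries.compAlongOrderedFinpartition_apply, hP]

lemma contDiffAt_taylorCurve {n k : ℕ} (z : JetModel n k) (t : ℝ) :
    ContDiffAt ℝ ∞ (taylorCurve z) t :=
  (contDiff_taylorCurve.comp (contDiff_prodMk_right z)).contDiffAt

lemma jetLift_eq {k : ℕ} {γ : ℝ → M} {t : ℝ} (h : ContMDiffAt 𝓘(ℝ, ℝ) (𝓡 n) ∞ γ t) :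
    jetLift n k γ t = Jet.mk k ⟨(t, γ), h⟩ := by
  rw [jetLift, dif_pos h]

lemma jetLift_point {k : ℕ} (γ : ℝ → M) (t : ℝ) : (jetLift n k γ t).point = γ t := by
  rw [jetLift]
  split_ifs <;> rfl

lemma jetCoord_jetLift {k : ℕ} {φ : OpenPartialHomeomorph M (EuclideanSpace ℝ (Fin n))}
    (hφ : φ ∈ IsManifold.maximalAtlas (𝓡 n) ∞ M) {γ : ℝ → M} {t : ℝ}
    (hγ : ContMDiffAt 𝓘(ℝ, ℝ) (𝓡 n) ∞ γ t) (ht : γ t ∈ φ.source) :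
    jetCoord (k := k) φ hφ (jetLift n k γ t) = (t, fun a : Fin (k + 1) => iteratedDeriv a (φ ∘ γ) t) := by
  rw [jetLift_eq hγ]
  refine Prod.ext rfl (funext fun a => ?_)
  exact if_pos ht

lemma contMDiffAt_symm_taylorCurve {k : ℕ} {φ : OpenPartialHomeomorph M (EuclideanSpace ℝ (Fin n))}
    (hφ : φ ∈ IsManifold.maximalAtlas (𝓡 n) ∞ M) {z : JetModel n k} (hz : z.2 0 ∈ φ.target) :
    ContMDiffAt 𝓘(ℝ, ℝ) (𝓡 n) ∞ (φ.symm ∘ taylorCurve z) z.1 := by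
  have h1 : ContMDiffAt (𝓡 n) (𝓡 n) ∞ φ.symm (taylorCurve z z.1) :=
    contMDiffAt_symm_of_mem_maximalAtlas hφ (by rw [taylorCurve_self]; exact hz)
  exact h1.comp z.1 (contDiffAt_taylorCurve z z.1).contMDiffAt

lemma contDiffAt_chart_comp {φ : OpenPartialHomeomorph M (EuclideanSpace ℝ (Fin n))}
    (hφ : φ ∈ IsManifold.maximalAtlas (𝓡 n) ∞ M) {γ : ℝ → M} {t : ℝ}
    (hγ : ContMDiffAt 𝓘(ℝ, ℝ) (𝓡 n) ∞ γ t) (ht : γ t ∈ φ.source) :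
    ContDiffAt ℝ ∞ (φ ∘ γ) t :=
  ((contMDiffAt_of_mem_maximalAtlas hφ ht).comp t hγ).contDiffAt

lemma contDiffAt_transition {φ ψ : OpenPartialHomeomorph M (EuclideanSpace ℝ (Fin n))}
    (hφ : φ ∈ IsManifold.maximalAtlas (𝓡 n) ∞ M) (hψ : ψ ∈ IsManifold.maximalAtlas (𝓡 n) ∞ M)
    {y : EuclideanSpace ℝ (Fin n)} (hy : y ∈ φ.target) (hy' : φ.symm y ∈ ψ.source) :
    ContDiffAt ℝ ∞ (ψ ∘ φ.symm) y :=
  ((contMDiffAt_of_mem_maximalAtlas hψ hy').comp y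
    (contMDiffAt_symm_of_mem_maximalAtlas hφ hy)).contDiffAt

/-- The system of adapted coordinates on `J^k(E)` associated with the coordinates `φ` of `M`, as a
bijection between `(π^k_0)⁻¹(ℝ × φ.source)` and an open subset of `ℝ^{n(k+1)+1}`. -/
def jetPartialEquiv (k : ℕ) (φ : OpenPartialHomeomorph M (EuclideanSpace ℝ (Fin n)))
    (hφ : φ ∈ IsManifold.maximalAtlas (𝓡 n) ∞ M) : PartialEquiv (Jet n M k) (JetModel n k) where
  toFun := jetCoord φ hφ
  invFun z := jetLift n k (φ.symm ∘ taylorCurve z) z.1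
  source := {u | u.point ∈ φ.source}
  target := {z | z.2 0 ∈ φ.target}
  map_source' := by
    intro u
    refine Quotient.inductionOn u fun p hp => ?_
    have hp' : p.1.2 p.1.1 ∈ φ.source := hp
    have h : (jetCoord (k := k) φ hφ (Quotient.mk _ p)).2 0 = φ (p.1.2 p.1.1) := by
      refine (if_pos hp').trans ?_
      simp
    show (jetCoord (k := k) φ hφ (Quotient.mk _ p)).2 0 ∈ φ.target
    rw [h]
    exact φ.map_source hp'
  map_target' := by
    intro z hz
    show (jetLift n k (φ.symm ∘ taylorCurve z) z.1).point ∈ φ.source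
    rw [jetLift_point, Function.comp_apply, taylorCurve_self]
    exact φ.map_target hz
  left_inv' := by
    intro u
    refine Quotient.inductionOn u fun p hp => ?_
    have hp' : p.1.2 p.1.1 ∈ φ.source := hp
    obtain ⟨z, hz⟩ : ∃ z, z = jetCoord (k := k) φ hφ (Quotient.mk _ p) := ⟨_, rfl⟩
    have hz1 : z.1 = p.1.1 := by rw [hz]; rfl
    have hz2 : ∀ a : Fin (k + 1), z.2 a = iteratedDeriv a (φ ∘ p.1.2) p.1.1 := by
      intro a
      rw [hz]
      exact if_pos hp'
    have hz0 : z.2 0 = φ (p.1.2 p.1.1) := by rw [hz2]; simp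
    have hzt : z.2 0 ∈ φ.target := by rw [hz0]; exact φ.map_source hp'
    rw [← hz, jetLift_eq (contMDiffAt_symm_taylorCurve hφ hzt)]
    have hpt : (φ.symm ∘ taylorCurve z) z.1 = p.1.2 p.1.1 := by
      rw [Function.comp_apply, taylorCurve_self, hz0, φ.left_inv hp']
    refine Quotient.sound ⟨hz1, hpt, fun ψ hψ hx a ha => ?_⟩
    have hx' : p.1.2 p.1.1 ∈ ψ.source := hpt ▸ hx
    have hcurve : ContDiffAt ℝ ∞ (φ ∘ p.1.2) p.1.1 := contDiffAt_chart_comp hφ p.2 hp'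
    have hev : ψ ∘ p.1.2 =ᶠ[𝓝 p.1.1] (ψ ∘ φ.symm) ∘ (φ ∘ p.1.2) := by
      filter_upwards [p.2.continuousAt (φ.open_source.mem_nhds hp')] with s hs
      simp only [Function.comp_apply]
      rw [φ.left_inv hs]
    have hfin : ∀ b ≤ k, iteratedDeriv b (taylorCurve z) z.1 =
        iteratedDeriv b (φ ∘ p.1.2) z.1 := by
      intro b hb
      have h1 := iteratedDeriv_taylorCurve z ⟨b, Nat.lt_succ_of_le hb⟩
      rw [h1, hz2, hz1]
    show iteratedDeriv a (ψ ∘ (φ.symm ∘ taylorCurve z)) z.1 = iteratedDeriv a (ψ ∘ p.1.2) p.1.1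
    rw [hev.iteratedDeriv_eq a, ← hz1]
    refine iteratedDeriv_comp_congr (g := ψ ∘ φ.symm) (c := taylorCurve z) ?_
      (contDiffAt_taylorCurve z z.1) (hz1 ▸ hcurve) hfin a ha
    rw [taylorCurve_self]
    refine contDiffAt_transition hφ hψ hzt ?_
    rw [hz0, φ.left_inv hp']
    exact hx'
  right_inv' := by
    intro z hz
    have hz' : z.2 0 ∈ φ.target := hz
    rw [jetCoord_jetLift hφ (contMDiffAt_symm_taylorCurve hφ hz')
      (by rw [Function.comp_apply, taylorCurve_self]; exact φ.map_target hz')]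
    refine Prod.ext rfl (funext fun a => ?_)
    show iteratedDeriv a (φ ∘ (φ.symm ∘ taylorCurve z)) z.1 = z.2 a
    rw [← iteratedDeriv_taylorCurve z a]
    refine Filter.EventuallyEq.iteratedDeriv_eq _ ?_
    have hc : ContinuousAt (taylorCurve z) z.1 := (contDiffAt_taylorCurve z z.1).continuousAt
    filter_upwards [hc (φ.open_target.mem_nhds (by rw [taylorCurve_self]; exact hz'))] with s hs
    exact φ.right_inv hs

/-- Iterated partial derivatives along the last variable of a smooth function are smooth. -/
lemma contDiffOn_iteratedDeriv_param {F G : Type*} [NormedAddCommGroup F] [NormedSpace ℝ F]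
    [NormedAddCommGroup G] [NormedSpace ℝ G] {Ψ : F × ℝ → G} {O : Set (F × ℝ)} (hO : IsOpen O)
    (hΨ : ContDiffOn ℝ ∞ Ψ O) (a : ℕ) :
    ContDiffOn ℝ ∞ (fun q : F × ℝ => iteratedDeriv a (fun s => Ψ (q.1, s)) q.2) O := by
  induction a with
  | zero => simpa using hΨ
  | succ a ih =>
    have h1 : ContDiffOn ℝ ∞ (fun q : F × ℝ => fderiv ℝ
        (fun q : F × ℝ => iteratedDeriv a (fun s => Ψ (q.1, s)) q.2) q (0, 1)) O :=
      (ih.fderiv_of_isOpen hO (m := ∞) (by simp)).clm_apply contDiffOn_const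
    refine h1.congr fun q hq => ?_
    have h2 : DifferentiableAt ℝ
        (fun q : F × ℝ => iteratedDeriv a (fun s => Ψ (q.1, s)) q.2) q :=
      (ih.differentiableOn (by simp) q hq).differentiableAt (hO.mem_nhds hq)
    have h3 : HasDerivAt (fun s : ℝ => (q.1, s)) ((0 : F), (1 : ℝ)) q.2 :=
      (hasDerivAt_const q.2 q.1).prodMk (hasDerivAt_id q.2)
    have h4 := h2.hasFDerivAt.comp_hasDerivAt (f := fun s : ℝ => (q.1, s)) q.2 h3
    rw [iteratedDeriv_succ]
    exact h4.deriv

lemma jetTransition_source {k : ℕ} {φ ψ : OpenPartialHomeomorph M (EuclideanSpace ℝ (Fin n))}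
    (hφ : φ ∈ IsManifold.maximalAtlas (𝓡 n) ∞ M) (hψ : ψ ∈ IsManifold.maximalAtlas (𝓡 n) ∞ M) :
    ((jetPartialEquiv k φ hφ).symm.trans (jetPartialEquiv k ψ hψ)).source =
      (fun z : JetModel n k => z.2 0) ⁻¹' (φ.symm.trans ψ).source := by
  ext z
  have h : (jetLift n k (φ.symm ∘ taylorCurve z) z.1).point = φ.symm (z.2 0) := by
    rw [jetLift_point, Function.comp_apply, taylorCurve_self]
  rw [PartialEquiv.trans_source, OpenPartialHomeomorph.trans_source]
  show (z.2 0 ∈ φ.target ∧ (jetLift n k (φ.symm ∘ taylorCurve z) z.1).point ∈ ψ.source) ↔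
    (z.2 0 ∈ φ.target ∧ φ.symm (z.2 0) ∈ ψ.source)
  rw [h]

lemma isOpen_jetTransition_source {k : ℕ}
    {φ ψ : OpenPartialHomeomorph M (EuclideanSpace ℝ (Fin n))}
    (hφ : φ ∈ IsManifold.maximalAtlas (𝓡 n) ∞ M) (hψ : ψ ∈ IsManifold.maximalAtlas (𝓡 n) ∞ M) :
    IsOpen ((jetPartialEquiv k φ hφ).symm.trans (jetPartialEquiv k ψ hψ)).source := by
  rw [jetTransition_source]
  exact (φ.symm.trans ψ).open_source.preimage (by fun_prop)

lemma contDiffOn_jetTransition {k : ℕ} {φ ψ : OpenPartialHomeomorph M (EuclideanSpace ℝ (Fin n))}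
    (hφ : φ ∈ IsManifold.maximalAtlas (𝓡 n) ∞ M) (hψ : ψ ∈ IsManifold.maximalAtlas (𝓡 n) ∞ M) :
    ContDiffOn ℝ ∞ ((jetPartialEquiv k φ hφ).symm.trans (jetPartialEquiv k ψ hψ))
      ((jetPartialEquiv k φ hφ).symm.trans (jetPartialEquiv k ψ hψ)).source := by
  have hS := jetTransition_source (k := k) hφ hψ
  let O : Set (JetModel n k × ℝ) :=
    (fun q => taylorCurve q.1 q.2) ⁻¹' (φ.symm.trans ψ).source
  have hO : IsOpen O :=
    (φ.symm.trans ψ).open_source.preimage contDiff_taylorCurve.continuous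
  have hΨ : ContDiffOn ℝ ∞ (fun q : JetModel n k × ℝ => (ψ ∘ φ.symm) (taylorCurve q.1 q.2)) O := by
    intro q hq
    have hq' : taylorCurve q.1 q.2 ∈ (φ.symm.trans ψ).source := hq
    rw [OpenPartialHomeomorph.trans_source] at hq'
    exact ((contDiffAt_transition hφ hψ hq'.1 hq'.2).comp q
      contDiff_taylorCurve.contDiffAt).contDiffWithinAt
  have hmain : ContDiffOn ℝ ∞ (fun z : JetModel n k => ((z.1, fun a : Fin (k + 1) =>
      iteratedDeriv a (fun s => (ψ ∘ φ.symm) (taylorCurve z s)) z.1) : JetModel n k))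
      ((jetPartialEquiv k φ hφ).symm.trans (jetPartialEquiv k ψ hψ)).source := by
    refine contDiffOn_fst.prodMk (contDiffOn_pi.2 fun a => ?_)
    refine (contDiffOn_iteratedDeriv_param hO hΨ a).comp
      (f := fun z : JetModel n k => (z, z.1)) (by fun_prop) fun z hz => ?_
    rw [hS] at hz
    show taylorCurve z z.1 ∈ (φ.symm.trans ψ).source
    rw [taylorCurve_self]
    exact hz
  refine hmain.congr fun z hz => ?_
  rw [hS, OpenPartialHomeomorph.trans_source] at hz
  have hz1 : z.2 0 ∈ φ.target := hz.1
  have hz2 : φ.symm (z.2 0) ∈ ψ.source := hz.2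
  exact jetCoord_jetLift hψ (contMDiffAt_symm_taylorCurve hφ hz1)
    (by rw [Function.comp_apply, taylorCurve_self]; exact hz2)

variable [IsManifold (𝓡 n) ∞ M]

variable (n M) in
/-- The atlas of `J^k(E)` given by all systems of adapted coordinates. -/
def jetCore (k : ℕ) : ChartedSpaceCore (JetModel n k) (Jet n M k) where
  atlas := {e | ∃ φ, ∃ hφ : φ ∈ IsManifold.maximalAtlas (𝓡 n) ∞ M, e = jetPartialEquiv k φ hφ}
  chartAt u := jetPartialEquiv k (chartAt (EuclideanSpace ℝ (Fin n)) u.point)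
    (IsManifold.chart_mem_maximalAtlas u.point)
  mem_chart_source u := mem_chart_source (EuclideanSpace ℝ (Fin n)) u.point
  chart_mem_atlas u := ⟨_, _, rfl⟩
  open_source := by
    rintro _ _ ⟨φ, hφ, rfl⟩ ⟨ψ, hψ, rfl⟩
    exact isOpen_jetTransition_source hφ hψ
  continuousOn_toFun := by
    rintro _ _ ⟨φ, hφ, rfl⟩ ⟨ψ, hψ, rfl⟩
    exact (contDiffOn_jetTransition hφ hψ).continuousOn

instance instTopologicalSpaceJet (k : ℕ) : TopologicalSpace (Jet n M k) :=
  (jetCore n M k).toTopologicalSpace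

instance instChartedSpaceJet (k : ℕ) : ChartedSpace (JetModel n k) (Jet n M k) :=
  (jetCore n M k).toChartedSpace

/-- The system of adapted coordinates of `J^k(E)` associated with the coordinates `φ` of `M`. -/
def jetChart (k : ℕ) (φ : OpenPartialHomeomorph M (EuclideanSpace ℝ (Fin n)))
    (hφ : φ ∈ IsManifold.maximalAtlas (𝓡 n) ∞ M) :
    OpenPartialHomeomorph (Jet n M k) (JetModel n k) :=
  (jetCore n M k).openPartialHomeomorph (jetPartialEquiv k φ hφ) ⟨φ, hφ, rfl⟩

instance instIsManifoldJet (k : ℕ) : IsManifold 𝓘(ℝ, JetModel n k) ∞ (Jet n M k) := by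
  refine isManifold_of_contDiffOn _ _ _ fun e e' he he' => ?_
  simp only [atlas, ChartedSpace.atlas, mem_iUnion, mem_singleton_iff] at he he'
  obtain ⟨_, ⟨φ, hφ, rfl⟩, rfl⟩ := he
  obtain ⟨_, ⟨ψ, hψ, rfl⟩, rfl⟩ := he'
  have h := contDiffOn_jetTransition (k := k) hφ hψ
  simpa using! h

end Jets

section Variational

variable {n k : ℕ} {M : Type*} [TopologicalSpace M] [ChartedSpace (EuclideanSpace ℝ (Fin n)) M]
  [IsManifold (𝓡 n) ∞ M]

variable (n k M) in
/-- Vector fields on `J^k(E)`. -/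
abbrev JField : Type _ := VField (JetModel n k) (Jet n M k)

variable (n k M) in
/-- `p`-forms on `J^k(E)`. -/
abbrev JForm (p : ℕ) : Type _ := PForm (JetModel n k) (Jet n M k) p

/-- `γ` is smooth on a neighbourhood of `t`. -/
def SmoothCurveNear (n : ℕ) {M : Type*} [TopologicalSpace M]
    [ChartedSpace (EuclideanSpace ℝ (Fin n)) M] (γ : ℝ → M) (t : ℝ) : Prop :=
  ∀ᶠ s in 𝓝 t, ContMDiffAt 𝓘(ℝ, ℝ) (𝓡 n) ∞ γ s

variable (n k) in
/-- The velocity `dγ^(k)/dt` at the time `t`, a tangent vector of `J^k(E)` at `γ^(k)(t)`. -/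
def jetVelocity (γ : ℝ → M) (t : ℝ) : JetModel n k :=
  mfderiv 𝓘(ℝ, ℝ) 𝓘(ℝ, JetModel n k) (jetLift n k γ) t (1 : ℝ)

/-- The holonomic distribution `𝒟_u ⊆ T_u J^k(E)`: the span of the velocities at `u` of the lifts
of the local sections with `k`-jet `u`. -/
def holonomicDist (u : Jet n M k) : Submodule ℝ (JetModel n k) :=
  Submodule.span ℝ {v | ∃ (γ : ℝ → M) (t : ℝ), SmoothCurveNear n γ t ∧ jetLift n k γ t = u ∧
    v = jetVelocity n k γ t}

/-- Holonomic `p`-forms on `U`: for `p ≥ 1` the contractions with all holonomic vectors vanish, a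
holonomic `0`-form vanishes identically. -/
def HolonomicOn (U : Set (Jet n M k)) : {p : ℕ} → JForm n k M p → Prop
  | 0, θ => ∀ u ∈ U, θ u = 0
  | _ + 1, θ => ∀ u ∈ U, ∀ v ∈ holonomicDist u, (θ u).curryLeft v = 0

/-- Variational equivalence on `U` of two `p`-forms, `p ≥ 1`. -/
def VarEquivOn (U : Set (Jet n M k)) {p : ℕ} (θ θ' : JForm n k M (p + 1)) : Prop :=
  ∃ (lam : JForm n k M (p + 1)) (mu : JForm n k M p), lam.SmoothOn U ∧ mu.SmoothOn U ∧
    HolonomicOn U lam ∧ HolonomicOn U mu ∧ ∀ u ∈ U, θ u - θ' u = lam u + mu.d u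

/-- The restriction to `U` of the `p`-form `θ` is of order `r`: it is the pull-back by `π^k_r` of a
`p`-form on an open subset of `J^r(E)`. -/
def HasOrderOn (U : Set (Jet n M k)) {p : ℕ} (θ : JForm n k M p) (r : ℕ) : Prop :=
  ∃ (hr : r ≤ k) (V : Set (Jet n M r)) (β : JForm n r M p), IsOpen V ∧ β.SmoothOn V ∧
    MapsTo (Jet.proj hr) U V ∧ ∀ u ∈ U, θ u = PForm.pullback (Jet.proj hr) β u

/-- The `1`-form `L dt`. -/
def lagrangianForm (L : Jet n M k → ℝ) : JForm n k M 1 := fun u =>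
  let dt : JetModel n k →L[ℝ] ℝ :=
    mfderiv 𝓘(ℝ, JetModel n k) 𝓘(ℝ, ℝ) (Jet.time : Jet n M k → ℝ) u
  L u • ContinuousAlternatingMap.ofSubsingleton ℝ (JetModel n k) ℝ (0 : Fin 1) dt

/-- On `U`, the `1`-form `α` is locally variationally equivalent to `1`-forms `L dt` of order `r`. -/
def LocallyLagrangianOn (U : Set (Jet n M k)) (α : JForm n k M 1) (r : ℕ) : Prop :=
  ∀ u ∈ U, ∃ (V : Set (Jet n M k)) (L : Jet n M k → ℝ), IsOpen V ∧ u ∈ V ∧ V ⊆ U ∧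
    ContMDiffOn 𝓘(ℝ, JetModel n k) 𝓘(ℝ, ℝ) ∞ L V ∧ HasOrderOn V (lagrangianForm L) r ∧
    VarEquivOn V α (lagrangianForm L)

/-- Source forms on `U`: the contractions with the vectors in the kernel of `(π^k_0)_*` vanish. -/
def IsSourceOn (U : Set (Jet n M k)) (σ : JForm n k M 2) : Prop :=
  ∀ u ∈ U, ∀ v : JetModel n k,
    mfderiv 𝓘(ℝ, JetModel n k) (𝓘(ℝ, ℝ).prod (𝓡 n)) (Jet.base : Jet n M k → ℝ × M) u v = 0 →
      (σ u).curryLeft v = 0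

/-- On `U`, the `1`-form `α₀` belongs to the variational class `[α]` and is of Poincaré-Cartan type:
`d α₀` is a source form modulo a holonomic `2`-form. -/
def IsPoincareCartanOn (U : Set (Jet n M k)) (α α₀ : JForm n k M 1) : Prop :=
  α₀.SmoothOn U ∧ VarEquivOn U α₀ α ∧ ∃ σ lam : JForm n k M 2, σ.SmoothOn U ∧ lam.SmoothOn U ∧
    IsSourceOn U σ ∧ HolonomicOn U lam ∧ ∀ u ∈ U, α₀.d u = σ u + lam u

/-! The action, its variational principle and the constants of motion. -/

/-- The action `∫_{γ^(k)([a,b])} α`. -/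
def action (α : JForm n k M 1) (γ : ℝ → M) (a b : ℝ) : ℝ :=
  ∫ t in a..b, α (jetLift n k γ t) ![jetVelocity n k γ t]

/-- `F` is a smooth variation on `[a,b] × [-ε,ε]`, with fixed boundary up to order `r`, of the
section `γ`, through sections whose lifts to `J^k(E)` take values in `W`. (The smoothness on the
closed rectangle means that `F` is smooth on an open set containing it.) -/
def IsVariation (W : Set (Jet n M k)) (r : ℕ) (γ : ℝ → M) (a b ε : ℝ) (F : ℝ × ℝ → M) : Prop :=
  (∃ O : Set (ℝ × ℝ), IsOpen O ∧ Icc a b ×ˢ Icc (-ε) ε ⊆ O ∧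
    ContMDiffOn 𝓘(ℝ, ℝ × ℝ) (𝓡 n) ∞ F O) ∧
  (∀ t ∈ Icc a b, F (t, 0) = γ t) ∧
  (∀ s ∈ Icc (-ε) ε, ∀ t ∈ Icc a b, jetLift n k (fun τ => F (τ, s)) t ∈ W) ∧
  (∀ s ∈ Icc (-ε) ε, jetLift n r (fun τ => F (τ, s)) a = jetLift n r γ a ∧
    jetLift n r (fun τ => F (τ, s)) b = jetLift n r γ b)

/-- The section `γ`, defined on the open interval `I` and with `γ^(k)(I) ⊆ W`, satisfies the
variational principle of the action `ℐ_[α]`, where `α` is a `1`-form of order `r` on `W`. -/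
def IsSolution (W : Set (Jet n M k)) (α : JForm n k M 1) (r : ℕ) (I : Set ℝ) (γ : ℝ → M) : Prop :=
  IsOpen I ∧ I.OrdConnected ∧ ContMDiffOn 𝓘(ℝ, ℝ) (𝓡 n) ∞ γ I ∧
  (∀ t ∈ I, jetLift n k γ t ∈ W) ∧
  ∀ a b : ℝ, a < b → Icc a b ⊆ I → ∀ ε > 0, ∀ F : ℝ × ℝ → M, IsVariation W r γ a b ε F →
    HasDerivAt (fun s => action α (fun τ => F (τ, s)) a b) 0 0

/-- The smooth function `f` on `U` is a constant of motion for `ℐ_[α]`. -/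
def IsConstantOfMotionOn (W : Set (Jet n M k)) (α : JForm n k M 1) (r : ℕ) (U : Set (Jet n M k))
    (f : Jet n M k → ℝ) : Prop :=
  ContMDiffOn 𝓘(ℝ, JetModel n k) 𝓘(ℝ, ℝ) ∞ f U ∧
  ∀ (I : Set ℝ) (γ : ℝ → M), IsSolution W α r I γ → ∀ t ∈ I, jetLift n k γ t ∈ U →
    HasDerivAt (fun s => f (jetLift n k γ s)) 0 t

/-- The function `f` vanishes at all points in `U` of the lifts of solutions. -/
def VanishesOnSolutions (W : Set (Jet n M k)) (α : JForm n k M 1) (r : ℕ) (U : Set (Jet n M k))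
    (f : Jet n M k → ℝ) : Prop :=
  ∀ (I : Set ℝ) (γ : ℝ → M), IsSolution W α r I γ → ∀ t ∈ I, jetLift n k γ t ∈ U →
    f (jetLift n k γ t) = 0

/-- The space `𝔆𝔬𝔫𝔰𝔱𝔐𝔬𝔱` of germs at `u₀` of constants of motion. -/
def ConstMot (W : Set (Jet n M k)) (α : JForm n k M 1) (r : ℕ) (u₀ : Jet n M k) :
    Submodule ℝ ((𝓝 u₀).Germ ℝ) where
  carrier := {g | ∃ (f : Jet n M k → ℝ) (U : Set (Jet n M k)), IsOpen U ∧ u₀ ∈ U ∧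
    IsConstantOfMotionOn W α r U f ∧ g = (f : (𝓝 u₀).Germ ℝ)}
  zero_mem' := ⟨fun _ => 0, univ, isOpen_univ, mem_univ _,
    ⟨contMDiffOn_const, fun _ _ _ _ _ _ => hasDerivAt_const _ _⟩, rfl⟩
  add_mem' := by
    rintro _ _ ⟨f, U, hU, hu, hf, rfl⟩ ⟨g, V, hV, hv, hg, rfl⟩
    refine ⟨f + g, U ∩ V, hU.inter hV, ⟨hu, hv⟩, ⟨(hf.1.mono inter_subset_left).add
      (hg.1.mono inter_subset_right), fun I γ hγ t ht hUV => ?_⟩, rfl⟩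
    have h := (hf.2 I γ hγ t ht hUV.1).add (hg.2 I γ hγ t ht hUV.2)
    rw [add_zero] at h
    exact h
  smul_mem' := by
    rintro c _ ⟨f, U, hU, hu, hf, rfl⟩
    refine ⟨c • f, U, hU, hu, ⟨(contDiff_const_smul c).contMDiff.comp_contMDiffOn hf.1,
      fun I γ hγ t ht hUt => ?_⟩, rfl⟩
    have h := (hf.2 I γ hγ t ht hUt).const_smul c
    rw [smul_zero] at h
    exact h

/-- The space `𝔑𝔲𝔩𝔩` of germs at `u₀` of constants of motion vanishing at the points of solutions. -/
def NullMot (W : Set (Jet n M k)) (α : JForm n k M 1) (r : ℕ) (u₀ : Jet n M k) :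
    Submodule ℝ (ConstMot W α r u₀) where
  carrier := {g | ∃ (f : Jet n M k → ℝ) (U : Set (Jet n M k)), IsOpen U ∧ u₀ ∈ U ∧
    VanishesOnSolutions W α r U f ∧ g.1 = (f : (𝓝 u₀).Germ ℝ)}
  zero_mem' := ⟨fun _ => 0, univ, isOpen_univ, mem_univ _, fun _ _ _ _ _ _ => rfl, rfl⟩
  add_mem' := by
    rintro x y ⟨f, U, hU, hu, hf, hx⟩ ⟨g, V, hV, hv, hg, hy⟩
    refine ⟨f + g, U ∩ V, hU.inter hV, ⟨hu, hv⟩, fun I γ hγ t ht hUV => ?_, ?_⟩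
    · simp [hf I γ hγ t ht hUV.1, hg I γ hγ t ht hUV.2]
    · rw [Submodule.coe_add, hx, hy]
      rfl
  smul_mem' := by
    rintro c x ⟨f, U, hU, hu, hf, hx⟩
    refine ⟨c • f, U, hU, hu, fun I γ hγ t ht hUt => ?_, ?_⟩
    · simp [hf I γ hγ t ht hUt]
    · rw [Submodule.coe_smul, hx]
      rfl

/-! Infinitesimal symmetries. -/

/-- The vector field `X` is a `𝒟`-symmetry on `U`: for every (locally defined) holonomic vector
field `Y`, the Lie derivative `ℒ_X Y = [X, Y]` is holonomic. -/
def IsDSymmetryOn (U : Set (Jet n M k)) (X : JField n k M) : Prop :=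
  ∀ V : Set (Jet n M k), IsOpen V → V ⊆ U → ∀ Y : JField n k M, (∀ u ∈ V, Y.SmoothAt u) →
    (∀ u ∈ V, Y u ∈ holonomicDist u) →
      ∀ u ∈ V, VectorField.mlieBracket 𝓘(ℝ, JetModel n k) X Y u ∈ holonomicDist u

/-- The smooth vector field `X` on `U` is an infinitesimal symmetry for `ℐ_[α]`. -/
def IsInfSymmetryOn (U : Set (Jet n M k)) (α : JForm n k M 1) (X : JField n k M) : Prop :=
  (∀ u ∈ U, X.SmoothAt u) ∧ IsDSymmetryOn U X ∧ HolonomicOn U (PForm.lieDeriv X α)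

/-- The set `Σ^{(α₀)}` of germs at `u₀` of `α₀`-symmetries, i.e. of infinitesimal symmetries `X` for
`ℐ_[α]` with `ℒ_X α₀ = 0`; here `α` and `α₀` are defined on `W`. -/
def alphaSymmetryGerms (W : Set (Jet n M k)) (α α₀ : JForm n k M 1) (u₀ : Jet n M k) :
    Set (VFGerm (JetModel n k) u₀) :=
  {g | ∃ (X : smoothNear (JetModel n k) u₀) (U : Set (Jet n M k)), IsOpen U ∧ u₀ ∈ U ∧ U ⊆ W ∧
    IsInfSymmetryOn U α X.1 ∧ (∀ u ∈ U, PForm.lieDeriv X.1 α₀ u = 0) ∧ g = VFGerm.mk X}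

/-! The non-degeneracy conditions. -/

/-- The vector `d/dt = ∂/∂t + ∑_{a < k} y^i_(a+1) ∂/∂y^i_(a)` at the point with adapted
coordinates `z`. -/
def totalVec (z : JetModel n k) : JetModel n k :=
  (1, fun a => if h : (a : ℕ) + 1 < k + 1 then z.2 ⟨a + 1, h⟩ else 0)

/-- The function `dg/dt`, in adapted coordinates. -/
def totalDeriv (g : JetModel n k → ℝ) (z : JetModel n k) : ℝ := fderiv ℝ g z (totalVec z)

/-- The points of `W`, in the adapted coordinates associated with `φ`. -/
def coordSet (W : Set (Jet n M k)) (φ : OpenPartialHomeomorph M (EuclideanSpace ℝ (Fin n)))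
    (hφ : φ ∈ IsManifold.maximalAtlas (𝓡 n) ∞ M) : Set (JetModel n k) :=
  {z | z ∈ (jetChart k φ hφ).target ∧ (jetChart k φ hφ).symm z ∈ W}

/-- The expression of a `p`-form in the adapted coordinates associated with `φ`. -/
def coordForm {p : ℕ} (θ : JForm n k M p) (φ : OpenPartialHomeomorph M (EuclideanSpace ℝ (Fin n)))
    (hφ : φ ∈ IsManifold.maximalAtlas (𝓡 n) ∞ M) : PForm (JetModel n k) (JetModel n k) p :=
  PForm.pullback (jetChart k φ hφ).symm θ

/-- The component `σ_i = σ(∂/∂y^i, ∂/∂t)` of a `2`-form in the adapted coordinates associated with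
`φ`. -/
def sourceComponent (σ : JForm n k M 2) (φ : OpenPartialHomeomorph M (EuclideanSpace ℝ (Fin n)))
    (hφ : φ ∈ IsManifold.maximalAtlas (𝓡 n) ∞ M) (i : Fin n) (z : JetModel n k) : ℝ :=
  coordForm σ φ hφ z ![(0, Pi.single 0 (EuclideanSpace.single i (1 : ℝ))), (1, 0)]

/-- In all adapted coordinates, `σ = ∑ σ_i ω^i_(0) ∧ dt` with `ω^i_(0) = dy^i - y^i_(1) dt`; note
that `ω^i_(0) ∧ dt = dy^i ∧ dt`. -/
def IsCanonicalSourceOn (W : Set (Jet n M k)) (σ : JForm n k M 2) : Prop :=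
  ∀ φ hφ, ∀ z ∈ coordSet W φ hφ, ∀ v w : JetModel n k,
    coordForm σ φ hφ z ![v, w] =
      ∑ i : Fin n, sourceComponent σ φ hφ i z * (v.2 0 i * w.1 - w.2 0 i * v.1)

/-- The map `F_σ = (σ_i, dσ_i/dt, …, (d/dt)^p σ_i)` in adapted coordinates. -/
def prolongation (σ : JForm n k M 2) (φ : OpenPartialHomeomorph M (EuclideanSpace ℝ (Fin n)))
    (hφ : φ ∈ IsManifold.maximalAtlas (𝓡 n) ∞ M) (p : ℕ) (z : JetModel n k) :
    Fin (p + 1) → Fin n → ℝ :=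
  fun b i => totalDeriv^[b] (sourceComponent σ φ hφ i) z

/-- Regularity on `W` of the Euler-Lagrange equations `σ_i = 0` given by a source form `σ` of
order `r₀`: the map `F_σ`, with `p = k - r₀`, is a submersion at all its zeros. -/
def IsRegularOn (W : Set (Jet n M k)) (σ : JForm n k M 2) (r₀ : ℕ) : Prop :=
  ∀ φ hφ, ∀ z ∈ coordSet W φ hφ, prolongation σ φ hφ (k - r₀) z = 0 →
    Function.Surjective (fderiv ℝ (prolongation σ φ hφ (k - r₀)) z)

/-- The condition `α₀(d/dt) ≠ 0` at all points of `W`. -/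
def NonvanishingOn (W : Set (Jet n M k)) (α₀ : JForm n k M 1) : Prop :=
  ∀ φ hφ, ∀ z ∈ coordSet W φ hφ, coordForm α₀ φ hφ z ![totalVec z] ≠ 0

end Variational

end

end JetNoether

open JetNoether

attribute [local instance] LieRing.ofAssociativeRing

/-! The core is an intrinsic description of solutions. A section whose lift stays in `W` is a
solution exactly when the velocity of its lift lies in the kernel of `d α₀` (`IsCritical`). The
forms `α` and `α₀` agree on holonomic vectors, so the action may be computed with `α₀`. Its first
variation is then the integral of `d α₀` on the pair (variation field, velocity), plus the values of
`α₀` on the variation field at the endpoints (`hasDerivAt_action`).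

The endpoint terms vanish. A variation with fixed `r`-jets moves only coordinates of order greater
than `r`, and `α₀` has no components along these (`IsPoincareCartanOn.cov_single_eq_zero`). This is
a descending induction on the order. It starts because `α₀` has order at most `k - 1`, and it
continues because `d α₀` vanishes on a pair of a vector vertical over `E` and a holonomic vector,
while `α₀(d/dt) = α(d/dt)` involves only coordinates of order at most `r + 1`. Hence critical
sections are solutions (`isSolution_of_isCritical`). Conversely, variations by bump functions and
the fundamental lemma of the calculus of variations give the vanishing of `d α₀(∂/∂y_(0), velocity)`
along a solution, and the Poincaré-Cartan condition extends this to all vectors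
(`IsSolution.isCritical`).

An `α₀`-symmetry `X` preserves both ingredients of criticality. Its local flow preserves the
holonomic distribution, because brackets of `X` with holonomic fields are holonomic, and it
preserves `d α₀`, because `ℒ_X α₀ = 0`. Each statement is turned into a homogeneous linear ODE for a
quantity that vanishes at time `0`. So the flow at a small time carries the lift of a solution to a
curve of contact vectors in the kernel of `d α₀`. Its time component still has nonzero speed, so
reparametrising by time gives the lift of a new solution (`exists_flow_of_solutions`). A constant of
motion `f` is therefore constant along every flowed curve. Differentiating in the flow time at `0`
shows that `X(f)` is constant along the original solution, and that `X(f)` vanishes there when `f`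
vanishes on all solutions. Thus `ρ` is well defined.

The flow must be differentiable in the initial point, with a derivative that solves the variational
equation. This is obtained by solving the integral equation in a Banach space of continuous curves
with the inverse function theorem.

The algebraic part rests on two facts. The Lie derivative along a bracket is the commutator of Lie
derivatives, and contact fields preserve holonomic `1`-forms. So symmetries are closed under
brackets, and the representation identity is the action of a bracket on functions. -/

namespace JetNoether

noncomputable section

/-! Superposition operators on spaces of continuous functions. -/

section Superposition

universe u

variable {K : Type*} [TopologicalSpace K] [CompactSpace K]

/-- Pointwise application of a continuous family of operators to a continuous function. -/
def pointwiseApply (K : Type*) [TopologicalSpace K] [CompactSpace K]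
    (E F : Type*) [NormedAddCommGroup E] [NormedSpace ℝ E]
    [NormedAddCommGroup F] [NormedSpace ℝ F] :
    C(K, E →L[ℝ] F) →L[ℝ] C(K, E) →L[ℝ] C(K, F) :=
  LinearMap.mkContinuous₂
    (LinearMap.mk₂ ℝ (fun (A : C(K, E →L[ℝ] F)) (h : C(K, E)) =>
      (⟨fun x => A x (h x), A.continuous.clm_apply h.continuous⟩ : C(K, F)))
      (fun A A' h => by ext x; simp) (fun c A h => by ext x; simp)
      (fun A h h' => by ext x; simp) (fun c A h => by ext x; simp)) 1
    (fun A h => by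
      rw [one_mul]
      refine (ContinuousMap.norm_le _ (by positivity)).2 fun x => ?_
      exact ((A x).le_opNorm _).trans (mul_le_mul (A.norm_coe_le_norm x) (h.norm_coe_le_norm x)
        (norm_nonneg _) (by positivity)))

lemma pointwiseApply_apply {E F : Type*} [NormedAddCommGroup E] [NormedSpace ℝ E]
    [NormedAddCommGroup F] [NormedSpace ℝ F] (A : C(K, E →L[ℝ] F)) (h : C(K, E)) (x : K) :
    pointwiseApply K E F A h x = A x (h x) := rfl

/-- Compact support makes `fderiv ℝ ξ` uniformly continuous. The mean value inequality on balls of a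
common radius then bounds the remainder uniformly in the point of `K`. -/
lemma hasFDerivAt_superposition {E F : Type*} [NormedAddCommGroup E] [NormedSpace ℝ E]
    [NormedAddCommGroup F] [NormedSpace ℝ F] {ξ : E → F} (hξ : ContDiff ℝ ∞ ξ)
    (hs : HasCompactSupport ξ) (c : C(K, E)) :
    HasFDerivAt (fun c : C(K, E) => (⟨ξ, hξ.continuous⟩ : C(E, F)).comp c)
      (pointwiseApply K E F ((⟨fderiv ℝ ξ, hξ.continuous_fderiv (by simp)⟩ :
        C(E, E →L[ℝ] F)).comp c)) c := by
  have hu : UniformContinuous (fderiv ℝ ξ) :=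
    (hξ.continuous_fderiv (by simp)).uniformContinuous_of_tendsto_cocompact
      (hs.fderiv ℝ).is_zero_at_infty
  rw [hasFDerivAt_iff_isLittleO_nhds_zero, Asymptotics.isLittleO_iff]
  intro ε hε
  obtain ⟨δ, hδ, hd⟩ := Metric.uniformContinuous_iff.1 hu ε hε
  filter_upwards [Metric.ball_mem_nhds (0 : C(K, E)) hδ] with h hh
  refine (ContinuousMap.norm_le _ (by positivity)).2 fun x => ?_
  have hx : ‖h x‖ ≤ ‖h‖ := h.norm_coe_le_norm x
  have hlt : ‖h‖ < δ := by simpa using hh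
  have key := Convex.norm_image_sub_le_of_norm_hasFDerivWithin_le' (f := ξ)
    (f' := fderiv ℝ ξ) (φ := fderiv ℝ ξ (c x)) (C := ε)
    (s := Metric.ball (c x) δ) (x := c x) (y := c x + h x)
    (fun y _ => ((hξ.differentiable (by simp)) y).hasFDerivAt.hasFDerivWithinAt)
    (fun y hy => by
      have := hd (a := y) (b := c x) hy
      rw [dist_eq_norm] at this
      exact this.le)
    (convex_ball _ _) (Metric.mem_ball_self hδ) (by simpa using hx.trans_lt hlt)
  refine le_trans ?_ (key.trans ?_)
  · simp [pointwiseApply_apply]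
  · rw [add_sub_cancel_left]
    exact mul_le_mul_of_nonneg_left hx hε.le

/-- The derivative at `c` is pointwise application of the superposition operator of `fderiv ℝ ξ`,
which is again smooth with compact support. The target changes from `F` to `E →L[ℝ] F` at each step,
so `F` is quantified inside the induction and shares the universe of `E`. -/
lemma contDiff_superposition_nat {E : Type u} [NormedAddCommGroup E] [NormedSpace ℝ E] (m : ℕ) :
    ∀ {F : Type u} [NormedAddCommGroup F] [NormedSpace ℝ F] {ξ : E → F} (hξ : ContDiff ℝ ∞ ξ)
    (_ : HasCompactSupport ξ),
    ContDiff ℝ m (fun c : C(K, E) => (⟨ξ, hξ.continuous⟩ : C(E, F)).comp c) := by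
  induction m with
  | zero =>
    intro F _ _ ξ hξ _
    exact contDiff_zero.2 (ContinuousMap.continuous_postcomp _)
  | succ m ih =>
    intro F _ _ ξ hξ hs
    have hd : fderiv ℝ (fun c : C(K, E) => (⟨ξ, hξ.continuous⟩ : C(E, F)).comp c) = fun c =>
        pointwiseApply K E F ((⟨fderiv ℝ ξ, hξ.continuous_fderiv (by simp)⟩ :
          C(E, E →L[ℝ] F)).comp c) :=
      funext fun c => (hasFDerivAt_superposition hξ hs c).fderiv
    have h2 : ContDiff ℝ ∞ (fderiv ℝ ξ) := hξ.fderiv_right (by simp)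
    push_cast
    refine contDiff_succ_iff_fderiv.2
      ⟨fun c => (hasFDerivAt_superposition hξ hs c).differentiableAt, by simp, ?_⟩
    rw [hd]
    exact (pointwiseApply K E F).contDiff.comp (ih h2 (hs.fderiv ℝ))

lemma contDiff_superposition {E : Type*} [NormedAddCommGroup E] [NormedSpace ℝ E]
    {ξ : E → E} (hξ : ContDiff ℝ ∞ ξ) (hs : HasCompactSupport ξ) :
    ContDiff ℝ ∞ (fun c : C(K, E) => (⟨ξ, hξ.continuous⟩ : C(E, E)).comp c) :=
  contDiff_infty.2 fun m => contDiff_superposition_nat m hξ hs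

end Superposition

/-! Smooth dependence on the initial data of the integral curves of a vector field. -/

section Flow

variable {H : Type*} [NormedAddCommGroup H] [NormedSpace ℝ H]

/-- The primitive vanishing at the time `0` of a continuous curve on `[-ε, ε]`. -/
def primitiveCLM (H : Type*) [NormedAddCommGroup H] [NormedSpace ℝ H] [CompleteSpace H]
    {ε : ℝ} (hε : 0 ≤ ε) : C(Icc (-ε) ε, H) →L[ℝ] C(Icc (-ε) ε, H) :=
  have hle : -ε ≤ ε := by linarith
  LinearMap.mkContinuous
    { toFun := fun c => ⟨fun τ => ∫ σ in (0 : ℝ)..τ, IccExtend hle c σ,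
        (intervalIntegral.continuous_primitive
          (fun a b => (c.continuous.Icc_extend' (h := hle)).intervalIntegrable a b) 0).comp
          continuous_subtype_val⟩
      map_add' := fun c c' => by
        ext τ
        exact intervalIntegral.integral_add
          ((c.continuous.Icc_extend' (h := hle)).intervalIntegrable _ _)
          ((c'.continuous.Icc_extend' (h := hle)).intervalIntegrable _ _)
      map_smul' := fun r c => by
        ext τ
        exact intervalIntegral.integral_smul r _ } ε
    (fun c => by
      refine (ContinuousMap.norm_le _ (by positivity)).2 fun τ => ?_
      have h := intervalIntegral.norm_integral_le_of_norm_le_const (a := (0 : ℝ)) (b := τ)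
        (f := IccExtend hle c) (C := ‖c‖) (fun σ _ => c.norm_coe_le_norm (projIcc (-ε) ε hle σ))
      refine h.trans ?_
      rw [mul_comm]
      refine mul_le_mul_of_nonneg_right ?_ (norm_nonneg _)
      rw [sub_zero]
      exact abs_le.2 τ.2)

lemma norm_primitiveCLM_le [CompleteSpace H] {ε : ℝ} (hε : 0 ≤ ε) : ‖primitiveCLM H hε‖ ≤ ε := by
  unfold primitiveCLM
  exact LinearMap.mkContinuous_norm_le _ hε _

/-- Turns a fixed-point equation in the space of curves back into an ODE. It serves twice: for the
flow and for its derivative in the initial point. -/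
lemma hasDerivAt_of_eq_primitive [CompleteSpace H] {ε : ℝ} (hε : 0 ≤ ε) {c g : C(Icc (-ε) ε, H)} {x : H}
    (h : c = ContinuousMap.const _ x + primitiveCLM H hε g) {s : ℝ} (hs : s ∈ Ioo (-ε) ε) :
    HasDerivAt (IccExtend (by linarith : -ε ≤ ε) c)
      (IccExtend (by linarith : -ε ≤ ε) g s) s := by
  have hle : -ε ≤ ε := by linarith
  have hg := g.continuous.Icc_extend' (h := hle)
  have h1 : HasDerivAt (fun s => x + ∫ σ in (0 : ℝ)..s, IccExtend hle g σ)
      (IccExtend hle g s) s :=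
    (intervalIntegral.integral_hasDerivAt_right (hg.intervalIntegrable _ _)
      (hg.stronglyMeasurableAtFilter _ _) hg.continuousAt).const_add x
  refine h1.congr_of_eventuallyEq ?_
  filter_upwards [isOpen_Ioo.mem_nhds hs] with σ hσ
  rw [IccExtend_of_mem hle _ (Ioo_subset_Icc_self hσ), h]
  rfl

/-- The flow of a smooth compactly supported vector field, on a short time interval. -/
theorem exists_flow_of_hasCompactSupport [FiniteDimensional ℝ H] {ξ : H → H}
    (hξ : ContDiff ℝ ∞ ξ) (hs : HasCompactSupport ξ) :
    ∃ ε > 0, ∃ Φ : H → ℝ → H, (∀ x, Φ x 0 = x) ∧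
      (∀ x, ∀ s ∈ Ioo (-ε) ε, HasDerivAt (Φ x) (ξ (Φ x s)) s) ∧
      (∀ s, ContDiff ℝ ∞ fun x => Φ x s) ∧
      (∀ x w, ∀ s ∈ Ioo (-ε) ε, HasDerivAt (fun s => fderiv ℝ (fun x => Φ x s) x w)
        (fderiv ℝ ξ (Φ x s) (fderiv ℝ (fun x => Φ x s) x w)) s) ∧
      Continuous (fun p : H × ℝ => Φ p.1 p.2) ∧
      Continuous (fun p : H × ℝ => fderiv ℝ (fun x => Φ x p.2) p.1) := by
  have : CompleteSpace H := FiniteDimensional.complete ℝ H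
  obtain ⟨C, hC⟩ := hξ.lipschitzWith_of_hasCompactSupport hs (by simp)
  -- The time interval is so short that integrating the field along a curve is a contraction with
  -- constant `1 / 2`.
  obtain ⟨ε, hε0, hεC⟩ : ∃ ε : ℝ, 0 < ε ∧ ε * C ≤ 1 / 2 :=
    ⟨1 / (2 * (C + 1)), by positivity, by
      rw [div_mul_eq_mul_div, one_mul, div_le_div_iff₀ (by positivity) (by positivity)]
      linarith [C.coe_nonneg]⟩
  have hε := hε0.le
  have hle : -ε ≤ ε := by linarith
  let K := Icc (-ε) ε
  let N : C(K, H) → C(K, H) := fun c => (⟨ξ, hξ.continuous⟩ : C(H, H)).comp c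
  let D : C(K, H) → C(K, H →L[ℝ] H) := fun c =>
    (⟨fderiv ℝ ξ, hξ.continuous_fderiv (by simp)⟩ : C(H, H →L[ℝ] H)).comp c
  let J := primitiveCLM H hε
  -- The integral curve issuing from `x` is the solution `c` of `P c = const x`. Smooth dependence
  -- on `x` is thus smoothness of the inverse of `P`.
  let P : C(K, H) → C(K, H) := fun c => c - J (N c)
  have hN : ContDiff ℝ ∞ N := contDiff_superposition hξ hs
  have hP : ContDiff ℝ ∞ P := contDiff_id.sub (J.contDiff.comp hN)
  have hNlip : ∀ c c', ‖N c - N c'‖ ≤ C * ‖c - c'‖ := fun c c' => by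
    refine (ContinuousMap.norm_le _ (by positivity)).2 fun τ => ?_
    have h1 := hC.dist_le_mul (c τ) (c' τ)
    rw [dist_eq_norm, dist_eq_norm] at h1
    exact h1.trans (mul_le_mul_of_nonneg_left ((c - c').norm_coe_le_norm τ) C.coe_nonneg)
  have hJN : ∀ c c', ‖J (N c) - J (N c')‖ ≤ 1 / 2 * ‖c - c'‖ := fun c c' => by
    rw [← map_sub]
    refine (J.le_opNorm _).trans ?_
    calc ‖J‖ * ‖N c - N c'‖ ≤ ε * (C * ‖c - c'‖) :=
          mul_le_mul (norm_primitiveCLM_le hε) (hNlip c c') (norm_nonneg _) hε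
      _ = ε * C * ‖c - c'‖ := by ring
      _ ≤ 1 / 2 * ‖c - c'‖ := mul_le_mul_of_nonneg_right hεC (norm_nonneg _)
  have happ : ApproximatesLinearOn P
      ((ContinuousLinearEquiv.refl ℝ C(K, H) : C(K, H) ≃L[ℝ] C(K, H)) : C(K, H) →L[ℝ] C(K, H))
      univ (1 / 2 : NNReal) := by
    intro c _ c' _
    have h1 : P c - P c' - (c - c') = -(J (N c) - J (N c')) := by
      simp only [P]
      abel
    show ‖P c - P c' - (c - c')‖ ≤ _
    rw [h1, norm_neg]
    simpa using hJN c c'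
  -- `P` differs from the identity by a `1 / 2`-Lipschitz map and the inverse of the identity has
  -- norm `1`, so `P` is a global homeomorphism.
  have hcst : Subsingleton C(K, H) ∨ (1 / 2 : NNReal) <
      ‖((ContinuousLinearEquiv.refl ℝ C(K, H)).symm : C(K, H) →L[ℝ] C(K, H))‖₊⁻¹ := by
    rcases subsingleton_or_nontrivial C(K, H) with h | h
    · exact Or.inl h
    · right
      have : ‖((ContinuousLinearEquiv.refl ℝ C(K, H)).symm : C(K, H) →L[ℝ] C(K, H))‖₊ = 1 :=
        ContinuousLinearMap.nnnorm_id
      rw [this, inv_one]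
      exact NNReal.half_lt_self one_ne_zero
  let Q := happ.toHomeomorph P hcst
  have hQ : ∀ c, Q c = P c := fun _ => rfl
  have hPd : ∀ c, HasFDerivAt P (ContinuousLinearMap.id ℝ _ -
      J.comp (pointwiseApply K H H (D c))) c := fun c =>
    (hasFDerivAt_id c).sub (J.hasFDerivAt.comp c (hasFDerivAt_superposition hξ hs c))
  have hsmall : ∀ c, ‖J.comp (pointwiseApply K H H (D c))‖ < 1 := fun c => by
    refine lt_of_le_of_lt (ContinuousLinearMap.opNorm_le_bound _ (by norm_num : (0:ℝ) ≤ 1 / 2)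
      fun h => ?_) (by norm_num : (1 / 2 : ℝ) < 1)
    have h1 : ‖pointwiseApply K H H (D c) h‖ ≤ C * ‖h‖ := by
      refine (ContinuousMap.norm_le _ (by positivity)).2 fun τ => ?_
      refine ((fderiv ℝ ξ (c τ)).le_opNorm _).trans ?_
      exact mul_le_mul (norm_fderiv_le_of_lipschitz ℝ hC) (h.norm_coe_le_norm τ) (norm_nonneg _)
        C.coe_nonneg
    refine (J.le_opNorm _).trans ?_
    calc ‖J‖ * ‖pointwiseApply K H H (D c) h‖ ≤ ε * (C * ‖h‖) :=
          mul_le_mul (norm_primitiveCLM_le hε) h1 (norm_nonneg _) hε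
      _ = ε * C * ‖h‖ := by ring
      _ ≤ 1 / 2 * ‖h‖ := mul_le_mul_of_nonneg_right hεC (norm_nonneg _)
  -- The derivative of `P` at every curve is the identity minus an operator of norm less than `1`,
  -- hence invertible by the Neumann series.
  have hQs : ContDiff ℝ ∞ Q.symm := Q.contDiff_symm
    (f₀' := fun c => ContinuousLinearEquiv.unitsEquiv ℝ _ (Units.oneSub _ (hsmall c)))
    (fun c => hPd c) hP
  let ι : H →L[ℝ] C(K, H) := ContinuousLinearMap.const ℝ K
  let S : H → C(K, H) := fun x => Q.symm (ι x)
  have hS : ContDiff ℝ ∞ S := hQs.comp ι.contDiff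
  have hSeq : ∀ x, S x = ι x + J (N (S x)) := fun x => by
    have h1 : P (S x) = ι x := Q.apply_symm_apply (ι x)
    exact sub_eq_iff_eq_add.1 h1
  -- Differentiating the fixed-point equation in `x` gives the variational equation in integral
  -- form.
  have hSd : ∀ x w, fderiv ℝ S x w = ι w +
      J (pointwiseApply K H H (D (S x)) (fderiv ℝ S x w)) := fun x w => by
    have hSx : HasFDerivAt S (fderiv ℝ S x) x := (hS.differentiable (by simp) x).hasFDerivAt
    have h1 : HasFDerivAt (fun x => ι x + J (N (S x)))
        (ι + J.comp ((pointwiseApply K H H (D (S x))).comp (fderiv ℝ S x))) x :=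
      ι.hasFDerivAt.add (J.hasFDerivAt.comp x
        ((hasFDerivAt_superposition hξ hs (S x)).comp x hSx))
    rw [← funext hSeq] at h1
    exact congrArg (fun A => A w) h1.fderiv |>.trans rfl
  -- Times outside `[-ε, ε]` are projected to the interval, which makes the flow map total and
  -- continuous in time.
  let ev : ℝ → C(K, H) →L[ℝ] H := fun s => ContinuousMap.evalCLM ℝ (projIcc (-ε) ε hle s)
  have hev : ∀ s c, ev s c = IccExtend hle c s := fun _ _ => rfl
  have hevd : ∀ s x, fderiv ℝ (fun x => ev s (S x)) x = (ev s).comp (fderiv ℝ S x) := fun s x =>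
    ((ev s).hasFDerivAt.comp x (hS.differentiable (by simp) x).hasFDerivAt).fderiv
  refine ⟨ε, hε0, fun x s => ev s (S x), fun x => ?_, fun x s hs' => ?_, fun s => ?_,
    fun x w s hs' => ?_, ?_, ?_⟩
  · show ev 0 (S x) = x
    rw [hSeq, map_add, hev, hev, IccExtend_of_mem hle _ ⟨by linarith, hε⟩,
      IccExtend_of_mem hle _ ⟨by linarith, hε⟩]
    have h1 : J (N (S x)) ⟨0, by linarith, hε⟩ = 0 := intervalIntegral.integral_same
    rw [h1, add_zero]
    rfl
  · exact hasDerivAt_of_eq_primitive hε (hSeq x) hs'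
  · exact (ev s).contDiff.comp hS
  · simp only [hevd]
    exact hasDerivAt_of_eq_primitive hε (hSd x w) hs'
  · have : Continuous fun p : H × ℝ => S p.1 (projIcc (-ε) ε hle p.2) :=
      ContinuousEval.continuous_eval.comp
        ((hS.continuous.comp continuous_fst).prodMk ((continuous_projIcc (h := hle)).comp continuous_snd))
    exact this
  · simp only [hevd]
    refine continuous_clm_apply.2 fun w => ?_
    have : Continuous fun p : H × ℝ => fderiv ℝ S p.1 w (projIcc (-ε) ε hle p.2) :=
      ContinuousEval.continuous_eval.comp
        ((((hS.continuous_fderiv (by simp)).clm_apply continuous_const).comp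
          continuous_fst).prodMk ((continuous_projIcc (h := hle)).comp continuous_snd))
    exact this

/-- The local flow of a smooth vector field, which depends smoothly on the initial point. -/
theorem exists_local_flow [FiniteDimensional ℝ H] {ξ : H → H} {O : Set H} (hO : IsOpen O)
    (hξ : ContDiffOn ℝ ∞ ξ O) {x₀ : H} (hx₀ : x₀ ∈ O) :
    ∃ ε > 0, ∃ V : Set H, IsOpen V ∧ x₀ ∈ V ∧ ∃ Φ : H → ℝ → H, (∀ x, Φ x 0 = x) ∧
      (∀ x ∈ V, ∀ s ∈ Ioo (-ε) ε, Φ x s ∈ O ∧ HasDerivAt (Φ x) (ξ (Φ x s)) s) ∧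
      (∀ s, ContDiff ℝ ∞ fun x => Φ x s) ∧
      (∀ x ∈ V, ∀ w, ∀ s ∈ Ioo (-ε) ε, HasDerivAt (fun s => fderiv ℝ (fun x => Φ x s) x w)
        (fderiv ℝ ξ (Φ x s) (fderiv ℝ (fun x => Φ x s) x w)) s) ∧
      Continuous (fun p : H × ℝ => Φ p.1 p.2) ∧
      Continuous (fun p : H × ℝ => fderiv ℝ (fun x => Φ x p.2) p.1) := by
  obtain ⟨R, hR, hRO⟩ := Metric.nhds_basis_closedBall.mem_iff.1 (hO.mem_nhds hx₀)
  -- The cut-off is supported in `O`, and equals `1` on the ball of radius `R / 2`, where the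
  -- truncated field therefore agrees with `ξ`.
  let χ : ContDiffBump x₀ := ⟨R / 2, R, by positivity, by linarith⟩
  have hη : ContDiff ℝ ∞ fun x => χ x • ξ x := by
    refine contDiff_iff_contDiffAt.2 fun x => ?_
    by_cases hx : x ∈ O
    · exact χ.contDiff.contDiffAt.smul (hξ.contDiffAt (hO.mem_nhds hx))
    · have hx' : x ∉ tsupport χ := fun h => hx (hRO (χ.tsupport_eq ▸ h))
      refine (contDiffAt_const (c := (0 : H))).congr_of_eventuallyEq ?_
      filter_upwards [(isClosed_tsupport χ).isOpen_compl.mem_nhds hx'] with y hy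
      rw [image_eq_zero_of_notMem_tsupport hy, zero_smul]
  have hηs : HasCompactSupport fun x => χ x • ξ x := χ.hasCompactSupport.smul_right
  have hηeq : ∀ x ∈ Metric.ball x₀ (R / 2), (fun x => χ x • ξ x) =ᶠ[𝓝 x] ξ := fun x hx => by
    filter_upwards [Metric.isOpen_ball.mem_nhds hx] with y hy
    rw [χ.one_of_mem_closedBall (Metric.ball_subset_closedBall hy), one_smul]
  obtain ⟨ε, hε, Φ, h0, hd, hsm, hvar, hcont, hcontd⟩ := exists_flow_of_hasCompactSupport hη hηs
  -- By continuity, orbits starting near `x₀` stay for a short time in the ball where the cut-off is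
  -- invisible.
  have hnear : ∀ᶠ p in 𝓝 (x₀, (0 : ℝ)), Φ p.1 p.2 ∈ Metric.ball x₀ (R / 2) :=
    hcont.continuousAt (Metric.isOpen_ball.mem_nhds (by
      show Φ x₀ 0 ∈ _
      rw [h0]
      exact Metric.mem_ball_self (by positivity)))
  rw [nhds_prod_eq] at hnear
  obtain ⟨pa, hpa, pb, hpb, hab⟩ := eventually_prod_iff.1 hnear
  obtain ⟨V, hVsub, hVo, hVx⟩ := mem_nhds_iff.1 hpa
  obtain ⟨δ, hδ, hδsub⟩ := Metric.mem_nhds_iff.1 hpb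
  have hin : ∀ x ∈ V, ∀ s ∈ Ioo (-min ε δ) (min ε δ), Φ x s ∈ Metric.ball x₀ (R / 2) ∧
      s ∈ Ioo (-ε) ε := fun x hx s hs => by
    have hs' := abs_lt.2 hs
    refine ⟨hab (hVsub hx) (hδsub ?_), abs_lt.1 (hs'.trans_le (min_le_left _ _))⟩
    simpa using hs'.trans_le (min_le_right _ _)
  refine ⟨min ε δ, lt_min hε hδ, V, hVo, hVx, Φ, h0, fun x hx s hs => ?_, hsm,
    fun x hx w s hs => ?_, hcont, hcontd⟩
  · obtain ⟨h1, h2⟩ := hin x hx s hs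
    refine ⟨hRO (Metric.ball_subset_closedBall (Metric.ball_subset_ball (by linarith) h1)), ?_⟩
    rw [← (hηeq _ h1).eq_of_nhds]
    exact hd x s h2
  · obtain ⟨h1, h2⟩ := hin x hx s hs
    rw [← (hηeq _ h1).fderiv_eq]
    exact hvar x w s h2

/-- A solution of a homogeneous linear differential equation that vanishes at the time `0`
vanishes identically. -/
lemma eq_zero_of_linear_ode {E : Type*} [NormedAddCommGroup E] [NormedSpace ℝ E] {ε : ℝ}
    {A : ℝ → E →L[ℝ] E} (hA : ContinuousOn A (Ioo (-ε) ε)) {y : ℝ → E}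
    (hy : ∀ s ∈ Ioo (-ε) ε, HasDerivAt y (A s (y s)) s) (h0 : y 0 = 0) :
    ∀ s ∈ Ioo (-ε) ε, y s = 0 := by
  intro s hs
  have hs' : |s| < ε := abs_lt.2 hs
  -- On the compact interval `[-b, b]` the coefficients are bounded, which supplies the Lipschitz
  -- constant for uniqueness.
  obtain ⟨b, hsb, hbε⟩ := exists_between hs'
  have hb : 0 < b := (abs_nonneg s).trans_lt hsb
  have hsub : Icc (-b) b ⊆ Ioo (-ε) ε := Icc_subset_Ioo (by linarith) hbε
  obtain ⟨C, hC⟩ := isCompact_Icc.exists_bound_of_continuousOn (hA.mono hsub)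
  have hC0 : 0 ≤ C := (norm_nonneg _).trans (hC 0 ⟨by linarith, hb.le⟩)
  refine ODE_solution_unique_of_mem_Ioo (v := fun s x => A s x) (s := fun _ => univ)
    (K := ⟨C, hC0⟩) (t₀ := 0) (a := -b) (b := b) (f := y) (g := fun _ => 0)
    (fun t ht => ?_) ⟨by linarith, hb⟩
    (fun t ht => ⟨hy t (hsub (Ioo_subset_Icc_self ht)), mem_univ _⟩)
    (fun t _ => ⟨by simpa using hasDerivAt_const t (0 : E), mem_univ _⟩) h0 (abs_lt.1 hsb)
  exact ((A t).lipschitz.weaken (hC t (Ioo_subset_Icc_self ht))).lipschitzOnWith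

end Flow

/-! Expressions of forms and vector fields in the preferred charts of a manifold. -/

section ChartCalculus

variable {H : Type*} [NormedAddCommGroup H] [NormedSpace ℝ H]
  {N : Type*} [TopologicalSpace N] [ChartedSpace H N]

/-- The derivative at `u` of the preferred chart at `u₁`. -/
def chartD (u₁ u : N) : H →L[ℝ] H := mfderiv 𝓘(ℝ, H) 𝓘(ℝ, H) (extChartAt 𝓘(ℝ, H) u₁) u

/-- The derivative of the inverse of the preferred chart at `u₁`. -/
def chartDsymm (u₁ : N) (z : H) : H →L[ℝ] H :=
  mfderiv 𝓘(ℝ, H) 𝓘(ℝ, H) (extChartAt 𝓘(ℝ, H) u₁).symm z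

/-- The expression of a vector field in the preferred chart at `u₁`. -/
def VField.inChart (X : VField H N) (u₁ : N) (z : H) : H :=
  chartD u₁ ((extChartAt 𝓘(ℝ, H) u₁).symm z) (X ((extChartAt 𝓘(ℝ, H) u₁).symm z))

/-- Covectors as alternating forms of degree `1`. -/
def oneFormEquiv (H : Type*) [NormedAddCommGroup H] [NormedSpace ℝ H] :
    (H →L[ℝ] ℝ) ≃ₗᵢ[ℝ] (H [⋀^Fin 1]→L[ℝ] ℝ) :=
  ContinuousAlternatingMap.ofSubsingletonLIE (0 : Fin 1)

/-- The covector field representing a `1`-form in the preferred chart at `u₁`. -/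
def PForm.cov (θ : PForm H N 1) (u₁ : N) (z : H) : H →L[ℝ] ℝ :=
  (oneFormEquiv H).symm (θ.inChart u₁ z)

lemma PForm.cov_apply (θ : PForm H N 1) (u₁ : N) (z v : H) :
    θ.cov u₁ z v = θ ((extChartAt 𝓘(ℝ, H) u₁).symm z) ![chartDsymm u₁ z v] := by
  show (θ.inChart u₁ z) (fun _ => v) = _
  show (θ ((extChartAt 𝓘(ℝ, H) u₁).symm z)) (fun _ => chartDsymm u₁ z v) = _
  congr 1
  ext i
  fin_cases i
  rfl

lemma PForm.inChart_apply {p : ℕ} (θ : PForm H N p) (u₁ : N) (z : H) (v : Fin p → H) :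
    θ.inChart u₁ z v = θ ((extChartAt 𝓘(ℝ, H) u₁).symm z) (fun i => chartDsymm u₁ z (v i)) := rfl

lemma isOpen_chart_target (u₁ : N) : IsOpen (extChartAt 𝓘(ℝ, H) u₁).target :=
  isOpen_extChartAt_target u₁

lemma PForm.inChart_eq_ofSubsingleton (θ : PForm H N 1) (u₁ : N) :
    θ.inChart u₁ = fun z =>
      oneFormEquiv H (θ.cov u₁ z) :=
  funext fun z => ((oneFormEquiv H).apply_symm_apply
    (θ.inChart u₁ z)).symm

variable [IsManifold 𝓘(ℝ, H) ∞ N]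

lemma contMDiffAt_chart {u₁ u : N} (hu : u ∈ (extChartAt 𝓘(ℝ, H) u₁).source) :
    ContMDiffAt 𝓘(ℝ, H) 𝓘(ℝ, H) ∞ (extChartAt 𝓘(ℝ, H) u₁) u :=
  contMDiffAt_extChartAt' (by rwa [extChartAt_source] at hu)

lemma contMDiffAt_chart_symm {u₁ : N} {z : H} (hz : z ∈ (extChartAt 𝓘(ℝ, H) u₁).target) :
    ContMDiffAt 𝓘(ℝ, H) 𝓘(ℝ, H) ∞ (extChartAt 𝓘(ℝ, H) u₁).symm z :=
  (contMDiffOn_extChartAt_symm u₁).contMDiffAt ((isOpen_chart_target u₁).mem_nhds hz)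

lemma mdifferentiableAt_chart {u₁ u : N} (hu : u ∈ (extChartAt 𝓘(ℝ, H) u₁).source) :
    MDifferentiableAt 𝓘(ℝ, H) 𝓘(ℝ, H) (extChartAt 𝓘(ℝ, H) u₁) u :=
  (contMDiffAt_chart hu).mdifferentiableAt (by simp)

lemma mdifferentiableAt_chart_symm {u₁ : N} {z : H} (hz : z ∈ (extChartAt 𝓘(ℝ, H) u₁).target) :
    MDifferentiableAt 𝓘(ℝ, H) 𝓘(ℝ, H) (extChartAt 𝓘(ℝ, H) u₁).symm z :=
  (contMDiffAt_chart_symm hz).mdifferentiableAt (by simp)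

lemma chartD_chartDsymm {u₁ : N} {z : H} (hz : z ∈ (extChartAt 𝓘(ℝ, H) u₁).target) (v : H) :
    chartD u₁ ((extChartAt 𝓘(ℝ, H) u₁).symm z) (chartDsymm u₁ z v) = v := by
  have : IsManifold 𝓘(ℝ, H) 1 N := IsManifold.of_le (n := ∞) ENat.LEInfty.out
  have h := mfderiv_extChartAt_comp_mfderivWithin_extChartAt_symm (I := 𝓘(ℝ, H)) hz
  rw [ModelWithCorners.range_eq_univ, mfderivWithin_univ] at h
  exact congrArg (fun A : H →L[ℝ] H => A v) h

lemma chartDsymm_chartD {u₁ u : N} (hu : u ∈ (extChartAt 𝓘(ℝ, H) u₁).source) (v : H) :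
    chartDsymm u₁ (extChartAt 𝓘(ℝ, H) u₁ u) (chartD u₁ u v) = v := by
  have : IsManifold 𝓘(ℝ, H) 1 N := IsManifold.of_le (n := ∞) ENat.LEInfty.out
  have h := mfderivWithin_extChartAt_symm_comp_mfderiv_extChartAt' (I := 𝓘(ℝ, H)) hu
  rw [ModelWithCorners.range_eq_univ, mfderivWithin_univ] at h
  exact congrArg (fun A : H →L[ℝ] H => A v) h

lemma chartD_chartDsymm' {u₁ u : N} (hu : u ∈ (extChartAt 𝓘(ℝ, H) u₁).source) (v : H) :
    chartD u₁ u (chartDsymm u₁ (extChartAt 𝓘(ℝ, H) u₁ u) v) = v := by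
  have h := chartD_chartDsymm ((extChartAt 𝓘(ℝ, H) u₁).map_source hu) v
  rwa [(extChartAt 𝓘(ℝ, H) u₁).left_inv hu] at h

lemma isInvertible_chartD {u₁ u : N} (hu : u ∈ (extChartAt 𝓘(ℝ, H) u₁).source) :
    (chartD (H := H) u₁ u).IsInvertible :=
  ContinuousLinearMap.IsInvertible.of_inverse
    (g := chartDsymm u₁ (extChartAt 𝓘(ℝ, H) u₁ u))
    (ContinuousLinearMap.ext fun v => chartD_chartDsymm' hu v)
    (ContinuousLinearMap.ext fun v => chartDsymm_chartD hu v)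

lemma isInvertible_chartDsymm {u₁ : N} {z : H} (hz : z ∈ (extChartAt 𝓘(ℝ, H) u₁).target) :
    (chartDsymm u₁ z).IsInvertible := by
  have hu := (extChartAt 𝓘(ℝ, H) u₁).map_target hz
  refine ContinuousLinearMap.IsInvertible.of_inverse
    (g := chartD u₁ ((extChartAt 𝓘(ℝ, H) u₁).symm z))
    (ContinuousLinearMap.ext fun v => ?_)
    (ContinuousLinearMap.ext fun v => chartD_chartDsymm hz v)
  have h := chartDsymm_chartD hu v
  rwa [(extChartAt 𝓘(ℝ, H) u₁).right_inv hz] at h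

lemma PForm.apply_eq_cov (θ : PForm H N 1) {u₁ u : N} (hu : u ∈ (extChartAt 𝓘(ℝ, H) u₁).source)
    (v : H) : θ u ![v] = θ.cov u₁ (extChartAt 𝓘(ℝ, H) u₁ u) (chartD u₁ u v) := by
  rw [PForm.cov_apply, chartDsymm_chartD hu, (extChartAt 𝓘(ℝ, H) u₁).left_inv hu]

/-- The transition map between two preferred charts. -/
def chartTransition (H : Type*) [NormedAddCommGroup H] [NormedSpace ℝ H]
    {N : Type*} [TopologicalSpace N] [ChartedSpace H N] (u₁ u : N) (z : H) : H :=
  extChartAt 𝓘(ℝ, H) u ((extChartAt 𝓘(ℝ, H) u₁).symm z)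

lemma contDiffAt_chartTransition {u₁ u : N} {z : H} (hz : z ∈ (extChartAt 𝓘(ℝ, H) u₁).target)
    (hu : (extChartAt 𝓘(ℝ, H) u₁).symm z ∈ (extChartAt 𝓘(ℝ, H) u).source) :
    ContDiffAt ℝ ∞ (chartTransition H u₁ u) z :=
  ((contMDiffAt_chart hu).comp z (contMDiffAt_chart_symm hz)).contDiffAt

lemma fderiv_chartTransition {u₁ u : N} {z : H} (hz : z ∈ (extChartAt 𝓘(ℝ, H) u₁).target)
    (hu : (extChartAt 𝓘(ℝ, H) u₁).symm z ∈ (extChartAt 𝓘(ℝ, H) u).source) :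
    fderiv ℝ (chartTransition H u₁ u) z =
      (chartD u ((extChartAt 𝓘(ℝ, H) u₁).symm z)).comp (chartDsymm u₁ z) := by
  rw [← mfderiv_eq_fderiv]
  exact mfderiv_comp z (mdifferentiableAt_chart hu) (mdifferentiableAt_chart_symm hz)

lemma eventually_mem_chart {u₁ u : N} {z : H} (hz : z ∈ (extChartAt 𝓘(ℝ, H) u₁).target)
    (hu : (extChartAt 𝓘(ℝ, H) u₁).symm z ∈ (extChartAt 𝓘(ℝ, H) u).source) :
    ∀ᶠ z' in 𝓝 z, z' ∈ (extChartAt 𝓘(ℝ, H) u₁).target ∧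
      (extChartAt 𝓘(ℝ, H) u₁).symm z' ∈ (extChartAt 𝓘(ℝ, H) u).source :=
  (eventually_mem_set.2 ((isOpen_chart_target u₁).mem_nhds hz)).and
    ((contMDiffAt_chart_symm hz).continuousAt ((isOpen_extChartAt_source u).mem_nhds hu))

lemma PForm.inChart_eq_transition {p : ℕ} (θ : PForm H N p) {u₁ u : N} {z : H}
    (hz : z ∈ (extChartAt 𝓘(ℝ, H) u₁).target)
    (hu : (extChartAt 𝓘(ℝ, H) u₁).symm z ∈ (extChartAt 𝓘(ℝ, H) u).source) :
    θ.inChart u₁ z = (θ.inChart u (chartTransition H u₁ u z)).compContinuousLinearMap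
      (fderiv ℝ (chartTransition H u₁ u) z) := by
  ext v
  rw [fderiv_chartTransition hz hu, ContinuousAlternatingMap.compContinuousLinearMap_apply,
    PForm.inChart_apply, PForm.inChart_apply, chartTransition,
    (extChartAt 𝓘(ℝ, H) u).left_inv hu]
  congr 1
  funext i
  exact (chartDsymm_chartD hu _).symm

/-- The differential is defined at each point through the preferred chart there. Naturality of
`extDeriv` under the transition map shows that any fixed chart computes it as well. -/
lemma PForm.inChart_d {p : ℕ} (θ : PForm H N p) {u₁ : N} {z : H}
    (hz : z ∈ (extChartAt 𝓘(ℝ, H) u₁).target)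
    (hθ : DifferentiableAt ℝ (θ.inChart ((extChartAt 𝓘(ℝ, H) u₁).symm z))
      (extChartAt 𝓘(ℝ, H) ((extChartAt 𝓘(ℝ, H) u₁).symm z) ((extChartAt 𝓘(ℝ, H) u₁).symm z))) :
    θ.d.inChart u₁ z = extDeriv (θ.inChart u₁) z := by
  obtain ⟨u, hu⟩ : ∃ u, u = (extChartAt 𝓘(ℝ, H) u₁).symm z := ⟨_, rfl⟩
  have hus : (extChartAt 𝓘(ℝ, H) u₁).symm z ∈ (extChartAt 𝓘(ℝ, H) u).source := by
    rw [← hu]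
    exact mem_extChartAt_source u
  have hev : θ.inChart u₁ =ᶠ[𝓝 z] fun z' =>
      (θ.inChart u (chartTransition H u₁ u z')).compContinuousLinearMap
        (fderiv ℝ (chartTransition H u₁ u) z') := by
    filter_upwards [eventually_mem_chart hz hus] with z' hz'
    exact θ.inChart_eq_transition hz'.1 hz'.2
  rw [hev.extDeriv_eq, extDeriv_pullback (r := ∞) (by
    rw [chartTransition, hu]
    exact hθ) (contDiffAt_chartTransition hz hus) (by
      rw [minSmoothness_of_isRCLikeNormedField]
      exact ENat.LEInfty.out), fderiv_chartTransition hz hus]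
  subst hu
  rfl

lemma PForm.cov_eq_transition (θ : PForm H N 1) {u₁ u : N} {z : H}
    (hz : z ∈ (extChartAt 𝓘(ℝ, H) u₁).target)
    (hu : (extChartAt 𝓘(ℝ, H) u₁).symm z ∈ (extChartAt 𝓘(ℝ, H) u).source) :
    θ.cov u₁ z = (θ.cov u (chartTransition H u₁ u z)).comp
      (fderiv ℝ (chartTransition H u₁ u) z) := by
  ext v
  show θ.inChart u₁ z (fun _ => v) = θ.inChart u _ (fun _ => _)
  rw [θ.inChart_eq_transition hz hu]
  rfl

/-- The covector representing a smooth `1`-form in a chart depends smoothly on the point. -/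
lemma PForm.SmoothOn.cov {θ : PForm H N 1} {U : Set N} (hθ : θ.SmoothOn U) {u₁ : N} {z : H}
    (hz : z ∈ (extChartAt 𝓘(ℝ, H) u₁).target)
    (hu : (extChartAt 𝓘(ℝ, H) u₁).symm z ∈ U) : ContDiffAt ℝ ∞ (θ.cov u₁) z := by
  obtain ⟨u, hu'⟩ : ∃ u, u = (extChartAt 𝓘(ℝ, H) u₁).symm z := ⟨_, rfl⟩
  have hus : (extChartAt 𝓘(ℝ, H) u₁).symm z ∈ (extChartAt 𝓘(ℝ, H) u).source := by
    rw [← hu']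
    exact mem_extChartAt_source u
  have hev : θ.cov u₁ =ᶠ[𝓝 z] fun z' =>
      (θ.cov u (chartTransition H u₁ u z')).comp (fderiv ℝ (chartTransition H u₁ u) z') := by
    filter_upwards [eventually_mem_chart hz hus] with z' hz'
    exact θ.cov_eq_transition hz'.1 hz'.2
  refine ContDiffAt.congr_of_eventuallyEq ?_ hev
  have hT := contDiffAt_chartTransition hz hus
  have h1 : ContDiffAt ℝ ∞ (θ.cov u) (chartTransition H u₁ u z) := by
    have h2 := hθ u (hu' ▸ hu)
    rw [chartTransition, ← hu']
    exact ((oneFormEquiv H).symm.contDiff).contDiffAt.comp _ h2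
  exact (h1.comp z hT).clm_comp (hT.fderiv_right (by simp))

/-- The exterior differential of a covector field on a vector space. -/
def covD (ϑ : H → H →L[ℝ] ℝ) (z : H) : H →L[ℝ] H →L[ℝ] ℝ :=
  fderiv ℝ ϑ z - (fderiv ℝ ϑ z).flip

lemma covD_apply (ϑ : H → H →L[ℝ] ℝ) (z v w : H) :
    covD ϑ z v w = fderiv ℝ ϑ z v w - fderiv ℝ ϑ z w v := rfl

lemma extDeriv_ofSubsingleton {ϑ : H → H →L[ℝ] ℝ} {z : H} (hϑ : DifferentiableAt ℝ ϑ z)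
    (v w : H) : extDeriv (fun z =>
      oneFormEquiv H (ϑ z)) z ![v, w] =
      covD ϑ z v w := by
  have hd : DifferentiableAt ℝ (fun z => oneFormEquiv H (ϑ z)) z :=
    (oneFormEquiv H).differentiableAt.comp z hϑ
  have h : ∀ c a : H, fderiv ℝ (fun x => ϑ x c) z a = fderiv ℝ ϑ z a c := fun c a => by
    have h1 := hϑ.hasFDerivAt.clm_apply (hasFDerivAt_const c z)
    rw [h1.fderiv]
    simp
  rw [extDeriv_apply hd, Fin.sum_univ_two]
  refine (congrArg₂ (· + ·) (congrArg _ (h w v)) (congrArg _ (h v w))).trans ?_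
  simp [covD_apply, sub_eq_add_neg]

/-- The bridge from the intrinsic differential to the bilinear expression `covD`. One chart `u₁` can
be used along a whole piece of curve. -/
lemma PForm.d_apply {θ : PForm H N 1} {U : Set N} (hθ : θ.SmoothOn U) {u₁ u : N} (huU : u ∈ U)
    (hu : u ∈ (extChartAt 𝓘(ℝ, H) u₁).source) (v w : H) :
    θ.d u ![v, w] =
      covD (θ.cov u₁) (extChartAt 𝓘(ℝ, H) u₁ u) (chartD u₁ u v) (chartD u₁ u w) := by
  have hz := (extChartAt 𝓘(ℝ, H) u₁).map_source hu
  have hl := (extChartAt 𝓘(ℝ, H) u₁).left_inv hu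
  have h1 := θ.inChart_d hz (by
    rw [hl]
    exact (hθ u huU).differentiableAt (by simp))
  rw [← extDeriv_ofSubsingleton ((hθ.cov hz (by rwa [hl])).differentiableAt (by simp)),
    ← θ.inChart_eq_ofSubsingleton, ← h1, PForm.inChart_apply, hl]
  congr 1
  funext i
  fin_cases i
  · exact (chartDsymm_chartD hu v).symm
  · exact (chartDsymm_chartD hu w).symm

lemma PForm.d_zero_apply (θ : PForm H N 0) {u₁ u : N}
    (hu : u ∈ (extChartAt 𝓘(ℝ, H) u₁).source)
    (hθ : DifferentiableAt ℝ (fun z => θ ((extChartAt 𝓘(ℝ, H) u).symm z) ![])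
      (extChartAt 𝓘(ℝ, H) u u)) (w : H) :
    θ.d u ![w] = fderiv ℝ (fun z => θ ((extChartAt 𝓘(ℝ, H) u₁).symm z) ![])
      (extChartAt 𝓘(ℝ, H) u₁ u) (chartD u₁ u w) := by
  have hz := (extChartAt 𝓘(ℝ, H) u₁).map_source hu
  have hl := (extChartAt 𝓘(ℝ, H) u₁).left_inv hu
  have hform : ∀ u' : N, θ.inChart u' = fun z => ContinuousAlternatingMap.constOfIsEmpty ℝ H (Fin 0)
      (θ ((extChartAt 𝓘(ℝ, H) u').symm z) ![]) := fun u' => by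
    funext z
    ext v
    rw [PForm.inChart_apply]
    exact congrArg _ (Subsingleton.elim _ _)
  have h1 := θ.inChart_d hz (by
    rw [hl, hform]
    exact (ContinuousAlternatingMap.constOfIsEmptyLIE ℝ H ℝ
      (Fin 0)).differentiableAt.comp _ hθ)
  have h2 : θ.d u ![w] = θ.d.inChart u₁ (extChartAt 𝓘(ℝ, H) u₁ u) ![chartD u₁ u w] := by
    rw [PForm.inChart_apply, hl]
    congr 1
    funext i
    fin_cases i
    exact (chartDsymm_chartD hu w).symm
  rw [h2, h1, hform u₁, extDeriv_constOfIsEmpty]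
  rfl

end ChartCalculus

/-! ### Lie derivative of covector fields on a vector space. -/

section CovectorLie

variable {H : Type*} [NormedAddCommGroup H] [NormedSpace ℝ H]

/-- The Lie derivative of a covector field on a vector space. -/
def covLie (ξ : H → H) (ϑ : H → H →L[ℝ] ℝ) (z : H) : H →L[ℝ] ℝ :=
  fderiv ℝ ϑ z (ξ z) + (ϑ z).comp (fderiv ℝ ξ z)

lemma covLie_apply (ξ : H → H) (ϑ : H → H →L[ℝ] ℝ) (z w : H) :
    covLie ξ ϑ z w = fderiv ℝ ϑ z (ξ z) w + ϑ z (fderiv ℝ ξ z w) := rfl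

end CovectorLie

/-! ### Vector fields, brackets and Lie derivatives in a chart. -/

section FieldCalculus

variable {H : Type*} [NormedAddCommGroup H] [NormedSpace ℝ H]
  {N : Type*} [TopologicalSpace N] [ChartedSpace H N]

lemma VField.inChart_apply_chart (X : VField H N) {u₁ u : N}
    (hu : u ∈ (extChartAt 𝓘(ℝ, H) u₁).source) :
    X.inChart u₁ (extChartAt 𝓘(ℝ, H) u₁ u) = chartD (H := H) u₁ u (X u) := by
  rw [VField.inChart, (extChartAt 𝓘(ℝ, H) u₁).left_inv hu]

variable [IsManifold 𝓘(ℝ, H) ∞ N]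

lemma VField.chartDsymm_inChart (X : VField H N) {u₁ u : N}
    (hu : u ∈ (extChartAt 𝓘(ℝ, H) u₁).source) :
    chartDsymm u₁ (extChartAt 𝓘(ℝ, H) u₁ u) (X.inChart u₁ (extChartAt 𝓘(ℝ, H) u₁ u)) = X u := by
  rw [VField.inChart, (extChartAt 𝓘(ℝ, H) u₁).left_inv hu]
  exact chartDsymm_chartD hu _

/-- In this form the chart expression inherits smoothness and naturality of brackets from
`VectorField.mpullback`. -/
lemma VField.inChart_eq_mpullback (X : VField H N) {u₁ : N} {z : H}
    (hz : z ∈ (extChartAt 𝓘(ℝ, H) u₁).target) :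
    X.inChart u₁ z =
      VectorField.mpullback 𝓘(ℝ, H) 𝓘(ℝ, H) (extChartAt 𝓘(ℝ, H) u₁).symm X z := by
  rw [VectorField.mpullback_apply]
  have h : chartDsymm u₁ z (X.inChart u₁ z) = X ((extChartAt 𝓘(ℝ, H) u₁).symm z) := by
    have h1 := X.chartDsymm_inChart ((extChartAt 𝓘(ℝ, H) u₁).map_target hz)
    rwa [(extChartAt 𝓘(ℝ, H) u₁).right_inv hz] at h1
  rw [← h]
  exact ((isInvertible_chartDsymm hz).inverse_apply_eq.2 rfl).symm

lemma VField.apply_eq_fderiv (X : VField H N) {f : N → ℝ} {u₁ u : N}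
    (hu : u ∈ (extChartAt 𝓘(ℝ, H) u₁).source) (hf : MDifferentiableAt 𝓘(ℝ, H) 𝓘(ℝ, ℝ) f u) :
    X.apply f u = fderiv ℝ (f ∘ (extChartAt 𝓘(ℝ, H) u₁).symm) (extChartAt 𝓘(ℝ, H) u₁ u)
      (X.inChart u₁ (extChartAt 𝓘(ℝ, H) u₁ u)) := by
  have hz := (extChartAt 𝓘(ℝ, H) u₁).map_source hu
  have hl := (extChartAt 𝓘(ℝ, H) u₁).left_inv hu
  rw [← mfderiv_eq_fderiv]
  have h := mfderiv_comp (I := 𝓘(ℝ, H)) (I' := 𝓘(ℝ, H)) (I'' := 𝓘(ℝ, ℝ)) (g := f)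
    (f := (extChartAt 𝓘(ℝ, H) u₁).symm) (extChartAt 𝓘(ℝ, H) u₁ u) (by rw [hl]; exact hf)
    (mdifferentiableAt_chart_symm hz)
  rw [h]
  have h2 := X.chartDsymm_inChart hu
  show _ = mfderiv 𝓘(ℝ, H) 𝓘(ℝ, ℝ) f ((extChartAt 𝓘(ℝ, H) u₁).symm (extChartAt 𝓘(ℝ, H) u₁ u))
    (chartDsymm u₁ (extChartAt 𝓘(ℝ, H) u₁ u) (X.inChart u₁ (extChartAt 𝓘(ℝ, H) u₁ u)))
  rw [h2, hl]
  rfl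

/-- The vector field with prescribed expression in the preferred chart at `u₁`. -/
def fieldOfChart (u₁ : N) (η : H → H) : VField H N := fun u =>
  chartDsymm u₁ (extChartAt 𝓘(ℝ, H) u₁ u) (η (extChartAt 𝓘(ℝ, H) u₁ u))

lemma inChart_fieldOfChart (u₁ : N) (η : H → H) {z : H}
    (hz : z ∈ (extChartAt 𝓘(ℝ, H) u₁).target) : (fieldOfChart u₁ η).inChart u₁ z = η z := by
  rw [VField.inChart, fieldOfChart, (extChartAt 𝓘(ℝ, H) u₁).right_inv hz, chartD_chartDsymm hz]

variable [CompleteSpace H]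

lemma VField.SmoothAt.inChart {X : VField H N} {u₁ : N} {z : H}
    (hz : z ∈ (extChartAt 𝓘(ℝ, H) u₁).target)
    (hX : X.SmoothAt ((extChartAt 𝓘(ℝ, H) u₁).symm z)) : ContDiffAt ℝ ∞ (X.inChart u₁) z := by
  have : IsManifold 𝓘(ℝ, H) 1 N := IsManifold.of_le (n := ∞) ENat.LEInfty.out
  have : IsManifold 𝓘(ℝ, H) (∞ + 1) N := by
    simpa using (inferInstance : IsManifold 𝓘(ℝ, H) ∞ N)
  have h1 := ContMDiffAt.mpullback_vectorField_preimage (I := 𝓘(ℝ, H)) (I' := 𝓘(ℝ, H))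
    (n := ∞) (m := ∞) hX (contMDiffAt_chart_symm hz) (isInvertible_chartDsymm (H := H) hz) (by simp)
  have h2 := contMDiffAt_vectorSpace_iff_contDiffAt.1 h1
  refine h2.congr_of_eventuallyEq ?_
  filter_upwards [(isOpen_chart_target u₁).mem_nhds hz] with z' hz'
  exact X.inChart_eq_mpullback hz'

lemma smoothAt_fieldOfChart {u₁ u : N} {η : H → H} (hu : u ∈ (extChartAt 𝓘(ℝ, H) u₁).source)
    (hη : ContDiffAt ℝ ∞ η (extChartAt 𝓘(ℝ, H) u₁ u)) : (fieldOfChart u₁ η).SmoothAt u := by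
  have : IsManifold 𝓘(ℝ, H) 1 N := IsManifold.of_le (n := ∞) ENat.LEInfty.out
  have : IsManifold 𝓘(ℝ, H) (∞ + 1) N := by
    simpa using (inferInstance : IsManifold 𝓘(ℝ, H) ∞ N)
  have h1 := ContMDiffAt.mpullback_vectorField_preimage (I := 𝓘(ℝ, H)) (I' := 𝓘(ℝ, H))
    (V := η) (n := ∞) (m := ∞) (contMDiffAt_vectorSpace_iff_contDiffAt.2 hη)
    (contMDiffAt_chart hu) (isInvertible_chartD (H := H) hu) (by simp)
  refine ContMDiffAt.congr_of_eventuallyEq h1 ?_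
  filter_upwards [(isOpen_extChartAt_source u₁).mem_nhds hu] with w hw
  have h2 : VectorField.mpullback 𝓘(ℝ, H) 𝓘(ℝ, H) (extChartAt 𝓘(ℝ, H) u₁) η w =
      fieldOfChart u₁ η w :=
    (isInvertible_chartD (H := H) hw).inverse_apply_eq.2 (chartD_chartDsymm' hw _).symm
  rw [h2]

lemma chartD_mlieBracket {X Y : VField H N} {u₁ u : N}
    (hu : u ∈ (extChartAt 𝓘(ℝ, H) u₁).source) (hX : X.SmoothAt u) (hY : Y.SmoothAt u) :
    chartD (H := H) u₁ u (VectorField.mlieBracket 𝓘(ℝ, H) X Y u) =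
      VectorField.lieBracket ℝ (X.inChart u₁) (Y.inChart u₁) (extChartAt 𝓘(ℝ, H) u₁ u) := by
  have hz := (extChartAt 𝓘(ℝ, H) u₁).map_source hu
  have hl := (extChartAt 𝓘(ℝ, H) u₁).left_inv hu
  have : IsManifold 𝓘(ℝ, H) (minSmoothness ℝ 3) N := by
    rw [minSmoothness_of_isRCLikeNormedField]
    exact IsManifold.of_le (n := ∞) ENat.LEInfty.out
  have : IsManifold 𝓘(ℝ, H) (minSmoothness ℝ 2) N := by
    rw [minSmoothness_of_isRCLikeNormedField]
    exact IsManifold.of_le (n := ∞) ENat.LEInfty.out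
  have h1 := VectorField.mpullback_mlieBracket (I := 𝓘(ℝ, H)) (I' := 𝓘(ℝ, H)) (V := X) (W := Y)
    (f := (extChartAt 𝓘(ℝ, H) u₁).symm) (x₀ := extChartAt 𝓘(ℝ, H) u₁ u) (n := ∞)
    (by rw [hl]; exact hX.mdiff) (by rw [hl]; exact hY.mdiff) (contMDiffAt_chart_symm hz) (by
      rw [minSmoothness_of_isRCLikeNormedField]
      exact ENat.LEInfty.out)
  have h2 := VField.inChart_eq_mpullback (VectorField.mlieBracket 𝓘(ℝ, H) X Y) hz
  have h3 := VField.inChart_apply_chart (VectorField.mlieBracket 𝓘(ℝ, H) X Y) hu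
  rw [← h3, h2, h1, ← VectorField.mlieBracketWithin_univ,
    VectorField.mlieBracketWithin_eq_lieBracketWithin]
  have hev : ∀ Z : VField H N, VectorField.mpullback 𝓘(ℝ, H) 𝓘(ℝ, H)
      (extChartAt 𝓘(ℝ, H) u₁).symm Z =ᶠ[𝓝 (extChartAt 𝓘(ℝ, H) u₁ u)] Z.inChart u₁ := fun Z => by
    filter_upwards [(isOpen_chart_target u₁).mem_nhds hz] with z' hz'
    exact (Z.inChart_eq_mpullback hz').symm
  exact (congrFun VectorField.lieBracketWithin_univ _).trans
    (Filter.EventuallyEq.lieBracket_vectorField_eq (hev X) (hev Y))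

/-- The Lie derivative of a `1`-form, in the preferred chart at `u₁`. -/
lemma PForm.lieDeriv_apply {θ : PForm H N 1} {U : Set N} (hθ : θ.SmoothOn U) {X : VField H N}
    {u₁ u : N} (huU : u ∈ U) (hu : u ∈ (extChartAt 𝓘(ℝ, H) u₁).source) (hX : X.SmoothAt u)
    (w : H) :
    PForm.lieDeriv X θ u ![w] = covLie (X.inChart u₁) (θ.cov u₁) (extChartAt 𝓘(ℝ, H) u₁ u)
      (chartD u₁ u w) := by
  have hint : ∀ (u' : N) (z : H), z ∈ (extChartAt 𝓘(ℝ, H) u').target →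
      PForm.interior X θ ((extChartAt 𝓘(ℝ, H) u').symm z) ![] = θ.cov u' z (X.inChart u' z) := by
    intro u' z hz
    rw [PForm.cov_apply]
    have h1 := X.chartDsymm_inChart ((extChartAt 𝓘(ℝ, H) u').map_target hz)
    rw [(extChartAt 𝓘(ℝ, H) u').right_inv hz] at h1
    rw [h1]
    rfl
  have hdiff : ∀ u' : N, u ∈ (extChartAt 𝓘(ℝ, H) u').source →
      ContDiffAt ℝ ∞ (θ.cov u') (extChartAt 𝓘(ℝ, H) u' u) ∧
      ContDiffAt ℝ ∞ (X.inChart u') (extChartAt 𝓘(ℝ, H) u' u) := fun u' hu' => by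
    have hz := (extChartAt 𝓘(ℝ, H) u').map_source hu'
    have hl := (extChartAt 𝓘(ℝ, H) u').left_inv hu'
    exact ⟨hθ.cov hz (by rwa [hl]), VField.SmoothAt.inChart hz (by rwa [hl])⟩
  have hev : ∀ u' : N, u ∈ (extChartAt 𝓘(ℝ, H) u').source →
      (fun z => PForm.interior X θ ((extChartAt 𝓘(ℝ, H) u').symm z) ![]) =ᶠ[
        𝓝 (extChartAt 𝓘(ℝ, H) u' u)] fun z => θ.cov u' z (X.inChart u' z) := fun u' hu' => by
    filter_upwards [(isOpen_chart_target u').mem_nhds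
      ((extChartAt 𝓘(ℝ, H) u').map_source hu')] with z hz
    exact hint u' z hz
  obtain ⟨h1, h2⟩ := hdiff u₁ hu
  have h1' := h1.differentiableAt (by simp)
  have h2' := h2.differentiableAt (by simp)
  have hself := mem_extChartAt_source (I := 𝓘(ℝ, H)) u
  have hd0 := (PForm.interior X θ).d_zero_apply hu
    ((((hdiff u hself).1.clm_apply (hdiff u hself).2).differentiableAt
      (by simp)).congr_of_eventuallyEq (hev u hself)) w
  rw [(hev u₁ hu).fderiv_eq, (h1'.hasFDerivAt.clm_apply h2'.hasFDerivAt).fderiv] at hd0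
  have hd1 : PForm.interior X θ.d u ![w] = covD (θ.cov u₁) (extChartAt 𝓘(ℝ, H) u₁ u)
      (X.inChart u₁ (extChartAt 𝓘(ℝ, H) u₁ u)) (chartD u₁ u w) := by
    rw [X.inChart_apply_chart hu]
    exact PForm.d_apply hθ huU hu (X u) w
  have hsum : PForm.lieDeriv X θ u ![w] =
      (PForm.interior X θ).d u ![w] + PForm.interior X θ.d u ![w] := rfl
  -- The terms in which the covector is differentiated along `w` cancel between `d (ι_X θ)` and `ι_X
  -- (d θ)`.
  rw [hsum, hd0, hd1, covD_apply, covLie_apply]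
  simp
  ring

end FieldCalculus

/-! ### Commutators and invariance for Lie derivatives of covector fields. -/

section CovectorCalculus

variable {H : Type*} [NormedAddCommGroup H] [NormedSpace ℝ H]

lemma covLie_congr {ξ ξ' : H → H} {ϑ ϑ' : H → H →L[ℝ] ℝ} {z : H} (h : ξ =ᶠ[𝓝 z] ξ')
    (h' : ϑ =ᶠ[𝓝 z] ϑ') : covLie ξ ϑ z = covLie ξ' ϑ' z := by
  rw [covLie, covLie, h.fderiv_eq, h'.fderiv_eq, h.eq_of_nhds, h'.eq_of_nhds]

lemma hasFDerivAt_covLie {ξ : H → H} {ϑ : H → H →L[ℝ] ℝ} {z : H} (hξ : ContDiffAt ℝ ∞ ξ z)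
    (hϑ : ContDiffAt ℝ ∞ ϑ z) (v w : H) :
    fderiv ℝ (covLie ξ ϑ) z v w = fderiv ℝ (fderiv ℝ ϑ) z v (ξ z) w +
      fderiv ℝ ϑ z (fderiv ℝ ξ z v) w + (fderiv ℝ ϑ z v (fderiv ℝ ξ z w) +
      ϑ z (fderiv ℝ (fderiv ℝ ξ) z v w)) := by
  have d1 : HasFDerivAt (fderiv ℝ ϑ) (fderiv ℝ (fderiv ℝ ϑ) z) z :=
    ((hϑ.fderiv_right (m := ∞) (by simp)).differentiableAt (by simp)).hasFDerivAt
  have d2 : HasFDerivAt (fderiv ℝ ξ) (fderiv ℝ (fderiv ℝ ξ) z) z :=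
    ((hξ.fderiv_right (m := ∞) (by simp)).differentiableAt (by simp)).hasFDerivAt
  have d3 := (hϑ.differentiableAt (by simp)).hasFDerivAt
  have d4 := (hξ.differentiableAt (by simp)).hasFDerivAt
  have h : HasFDerivAt (covLie ξ ϑ) _ z := (d1.clm_apply d4).add (d3.clm_comp d2)
  rw [h.fderiv]
  simp
  ring

lemma contDiffAt_covLie {ξ : H → H} {ϑ : H → H →L[ℝ] ℝ} {z : H} (hξ : ContDiffAt ℝ ∞ ξ z)
    (hϑ : ContDiffAt ℝ ∞ ϑ z) : ContDiffAt ℝ ∞ (covLie ξ ϑ) z :=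
  ((hϑ.fderiv_right (by simp)).clm_apply hξ).add (hϑ.clm_comp (hξ.fderiv_right (by simp)))

lemma fderiv_fderiv_comm {F : Type*} [NormedAddCommGroup F] [NormedSpace ℝ F] {g : H → F} {z : H}
    (hg : ContDiffAt ℝ ∞ g z) (v w : H) :
    fderiv ℝ (fderiv ℝ g) z v w = fderiv ℝ (fderiv ℝ g) z w v :=
  (hg.isSymmSndFDerivAt (by
    rw [minSmoothness_of_isRCLikeNormedField]
    exact ENat.LEInfty.out)) v w

/-- The Lie derivative along a bracket is the commutator of the Lie derivatives. -/
lemma covLie_lieBracket {ξ η : H → H} {ϑ : H → H →L[ℝ] ℝ} {z : H} (hξ : ContDiffAt ℝ ∞ ξ z)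
    (hη : ContDiffAt ℝ ∞ η z) (hϑ : ContDiffAt ℝ ∞ ϑ z) :
    covLie (VectorField.lieBracket ℝ ξ η) ϑ z =
      covLie ξ (covLie η ϑ) z - covLie η (covLie ξ ϑ) z := by
  have d1 : HasFDerivAt (fderiv ℝ η) (fderiv ℝ (fderiv ℝ η) z) z :=
    ((hη.fderiv_right (m := ∞) (by simp)).differentiableAt (by simp)).hasFDerivAt
  have d2 : HasFDerivAt (fderiv ℝ ξ) (fderiv ℝ (fderiv ℝ ξ) z) z :=
    ((hξ.fderiv_right (m := ∞) (by simp)).differentiableAt (by simp)).hasFDerivAt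
  have d3 := (hη.differentiableAt (by simp)).hasFDerivAt
  have d4 := (hξ.differentiableAt (by simp)).hasFDerivAt
  have h : HasFDerivAt (VectorField.lieBracket ℝ ξ η) _ z :=
    (d1.clm_apply d4).sub (d2.clm_apply d3)
  ext w
  rw [sub_apply, covLie_apply ξ (covLie η ϑ),
    covLie_apply η (covLie ξ ϑ), hasFDerivAt_covLie hη hϑ,
    hasFDerivAt_covLie hξ hϑ, covLie_apply, h.fderiv, fderiv_fderiv_comm hϑ (η z) (ξ z),
    fderiv_fderiv_comm hη (ξ z) w, fderiv_fderiv_comm hξ (η z) w]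
  simp [VectorField.lieBracket, covLie_apply]
  ring

lemma contDiffAt_covD {ϑ : H → H →L[ℝ] ℝ} {z : H} (hϑ : ContDiffAt ℝ ∞ ϑ z) :
    ContDiffAt ℝ ∞ (covD ϑ) z := by
  have h : ContDiffAt ℝ ∞ (fderiv ℝ ϑ) z := hϑ.fderiv_right (by simp)
  have h2 : ContDiff ℝ ∞ fun A : H →L[ℝ] H →L[ℝ] ℝ => A.flip := by
    refine IsBoundedLinearMap.contDiff ⟨⟨fun _ _ => rfl, fun _ _ => rfl⟩, 1, one_pos, fun A => ?_⟩
    rw [ContinuousLinearMap.opNorm_flip, one_mul]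
  exact h.sub (h2.contDiffAt.comp z h)

lemma fderiv_bilinear_apply {G : H → H →L[ℝ] H →L[ℝ] ℝ} {z : H} (hG : DifferentiableAt ℝ G z)
    (a v w : H) : fderiv ℝ (fun z => G z v w) z a = fderiv ℝ G z a v w := by
  have h1 := (hG.hasFDerivAt.clm_apply (hasFDerivAt_const v z)).clm_apply (hasFDerivAt_const w z)
  rw [h1.fderiv]
  simp

/-- The differential of an invariant covector field is invariant. -/
lemma covD_invariant {ξ : H → H} {ϑ : H → H →L[ℝ] ℝ} {z : H} (hξ : ContDiffAt ℝ ∞ ξ z)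
    (hϑ : ContDiffAt ℝ ∞ ϑ z) (h : covLie ξ ϑ =ᶠ[𝓝 z] 0) (v w : H) :
    fderiv ℝ (covD ϑ) z (ξ z) v w + covD ϑ z (fderiv ℝ ξ z v) w +
      covD ϑ z v (fderiv ℝ ξ z w) = 0 := by
  have d1 : DifferentiableAt ℝ (fderiv ℝ ϑ) z :=
    (hϑ.fderiv_right (m := ∞) (by simp)).differentiableAt (by simp)
  have h0 : ∀ a b, fderiv ℝ (covLie ξ ϑ) z a b = 0 := fun a b => by
    rw [h.fderiv_eq]
    simp [Pi.zero_def]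
  -- The derivative of `covLie ξ ϑ` is zero. Antisymmetrising it in `v`, `w` removes the symmetric
  -- term in the second derivative of `ξ` and leaves the invariance of `covD ϑ`.
  have e1 := h0 v w
  have e2 := h0 w v
  rw [hasFDerivAt_covLie hξ hϑ] at e1 e2
  rw [fderiv_fderiv_comm hϑ] at e1 e2
  rw [fderiv_fderiv_comm hξ w v] at e2
  have e3 : fderiv ℝ (covD ϑ) z (ξ z) v w = fderiv ℝ (fderiv ℝ ϑ) z (ξ z) v w -
      fderiv ℝ (fderiv ℝ ϑ) z (ξ z) w v := by
    rw [← fderiv_bilinear_apply ((contDiffAt_covD hϑ).differentiableAt (by simp)),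
      ← fderiv_bilinear_apply d1, ← fderiv_bilinear_apply d1]
    have hvw : ∀ v w, DifferentiableAt ℝ (fun z => fderiv ℝ ϑ z v w) z := fun v w =>
      (d1.clm_apply (differentiableAt_const v)).clm_apply (differentiableAt_const w)
    exact congrArg (fun A => A (ξ z)) (fderiv_fun_sub (hvw v w) (hvw w v))
  rw [e3, covD_apply, covD_apply]
  linarith

end CovectorCalculus

/-! Adapted coordinates. -/

section JetCoordinates

variable {n k : ℕ} {M : Type*} [TopologicalSpace M] [ChartedSpace (EuclideanSpace ℝ (Fin n)) M]
  [IsManifold (𝓡 n) ∞ M]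

lemma jetChartAt_source (u₁ : Jet n M k) : (extChartAt 𝓘(ℝ, JetModel n k) u₁).source =
    {u | u.point ∈ (chartAt (EuclideanSpace ℝ (Fin n)) u₁.point).source} := by
  rw [extChartAt_source]
  rfl

lemma jetChartAt_target (u₁ : Jet n M k) : (extChartAt 𝓘(ℝ, JetModel n k) u₁).target =
    {z | z.2 0 ∈ (chartAt (EuclideanSpace ℝ (Fin n)) u₁.point).target} := by
  rw [extChartAt_target]
  simp only [modelWithCornersSelf_coe_symm, preimage_id, modelWithCornersSelf_coe, range_id,
    inter_univ]
  rfl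

lemma jetChartAt_apply (u₁ u : Jet n M k) : extChartAt 𝓘(ℝ, JetModel n k) u₁ u =
    jetCoord (chartAt (EuclideanSpace ℝ (Fin n)) u₁.point)
      (IsManifold.chart_mem_maximalAtlas u₁.point) u := rfl

/-- The point of the coordinate space with the derivatives of the curve `c` at the time `t`. -/
def coordCurve (k : ℕ) (c : ℝ → EuclideanSpace ℝ (Fin n)) (t : ℝ) : JetModel n k :=
  (t, fun a => iteratedDeriv a c t)

lemma jetChartAt_jetLift (u₁ : Jet n M k) {γ : ℝ → M} {t : ℝ}
    (hγ : ContMDiffAt 𝓘(ℝ, ℝ) (𝓡 n) ∞ γ t)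
    (ht : γ t ∈ (chartAt (EuclideanSpace ℝ (Fin n)) u₁.point).source) :
    extChartAt 𝓘(ℝ, JetModel n k) u₁ (jetLift n k γ t) =
      coordCurve k (chartAt (EuclideanSpace ℝ (Fin n)) u₁.point ∘ γ) t :=
  jetCoord_jetLift (IsManifold.chart_mem_maximalAtlas u₁.point) hγ ht

lemma jetLift_mem_source (u₁ : Jet n M k) {γ : ℝ → M} {t : ℝ} :
    jetLift n k γ t ∈ (extChartAt 𝓘(ℝ, JetModel n k) u₁).source ↔
      γ t ∈ (chartAt (EuclideanSpace ℝ (Fin n)) u₁.point).source := by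
  rw [jetChartAt_source, mem_ofPred_eq, jetLift_point]

/-- The lift of a family of curves. -/
def jetLiftFamily (n k : ℕ) {M : Type*} [TopologicalSpace M]
    [ChartedSpace (EuclideanSpace ℝ (Fin n)) M] (F : ℝ × ℝ → M) (p : ℝ × ℝ) : Jet n M k :=
  jetLift n k (fun τ => F (τ, p.2)) p.1

/-- The expression of the lift of a family of curves in coordinates. -/
def coordFamily (k : ℕ) (C : ℝ × ℝ → EuclideanSpace ℝ (Fin n)) (p : ℝ × ℝ) : JetModel n k :=
  coordCurve k (fun τ => C (τ, p.2)) p.1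

lemma contDiffAt_coordFamily {C : ℝ × ℝ → EuclideanSpace ℝ (Fin n)} {O : Set (ℝ × ℝ)}
    (hO : IsOpen O) (hC : ContDiffOn ℝ ∞ C O) {p : ℝ × ℝ} (hp : p ∈ O) :
    ContDiffAt ℝ ∞ (coordFamily k C) p := by
  refine contDiffAt_fst.prodMk (contDiffAt_pi.2 fun a => ?_)
  -- `contDiffOn_iteratedDeriv_param` differentiates in the last variable, so time and parameter are
  -- exchanged.
  have hO' : IsOpen (Prod.swap ⁻¹' O : Set (ℝ × ℝ)) := hO.preimage continuous_swap
  have hC' : ContDiffOn ℝ ∞ (fun q : ℝ × ℝ => C (q.2, q.1)) (Prod.swap ⁻¹' O) :=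
    hC.comp (contDiff_snd.prodMk contDiff_fst).contDiffOn fun q hq => hq
  have h := contDiffOn_iteratedDeriv_param hO' hC' a
  have h2 : ContDiffAt ℝ ∞ (fun q : ℝ × ℝ => iteratedDeriv a (fun s => C (s, q.1)) q.2)
      (p.2, p.1) := h.contDiffAt (hO'.mem_nhds hp)
  exact h2.comp p (contDiff_snd.prodMk contDiff_fst).contDiffAt

lemma contMDiffAt_of_family {F : ℝ × ℝ → M} {O : Set (ℝ × ℝ)}
    (hO : IsOpen O) (hF : ContMDiffOn 𝓘(ℝ, ℝ × ℝ) (𝓡 n) ∞ F O) {p : ℝ × ℝ} (hp : p ∈ O) :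
    ContMDiffAt 𝓘(ℝ, ℝ) (𝓡 n) ∞ (fun τ => F (τ, p.2)) p.1 := by
  have h1 : ContMDiffAt 𝓘(ℝ, ℝ × ℝ) (𝓡 n) ∞ F ((fun τ => (τ, p.2)) p.1) :=
    hF.contMDiffAt (hO.mem_nhds hp)
  exact h1.comp p.1 (contDiff_prodMk_left p.2).contDiffAt.contMDiffAt

/-- The coordinates of the lift of a smooth family of curves. -/
lemma eventually_coord_jetLiftFamily (u₁ : Jet n M k) {F : ℝ × ℝ → M} {O : Set (ℝ × ℝ)}
    (hO : IsOpen O) (hF : ContMDiffOn 𝓘(ℝ, ℝ × ℝ) (𝓡 n) ∞ F O) {p : ℝ × ℝ} (hp : p ∈ O)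
    (hs : F p ∈ (chartAt (EuclideanSpace ℝ (Fin n)) u₁.point).source) :
    ContDiffAt ℝ ∞ (coordFamily k (chartAt (EuclideanSpace ℝ (Fin n)) u₁.point ∘ F)) p ∧
    ∀ᶠ q in 𝓝 p, q ∈ O ∧ jetLiftFamily n k F q ∈ (extChartAt 𝓘(ℝ, JetModel n k) u₁).source ∧
      extChartAt 𝓘(ℝ, JetModel n k) u₁ (jetLiftFamily n k F q) =
        coordFamily k (chartAt (EuclideanSpace ℝ (Fin n)) u₁.point ∘ F) q := by
  set φ := chartAt (EuclideanSpace ℝ (Fin n)) u₁.point with hφ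
  have hO' : IsOpen (O ∩ F ⁻¹' φ.source) :=
    hF.continuousOn.isOpen_inter_preimage hO φ.open_source
  refine ⟨contDiffAt_coordFamily hO' ?_ ⟨hp, hs⟩, ?_⟩
  · intro q hq
    exact (((contMDiffAt_of_mem_maximalAtlas (IsManifold.chart_mem_maximalAtlas u₁.point)
      hq.2).comp q (hF.contMDiffAt (hO.mem_nhds hq.1))).contDiffAt).contDiffWithinAt
  · filter_upwards [hO'.mem_nhds ⟨hp, hs⟩] with q hq
    exact ⟨hq.1, (jetLift_mem_source u₁).2 hq.2,
      jetChartAt_jetLift u₁ (contMDiffAt_of_family hO hF hq.1) hq.2⟩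

lemma contMDiffAt_jetLiftFamily {F : ℝ × ℝ → M} {O : Set (ℝ × ℝ)}
    (hO : IsOpen O) (hF : ContMDiffOn 𝓘(ℝ, ℝ × ℝ) (𝓡 n) ∞ F O) {p : ℝ × ℝ} (hp : p ∈ O) :
    ContMDiffAt 𝓘(ℝ, ℝ × ℝ) 𝓘(ℝ, JetModel n k) ∞ (jetLiftFamily n k F) p := by
  let u₁ : Jet n M k := jetLiftFamily n k F p
  have hu₁ : u₁.point = F p := jetLift_point _ _
  have hs : F p ∈ (chartAt (EuclideanSpace ℝ (Fin n)) u₁.point).source := by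
    rw [hu₁]
    exact mem_chart_source _ _
  obtain ⟨h1, h2⟩ := eventually_coord_jetLiftFamily u₁ hO hF hp hs
  have h3 := h2.self_of_nhds
  have h4 : ContMDiffAt 𝓘(ℝ, JetModel n k) 𝓘(ℝ, JetModel n k) ∞
      (extChartAt 𝓘(ℝ, JetModel n k) u₁).symm
      (coordFamily k (chartAt (EuclideanSpace ℝ (Fin n)) u₁.point ∘ F) p) := by
    rw [← h3.2.2]
    exact contMDiffAt_chart_symm ((extChartAt 𝓘(ℝ, JetModel n k) u₁).map_source h3.2.1)
  refine (h4.comp p h1.contMDiffAt).congr_of_eventuallyEq ?_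
  filter_upwards [h2] with q hq
  rw [Function.comp_apply, ← hq.2.2, (extChartAt 𝓘(ℝ, JetModel n k) u₁).left_inv hq.2.1]

/-- A single curve is viewed as a family constant in the parameter, so that its lift inherits the
regularity proved for lifts of families. -/
lemma exists_open_of_smoothCurveNear {γ : ℝ → M} {t : ℝ} (h : SmoothCurveNear n γ t) :
    ∃ O : Set (ℝ × ℝ), IsOpen O ∧ (t, (0 : ℝ)) ∈ O ∧
      ContMDiffOn 𝓘(ℝ, ℝ × ℝ) (𝓡 n) ∞ (fun p : ℝ × ℝ => γ p.1) O := by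
  obtain ⟨s, hs, hso, hts⟩ := mem_nhds_iff.1 h
  refine ⟨Prod.fst ⁻¹' s, hso.preimage continuous_fst, hts, fun p hp => ?_⟩
  have h1 : ContMDiffAt 𝓘(ℝ, ℝ) (𝓡 n) ∞ γ p.1 := hs hp
  exact (ContMDiffAt.comp p h1 contDiffAt_fst.contMDiffAt).contMDiffWithinAt

lemma contMDiffAt_jetLift {γ : ℝ → M} {t : ℝ} (h : SmoothCurveNear n γ t) :
    ContMDiffAt 𝓘(ℝ, ℝ) 𝓘(ℝ, JetModel n k) ∞ (jetLift n k γ) t := by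
  obtain ⟨O, hO, htO, hF⟩ := exists_open_of_smoothCurveNear h
  have h1 : ContMDiffAt 𝓘(ℝ, ℝ × ℝ) 𝓘(ℝ, JetModel n k) ∞
      (jetLiftFamily n k fun p : ℝ × ℝ => γ p.1) ((fun τ => (τ, (0 : ℝ))) t) :=
    contMDiffAt_jetLiftFamily hO hF htO
  exact h1.comp t (contDiff_prodMk_left (0 : ℝ)).contDiffAt.contMDiffAt

lemma eventually_coord_jetLift (u₁ : Jet n M k) {γ : ℝ → M} {t : ℝ} (h : SmoothCurveNear n γ t)
    (hs : γ t ∈ (chartAt (EuclideanSpace ℝ (Fin n)) u₁.point).source) :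
    ContDiffAt ℝ ∞ (coordCurve k (chartAt (EuclideanSpace ℝ (Fin n)) u₁.point ∘ γ)) t ∧
    ∀ᶠ s in 𝓝 t, jetLift n k γ s ∈ (extChartAt 𝓘(ℝ, JetModel n k) u₁).source ∧
      extChartAt 𝓘(ℝ, JetModel n k) u₁ (jetLift n k γ s) =
        coordCurve k (chartAt (EuclideanSpace ℝ (Fin n)) u₁.point ∘ γ) s := by
  obtain ⟨O, hO, htO, hF⟩ := exists_open_of_smoothCurveNear h
  obtain ⟨h1, h2⟩ := eventually_coord_jetLiftFamily u₁ hO hF htO hs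
  have hc : ContDiff ℝ ∞ fun τ : ℝ => (τ, (0 : ℝ)) := contDiff_prodMk_left 0
  have h1' : ContDiffAt ℝ ∞ (coordFamily k (chartAt (EuclideanSpace ℝ (Fin n)) u₁.point ∘
      fun p : ℝ × ℝ => γ p.1)) ((fun τ : ℝ => (τ, (0 : ℝ))) t) := h1
  have h4 := h1'.comp t hc.contDiffAt
  refine ⟨h4, ?_⟩
  have h3 : Tendsto (fun τ : ℝ => (τ, (0 : ℝ))) (𝓝 t) (𝓝 (t, 0)) := hc.continuous.continuousAt
  filter_upwards [h3.eventually h2] with s hs'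
  exact hs'.2

/-- The velocity in a chart. -/
lemma chartD_velocity {H : Type*} [NormedAddCommGroup H] [NormedSpace ℝ H]
    {N : Type*} [TopologicalSpace N] [ChartedSpace H N] [IsManifold 𝓘(ℝ, H) ∞ N]
    {u₁ : N} {c : ℝ → N} {t : ℝ} (hc : MDifferentiableAt 𝓘(ℝ, ℝ) 𝓘(ℝ, H) c t)
    (hs : c t ∈ (extChartAt 𝓘(ℝ, H) u₁).source) :
    HasDerivAt (fun s => extChartAt 𝓘(ℝ, H) u₁ (c s))
      (chartD (H := H) u₁ (c t) (mfderiv 𝓘(ℝ, ℝ) 𝓘(ℝ, H) c t (1 : ℝ))) t := by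
  have h := (mdifferentiableAt_chart hs).hasMFDerivAt.comp t hc.hasMFDerivAt
  have h2 : HasFDerivAt (fun s => extChartAt 𝓘(ℝ, H) u₁ (c s))
      ((chartD (H := H) u₁ (c t)).comp (mfderiv 𝓘(ℝ, ℝ) 𝓘(ℝ, H) c t : ℝ →L[ℝ] H)) t :=
    hasMFDerivAt_iff_hasFDerivAt.1 h
  exact h2.hasDerivAt

lemma iteratedDeriv_coordCurve {c : ℝ → EuclideanSpace ℝ (Fin n)} {t : ℝ}
    (hc : ContDiffAt ℝ ∞ c t) :
    HasDerivAt (coordCurve k c) (1, fun a => iteratedDeriv (a + 1) c t) t := by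
  refine (hasDerivAt_id t).prodMk (hasDerivAt_pi.2 fun a => ?_)
  rw [iteratedDeriv_succ]
  refine DifferentiableAt.hasDerivAt ?_
  have h := (hc.contDiffWithinAt (s := univ)).differentiableWithinAt_iteratedDerivWithin
    (m := (a : ℕ)) (by exact_mod_cast ENat.natCast_lt_top _) (by simp)
  rwa [iteratedDerivWithin_univ, differentiableWithinAt_univ] at h

end JetCoordinates

/-! The holonomic distribution in adapted coordinates. -/

section ContactForm

variable {n k : ℕ}

/-- The contact forms `dy_(a) - y_(a+1) dt`, `a < k`. -/
def contactForm (z : JetModel n k) :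
    JetModel n k →L[ℝ] (Fin k → EuclideanSpace ℝ (Fin n)) :=
  ContinuousLinearMap.pi fun a =>
    (ContinuousLinearMap.proj (R := ℝ) a.castSucc).comp
      (ContinuousLinearMap.snd ℝ ℝ (Fin (k + 1) → EuclideanSpace ℝ (Fin n))) -
    (ContinuousLinearMap.fst ℝ ℝ (Fin (k + 1) → EuclideanSpace ℝ (Fin n))).smulRight (z.2 a.succ)

lemma contactForm_apply (z v : JetModel n k) (a : Fin k) :
    contactForm z v a = v.2 a.castSucc - v.1 • z.2 a.succ := rfl

lemma totalVec_castSucc (z : JetModel n k) (a : Fin k) :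
    (totalVec z).2 a.castSucc = z.2 a.succ := by
  have h : (a.castSucc : ℕ) + 1 < k + 1 := by simp
  exact dif_pos h

lemma totalVec_last (z : JetModel n k) : (totalVec z).2 (Fin.last k) = 0 :=
  dif_neg (by simp)

/-- The contact equations determine the components of order below `k` from the time component. Only
the time and the top-order components remain free. -/
lemma contactForm_eq_zero_iff {z v : JetModel n k} : contactForm z v = 0 ↔
    v = v.1 • totalVec z + (0, Pi.single (Fin.last k) (v.2 (Fin.last k))) := by
  constructor
  · intro h
    refine Prod.ext (by simp [totalVec]) (funext fun a => ?_)
    refine Fin.lastCases ?_ (fun b => ?_) a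
    · simp [totalVec_last]
    · have hb := congrFun h b
      rw [contactForm_apply] at hb
      have : b.castSucc ≠ Fin.last k := (Fin.castSucc_lt_last b).ne
      simp [totalVec_castSucc, this, sub_eq_zero.1 hb]
  · intro h
    funext a
    have : a.castSucc ≠ Fin.last k := (Fin.castSucc_lt_last a).ne
    have h1 : v.2 a.castSucc = v.1 • z.2 a.succ := by
      nth_rewrite 1 [h]
      simp [totalVec_castSucc, this]
    rw [contactForm_apply, h1, sub_self]
    rfl

lemma contactForm_totalVec (z : JetModel n k) : contactForm z (totalVec z) = 0 := by
  funext a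
  rw [contactForm_apply, totalVec_castSucc]
  simp [totalVec]

end ContactForm

/-! ### Velocities of lifts, and the projections of jet spaces, in adapted coordinates. -/

section JetCoordinates

variable {n k : ℕ} {M : Type*} [TopologicalSpace M] [ChartedSpace (EuclideanSpace ℝ (Fin n)) M]
  [IsManifold (𝓡 n) ∞ M]

lemma chartD_jetVelocity (u₁ : Jet n M k) {γ : ℝ → M} {t : ℝ} (h : SmoothCurveNear n γ t)
    (hs : γ t ∈ (chartAt (EuclideanSpace ℝ (Fin n)) u₁.point).source) :
    chartD u₁ (jetLift n k γ t) (jetVelocity n k γ t) = ((1 : ℝ), fun a : Fin (k + 1) =>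
      iteratedDeriv (a + 1) (chartAt (EuclideanSpace ℝ (Fin n)) u₁.point ∘ γ) t) := by
  have h1 := chartD_velocity (u₁ := u₁) ((contMDiffAt_jetLift (k := k) h).mdifferentiableAt
    (by simp)) ((jetLift_mem_source u₁).2 hs)
  have h2 := iteratedDeriv_coordCurve (k := k)
    (contDiffAt_chart_comp (IsManifold.chart_mem_maximalAtlas u₁.point) h.self_of_nhds hs)
  refine h1.unique (h2.congr_of_eventuallyEq ?_)
  filter_upwards [(eventually_coord_jetLift u₁ h hs).2] with s hs'
  exact hs'.2

lemma hasDerivAt_coord_jetLift (u₁ : Jet n M k) {γ : ℝ → M} {t : ℝ} (h : SmoothCurveNear n γ t)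
    (hs : γ t ∈ (chartAt (EuclideanSpace ℝ (Fin n)) u₁.point).source) :
    HasDerivAt (fun s => extChartAt 𝓘(ℝ, JetModel n k) u₁ (jetLift n k γ s))
      (chartD u₁ (jetLift n k γ t) (jetVelocity n k γ t)) t :=
  chartD_velocity (u₁ := u₁) ((contMDiffAt_jetLift (k := k) h).mdifferentiableAt
    (by simp)) ((jetLift_mem_source u₁).2 hs)

lemma contactForm_jetVelocity (u₁ : Jet n M k) {γ : ℝ → M} {t : ℝ} (h : SmoothCurveNear n γ t)
    (hs : γ t ∈ (chartAt (EuclideanSpace ℝ (Fin n)) u₁.point).source) :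
    contactForm (extChartAt 𝓘(ℝ, JetModel n k) u₁ (jetLift n k γ t))
      (chartD u₁ (jetLift n k γ t) (jetVelocity n k γ t)) = 0 := by
  funext a
  rw [contactForm_apply, chartD_jetVelocity u₁ h hs, jetChartAt_jetLift u₁ h.self_of_nhds hs]
  simp [coordCurve]

/-- Every contact vector with unit time component is the velocity of a lift. -/
lemma exists_curve_of_contact (u₁ : Jet n M k) {u : Jet n M k}
    (hu : u ∈ (extChartAt 𝓘(ℝ, JetModel n k) u₁).source) (y : EuclideanSpace ℝ (Fin n)) :
    ∃ (γ : ℝ → M) (t : ℝ), SmoothCurveNear n γ t ∧ jetLift n k γ t = u ∧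
      chartD u₁ u (jetVelocity n k γ t) =
        totalVec (extChartAt 𝓘(ℝ, JetModel n k) u₁ u) + (0, Pi.single (Fin.last k) y) := by
  set φ := chartAt (EuclideanSpace ℝ (Fin n)) u₁.point with hφ
  have hφm : φ ∈ IsManifold.maximalAtlas (𝓡 n) ∞ M := IsManifold.chart_mem_maximalAtlas u₁.point
  set z := extChartAt 𝓘(ℝ, JetModel n k) u₁ u with hz
  have hzt : z ∈ (extChartAt 𝓘(ℝ, JetModel n k) u₁).target :=
    (extChartAt 𝓘(ℝ, JetModel n k) u₁).map_source hu
  have hz0 : z.2 0 ∈ φ.target := by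
    rw [jetChartAt_target] at hzt
    exact hzt
  -- A Taylor polynomial of degree `k + 1` has the prescribed `k`-jet. Its additional derivative `y`
  -- becomes the top-order component of the velocity of the lift.
  let z' : JetModel n (k + 1) := (z.1, Fin.snoc z.2 y)
  have hz'c : ∀ a : Fin (k + 1), z'.2 a.castSucc = z.2 a := fun a => by
    simp only [z', Fin.snoc_castSucc]
  have hz'l : z'.2 (Fin.last (k + 1)) = y := by simp only [z', Fin.snoc_last]
  have h0 : taylorCurve z' z.1 = z.2 0 := (taylorCurve_self z').trans (hz'c 0)
  have hev : ∀ᶠ s in 𝓝 z.1, taylorCurve z' s ∈ φ.target :=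
    (contDiffAt_taylorCurve z' z.1).continuousAt.eventually
      (φ.open_target.mem_nhds (by rw [h0]; exact hz0))
  have hsm : SmoothCurveNear n (φ.symm ∘ taylorCurve z') z.1 := by
    filter_upwards [hev] with s hs
    exact (contMDiffAt_symm_of_mem_maximalAtlas hφm hs).comp s
      (contDiffAt_taylorCurve z' s).contMDiffAt
  have hsrc : (φ.symm ∘ taylorCurve z') z.1 ∈ φ.source := by
    rw [Function.comp_apply, h0]
    exact φ.map_target hz0
  have hit : ∀ b, iteratedDeriv b (φ ∘ (φ.symm ∘ taylorCurve z')) z.1 =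
      iteratedDeriv b (taylorCurve z') z.1 := by
    intro b
    refine Filter.EventuallyEq.iteratedDeriv_eq _ ?_
    filter_upwards [hev] with s hs
    exact φ.right_inv hs
  have hjet : jetLift n k (φ.symm ∘ taylorCurve z') z.1 = u := by
    refine (extChartAt 𝓘(ℝ, JetModel n k) u₁).injOn ((jetLift_mem_source u₁).2 hsrc) hu ?_
    rw [jetChartAt_jetLift u₁ hsm.self_of_nhds hsrc]
    refine Prod.ext rfl (funext fun a => ?_)
    refine (hit a).trans ((iteratedDeriv_taylorCurve z' a.castSucc).trans (hz'c a))
  refine ⟨_, z.1, hsm, hjet, ?_⟩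
  have hv := chartD_jetVelocity (k := k) u₁ hsm hsrc
  rw [hjet] at hv
  rw [hv]
  refine Prod.ext (by simp [totalVec]) (funext fun a => ?_)
  have h2 : iteratedDeriv ((a : ℕ) + 1) (φ ∘ (φ.symm ∘ taylorCurve z')) z.1 = z'.2 a.succ :=
    (hit _).trans (iteratedDeriv_taylorCurve z' a.succ)
  refine h2.trans ?_
  refine Fin.lastCases ?_ (fun b => ?_) a
  · rw [Fin.succ_last, hz'l]
    simp [totalVec_last]
  · have : b.castSucc ≠ Fin.last k := (Fin.castSucc_lt_last b).ne
    rw [Fin.succ_castSucc, hz'c]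
    simp [totalVec_castSucc, this]

/-- The holonomic distribution is the kernel of the contact forms. -/
lemma mem_holonomicDist_iff (u₁ : Jet n M k) {u : Jet n M k}
    (hu : u ∈ (extChartAt 𝓘(ℝ, JetModel n k) u₁).source) {v : JetModel n k} :
    v ∈ holonomicDist u ↔
      contactForm (extChartAt 𝓘(ℝ, JetModel n k) u₁ u) (chartD u₁ u v) = 0 := by
  set z := extChartAt 𝓘(ℝ, JetModel n k) u₁ u with hz
  constructor
  · intro hv
    have hle : holonomicDist u ≤ ((contactForm z).comp (chartD u₁ u)).ker := by
      refine Submodule.span_le.2 ?_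
      rintro _ ⟨γ, t, hγ, rfl, rfl⟩
      exact contactForm_jetVelocity u₁ hγ ((jetLift_mem_source u₁).1 hu)
    exact hle hv
  · intro hv
    rw [contactForm_eq_zero_iff] at hv
    have hgen : ∀ y, chartDsymm u₁ z (totalVec z + (0, Pi.single (Fin.last k) y)) ∈
        holonomicDist u := by
      intro y
      obtain ⟨γ, t, h1, h2, h3⟩ := exists_curve_of_contact u₁ hu y
      rw [← h3, chartDsymm_chartD hu]
      exact Submodule.subset_span ⟨γ, t, h1, h2, rfl⟩
    set w := chartD u₁ u v with hw
    have hvw : v = chartDsymm u₁ z w := (chartDsymm_chartD hu v).symm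
    -- Velocities always have time component `1`. The purely top-order directions arise as
    -- differences of two of them.
    have hdec : w = w.1 • (totalVec z + (0, Pi.single (Fin.last k) 0)) +
        ((totalVec z + (0, Pi.single (Fin.last k) (w.2 (Fin.last k)))) -
          (totalVec z + (0, Pi.single (Fin.last k) 0))) := by
      nth_rewrite 1 [hv]
      simp
    rw [hvw, hdec, map_add, map_smul, map_sub]
    exact add_mem (Submodule.smul_mem _ _ (hgen _)) (sub_mem (hgen _) (hgen _))

/-- Vectors whose components along `t` and `y_(0)` vanish are vertical over `E`. -/
lemma mfderiv_base_eq_zero (u₁ : Jet n M k) {u : Jet n M k}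
    (hu : u ∈ (extChartAt 𝓘(ℝ, JetModel n k) u₁).source) {v : JetModel n k}
    (h1 : (chartD u₁ u v).1 = 0) (h2 : (chartD u₁ u v).2 0 = 0) :
    mfderiv 𝓘(ℝ, JetModel n k) (𝓘(ℝ, ℝ).prod (𝓡 n)) (Jet.base : Jet n M k → ℝ × M) u v = 0 := by
  set φ := chartAt (EuclideanSpace ℝ (Fin n)) u₁.point with hφ
  have hφm : φ ∈ IsManifold.maximalAtlas (𝓡 n) ∞ M := IsManifold.chart_mem_maximalAtlas u₁.point
  set e := extChartAt 𝓘(ℝ, JetModel n k) u₁ with he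
  have hzt : (e u).2 0 ∈ φ.target := by
    have := e.map_source hu
    rw [he, jetChartAt_target] at this
    exact this
  let L : JetModel n k →L[ℝ] ℝ × EuclideanSpace ℝ (Fin n) :=
    (ContinuousLinearMap.fst ℝ ℝ _).prod ((ContinuousLinearMap.proj (R := ℝ) 0).comp
      (ContinuousLinearMap.snd ℝ ℝ (Fin (k + 1) → EuclideanSpace ℝ (Fin n))))
  let g : ℝ × EuclideanSpace ℝ (Fin n) → ℝ × M := fun p => (p.1, φ.symm p.2)
  -- Near `u` the projection to `E` factors through the coordinates `(t, y_(0))`.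
  have hbase : (Jet.base : Jet n M k → ℝ × M) =ᶠ[𝓝 u] g ∘ (L ∘ e) := by
    have hopen : e.source ∈ 𝓝 u := extChartAt_source_mem_nhds' hu
    filter_upwards [hopen] with w hw
    have h3 : e.symm (e w) = w := e.left_inv hw
    have h4 : (jetLift n k (φ.symm ∘ taylorCurve (e w)) (e w).1) = w := h3
    refine Prod.ext ?_ ?_
    · revert w
      intro w
      exact Quotient.inductionOn w fun p _ _ _ => rfl
    · show w.point = φ.symm ((e w).2 0)
      conv_lhs => rw [← h4]
      rw [jetLift_point, Function.comp_apply, taylorCurve_self]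
  have hg : MDifferentiableAt 𝓘(ℝ, ℝ × EuclideanSpace ℝ (Fin n)) (𝓘(ℝ, ℝ).prod (𝓡 n)) g
      ((L ∘ e) u) := by
    refine MDifferentiableAt.prodMk (differentiableAt_fst.mdifferentiableAt) ?_
    have h5 : MDifferentiableAt (𝓡 n) (𝓡 n) φ.symm (Prod.snd ((L ∘ e) u)) :=
      (contMDiffAt_symm_of_mem_maximalAtlas (n := ∞) hφm hzt).mdifferentiableAt (by simp)
    exact h5.comp ((L ∘ e) u) differentiableAt_snd.mdifferentiableAt
  have hL : MDifferentiableAt 𝓘(ℝ, JetModel n k) 𝓘(ℝ, ℝ × EuclideanSpace ℝ (Fin n)) L (e u) :=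
    L.differentiableAt.mdifferentiableAt
  have hLe := HasMFDerivAt.comp u hL.hasMFDerivAt (mdifferentiableAt_chart hu).hasMFDerivAt
  have hfin := (hg.hasMFDerivAt.comp u hLe).congr_of_eventuallyEq hbase
  rw [hfin.mfderiv]
  have h6 : L (chartD u₁ u v) = 0 := Prod.ext h1 h2
  have h7 : (mfderiv 𝓘(ℝ, JetModel n k) 𝓘(ℝ, ℝ × EuclideanSpace ℝ (Fin n)) L (e u) :
      JetModel n k →L[ℝ] ℝ × EuclideanSpace ℝ (Fin n)) = L :=
    mfderiv_eq_fderiv.trans L.fderiv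
  show mfderiv 𝓘(ℝ, ℝ × EuclideanSpace ℝ (Fin n)) (𝓘(ℝ, ℝ).prod (𝓡 n)) g ((L ∘ e) u)
    (mfderiv 𝓘(ℝ, JetModel n k) 𝓘(ℝ, ℝ × EuclideanSpace ℝ (Fin n)) L (e u)
      (chartD (H := JetModel n k) u₁ u v)) = 0
  have h8 : mfderiv 𝓘(ℝ, JetModel n k) 𝓘(ℝ, ℝ × EuclideanSpace ℝ (Fin n)) L (e u)
      (chartD (H := JetModel n k) u₁ u v) = 0 :=
    (congrArg (fun A : JetModel n k →L[ℝ] ℝ × EuclideanSpace ℝ (Fin n) => A (chartD (H := JetModel n k) u₁ u v))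
      h7).trans h6
  exact (congrArg _ h8).trans (map_zero _)

/-- The truncation of adapted coordinates. -/
def truncCLM {r : ℕ} (hr : r ≤ k) : JetModel n k →L[ℝ] JetModel n r :=
  (ContinuousLinearMap.fst ℝ ℝ _).prod (ContinuousLinearMap.pi fun a =>
    (ContinuousLinearMap.proj (R := ℝ) (Fin.castLE (Nat.succ_le_succ hr) a)).comp
      (ContinuousLinearMap.snd ℝ ℝ (Fin (k + 1) → EuclideanSpace ℝ (Fin n))))

/-- The preferred charts at `u₁` and at its projection are induced by the same chart of `M`, so the
identity is definitional on representatives. -/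
lemma jetChartAt_proj {r : ℕ} (hr : r ≤ k) (u₁ u : Jet n M k) :
    extChartAt 𝓘(ℝ, JetModel n r) (Jet.proj hr u₁) (Jet.proj hr u) =
      truncCLM hr (extChartAt 𝓘(ℝ, JetModel n k) u₁ u) := by
  rw [jetChartAt_apply, jetChartAt_apply]
  refine Quotient.inductionOn₂ u₁ u fun p q => ?_
  rfl

lemma proj_mem_source {r : ℕ} (hr : r ≤ k) {u₁ u : Jet n M k}
    (hu : u ∈ (extChartAt 𝓘(ℝ, JetModel n k) u₁).source) :
    Jet.proj hr u ∈ (extChartAt 𝓘(ℝ, JetModel n r) (Jet.proj hr u₁)).source := by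
  rw [jetChartAt_source] at hu ⊢
  revert hu
  refine Quotient.inductionOn₂ u₁ u fun p q h => ?_
  exact h

lemma mdifferentiableAt_proj {r : ℕ} (hr : r ≤ k) (u : Jet n M k) :
    MDifferentiableAt 𝓘(ℝ, JetModel n k) 𝓘(ℝ, JetModel n r) (Jet.proj hr : Jet n M k → _) u := by
  set e := extChartAt 𝓘(ℝ, JetModel n k) u
  set e' := extChartAt 𝓘(ℝ, JetModel n r) (Jet.proj hr u)
  have hu : u ∈ e.source := mem_extChartAt_source u
  have h1 : MDifferentiableAt 𝓘(ℝ, JetModel n r) 𝓘(ℝ, JetModel n r) e'.symm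
      ((truncCLM hr ∘ e) u) := by
    refine mdifferentiableAt_chart_symm ?_
    rw [Function.comp_apply, ← jetChartAt_proj hr u u]
    exact e'.map_source (proj_mem_source hr hu)
  have h2 : MDifferentiableAt 𝓘(ℝ, JetModel n k) 𝓘(ℝ, JetModel n r)
      (truncCLM (n := n) hr) (e u) := (truncCLM hr).differentiableAt.mdifferentiableAt
  have h3 := h1.comp u (h2.comp u (mdifferentiableAt_chart hu))
  refine h3.congr_of_eventuallyEq ?_
  have hopen : e.source ∈ 𝓝 u := extChartAt_source_mem_nhds u
  filter_upwards [hopen] with w hw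
  have h4 := e'.left_inv (proj_mem_source hr hw)
  rw [jetChartAt_proj hr u w] at h4
  exact h4.symm

lemma chartD_proj {r : ℕ} (hr : r ≤ k) {u₁ u : Jet n M k}
    (hu : u ∈ (extChartAt 𝓘(ℝ, JetModel n k) u₁).source) (v : JetModel n k) :
    chartD (H := JetModel n r) (Jet.proj hr u₁) (Jet.proj hr u)
      (mfderiv 𝓘(ℝ, JetModel n k) 𝓘(ℝ, JetModel n r) (Jet.proj hr : Jet n M k → _) u v) =
      truncCLM hr (chartD u₁ u v) := by
  have h1 := (mdifferentiableAt_chart (proj_mem_source hr hu)).hasMFDerivAt.comp u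
    (mdifferentiableAt_proj hr u).hasMFDerivAt
  have h2 := HasMFDerivAt.comp u (f := extChartAt 𝓘(ℝ, JetModel n k) u₁)
    (hasMFDerivAt_iff_hasFDerivAt.2 (truncCLM (n := n) hr).hasFDerivAt)
    (mdifferentiableAt_chart hu).hasMFDerivAt
  have h3 : (extChartAt 𝓘(ℝ, JetModel n r) (Jet.proj hr u₁) ∘ Jet.proj hr : Jet n M k → _) =
      truncCLM hr ∘ extChartAt 𝓘(ℝ, JetModel n k) u₁ := funext fun w => jetChartAt_proj hr u₁ w
  rw [h3] at h1
  exact congrArg (fun A : JetModel n k →L[ℝ] JetModel n r => A v) (hasMFDerivAt_unique h1 h2)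

/-- A `1`-form of order `r` in adapted coordinates. -/
lemma HasOrderOn.exists_cov {U : Set (Jet n M k)} {θ : JForm n k M 1} {r : ℕ}
    (h : HasOrderOn U θ r) (u₁ : Jet n M k) :
    ∃ (hr : r ≤ k) (β : JetModel n r → JetModel n r →L[ℝ] ℝ),
      ∀ z ∈ (extChartAt 𝓘(ℝ, JetModel n k) u₁).target,
        (extChartAt 𝓘(ℝ, JetModel n k) u₁).symm z ∈ U →
        ∀ v, θ.cov u₁ z v = β (truncCLM hr z) (truncCLM hr v) := by
  obtain ⟨hr, V, β, -, -, -, hβ⟩ := h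
  refine ⟨hr, β.cov (Jet.proj hr u₁), fun z hz hzU v => ?_⟩
  set e := extChartAt 𝓘(ℝ, JetModel n k) u₁
  have hu : e.symm z ∈ e.source := e.map_target hz
  rw [PForm.cov_apply, hβ _ hzU]
  have h1 : (PForm.pullback (Jet.proj hr) β (e.symm z)) ![chartDsymm u₁ z v] =
      β (Jet.proj hr (e.symm z)) ![(mfderiv 𝓘(ℝ, JetModel n k) 𝓘(ℝ, JetModel n r)
        (Jet.proj hr : Jet n M k → _) (e.symm z) (chartDsymm u₁ z v) : JetModel n r)] := by
    show β (Jet.proj hr (e.symm z)) _ = _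
    congr 1
    funext i
    fin_cases i
    rfl
  have h2 := β.apply_eq_cov (proj_mem_source hr hu)
    (mfderiv 𝓘(ℝ, JetModel n k) 𝓘(ℝ, JetModel n r)
        (Jet.proj hr : Jet n M k → _) (e.symm z) (chartDsymm u₁ z v) : JetModel n r)
  have h3 := chartD_proj hr hu (chartDsymm u₁ z v)
  rw [chartD_chartDsymm hz] at h3
  have h4 := jetChartAt_proj hr u₁ (e.symm z)
  have h5 : extChartAt 𝓘(ℝ, JetModel n k) u₁ (e.symm z) = z := e.right_inv hz
  rw [h5] at h4
  refine h1.trans (h2.trans ?_)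
  rw [h4]
  exact congrArg _ h3

end JetCoordinates

/-! ### Evaluation and differential of a `1`-form along a map. -/

section Pullback

variable {H : Type*} [NormedAddCommGroup H] [NormedSpace ℝ H]
  {N : Type*} [TopologicalSpace N] [ChartedSpace H N]

/-- The set of the coordinates of the points of `U` in the preferred chart at `u₁`. -/
def chartDomain (u₁ : N) (U : Set N) : Set H :=
  (extChartAt 𝓘(ℝ, H) u₁).target ∩ (extChartAt 𝓘(ℝ, H) u₁).symm ⁻¹' U

lemma isOpen_chartDomain (u₁ : N) {U : Set N} (hU : IsOpen U) :
    IsOpen (chartDomain (H := H) u₁ U) :=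
  (continuousOn_extChartAt_symm u₁).isOpen_inter_preimage (isOpen_extChartAt_target u₁) hU

lemma mem_chartDomain {u₁ u : N} {U : Set N} (hu : u ∈ (extChartAt 𝓘(ℝ, H) u₁).source)
    (hU : u ∈ U) : extChartAt 𝓘(ℝ, H) u₁ u ∈ chartDomain (H := H) u₁ U :=
  ⟨(extChartAt 𝓘(ℝ, H) u₁).map_source hu, by
    rw [mem_preimage, (extChartAt 𝓘(ℝ, H) u₁).left_inv hu]
    exact hU⟩

lemma covD_neg_swap (ϑ : H → H →L[ℝ] ℝ) (z v w : H) : covD ϑ z v w = -covD ϑ z w v := by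
  rw [covD_apply, covD_apply]
  ring

variable {V : Type*} [NormedAddCommGroup V] [NormedSpace ℝ V] [IsManifold 𝓘(ℝ, H) ∞ N]

/-- The evaluation of a `1`-form on the derivative of a map. -/
def PForm.along (θ : PForm H N 1) (f : V → N) (w q : V) : ℝ :=
  θ (f q) ![(mfderiv 𝓘(ℝ, V) 𝓘(ℝ, H) f q w : H)]

lemma fderiv_chart_comp {u₁ : N} {f : V → N} {q : V}
    (hf : MDifferentiableAt 𝓘(ℝ, V) 𝓘(ℝ, H) f q)
    (hs : f q ∈ (extChartAt 𝓘(ℝ, H) u₁).source) (w : V) :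
    fderiv ℝ (fun q => extChartAt 𝓘(ℝ, H) u₁ (f q)) q w =
      chartD (H := H) u₁ (f q) (mfderiv 𝓘(ℝ, V) 𝓘(ℝ, H) f q w) := by
  have h := (mdifferentiableAt_chart hs).hasMFDerivAt.comp q hf.hasMFDerivAt
  obtain ⟨A, hA⟩ : ∃ A : V →L[ℝ] H, A = mfderiv 𝓘(ℝ, V) 𝓘(ℝ, H) f q := ⟨_, rfl⟩
  have h2 : HasFDerivAt (fun q => extChartAt 𝓘(ℝ, H) u₁ (f q)) ((chartD (H := H) u₁ (f q)).comp A)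
      q := by
    rw [hA]
    exact hasMFDerivAt_iff_hasFDerivAt.1 h
  rw [h2.fderiv, hA]
  rfl

lemma contDiffAt_chart_comp_map {u₁ : N} {f : V → N} {q : V}
    (hf : ContMDiffAt 𝓘(ℝ, V) 𝓘(ℝ, H) ∞ f q)
    (hs : f q ∈ (extChartAt 𝓘(ℝ, H) u₁).source) :
    ContDiffAt ℝ ∞ (fun q => extChartAt 𝓘(ℝ, H) u₁ (f q)) q :=
  ((contMDiffAt_chart hs).comp q hf).contDiffAt

lemma PForm.along_eq (θ : PForm H N 1) {u₁ : N} {f : V → N} {q : V}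
    (hf : MDifferentiableAt 𝓘(ℝ, V) 𝓘(ℝ, H) f q)
    (hs : f q ∈ (extChartAt 𝓘(ℝ, H) u₁).source) (w : V) :
    θ.along f w q = θ.cov u₁ (extChartAt 𝓘(ℝ, H) u₁ (f q))
      (fderiv ℝ (fun q => extChartAt 𝓘(ℝ, H) u₁ (f q)) q w) := by
  rw [fderiv_chart_comp hf hs]
  exact θ.apply_eq_cov hs _

lemma PForm.along_eventuallyEq (θ : PForm H N 1) {f : V → N} {p : V} (u₁ : N)
    (hf : ∀ᶠ q in 𝓝 p, ContMDiffAt 𝓘(ℝ, V) 𝓘(ℝ, H) ∞ f q)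
    (hs : f p ∈ (extChartAt 𝓘(ℝ, H) u₁).source) (w : V) :
    θ.along f w =ᶠ[𝓝 p] fun q => θ.cov u₁ (extChartAt 𝓘(ℝ, H) u₁ (f q))
      (fderiv ℝ (fun q => extChartAt 𝓘(ℝ, H) u₁ (f q)) q w) := by
  filter_upwards [hf, hf.self_of_nhds.continuousAt
    ((isOpen_extChartAt_source (I := 𝓘(ℝ, H)) u₁).mem_nhds hs)] with q hq hq2
  exact θ.along_eq (hq.mdifferentiableAt (by simp)) hq2 w

lemma PForm.SmoothOn.contDiffAt_along {θ : PForm H N 1} {U : Set N} (hθ : θ.SmoothOn U)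
    {f : V → N} {p : V} (hf : ∀ᶠ q in 𝓝 p, ContMDiffAt 𝓘(ℝ, V) 𝓘(ℝ, H) ∞ f q)
    (hp : f p ∈ U) (w : V) : ContDiffAt ℝ ∞ (θ.along f w) p := by
  have hs := mem_extChartAt_source (I := 𝓘(ℝ, H)) (f p)
  refine ContDiffAt.congr_of_eventuallyEq ?_ (θ.along_eventuallyEq (f p) hf hs w)
  have h1 := contDiffAt_chart_comp_map hf.self_of_nhds hs
  have hm := mem_chartDomain hs hp
  have h2 : ContDiffAt ℝ ∞ (θ.cov (f p)) (extChartAt 𝓘(ℝ, H) (f p) (f p)) := hθ.cov hm.1 hm.2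
  exact (h2.comp p h1).clm_apply ((h1.fderiv_right (m := ∞) (by simp)).clm_apply contDiffAt_const)

/-- The exterior differential along a map. -/
lemma PForm.SmoothOn.d_along {θ : PForm H N 1} {U : Set N} (hθ : θ.SmoothOn U)
    {f : V → N} {p : V} (hf : ∀ᶠ q in 𝓝 p, ContMDiffAt 𝓘(ℝ, V) 𝓘(ℝ, H) ∞ f q)
    (hp : f p ∈ U) (v w : V) :
    fderiv ℝ (θ.along f w) p v - fderiv ℝ (θ.along f v) p w =
      θ.d (f p) ![(mfderiv 𝓘(ℝ, V) 𝓘(ℝ, H) f p v : H), (mfderiv 𝓘(ℝ, V) 𝓘(ℝ, H) f p w : H)] := by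
  have hs := mem_extChartAt_source (I := 𝓘(ℝ, H)) (f p)
  have h1 := contDiffAt_chart_comp_map hf.self_of_nhds hs
  have hm := mem_chartDomain hs hp
  have h2 : ContDiffAt ℝ ∞ (θ.cov (f p)) (extChartAt 𝓘(ℝ, H) (f p) (f p)) := hθ.cov hm.1 hm.2
  set Z : V → H := fun q => extChartAt 𝓘(ℝ, H) (f p) (f q) with hZ
  have hd := hf.self_of_nhds.mdifferentiableAt (by simp)
  have hder : ∀ a b : V, fderiv ℝ (θ.along f b) p a =
      fderiv ℝ (θ.cov (f p)) (Z p) (fderiv ℝ Z p a) (fderiv ℝ Z p b) +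
        θ.cov (f p) (Z p) (fderiv ℝ (fderiv ℝ Z) p a b) := by
    intro a b
    rw [(θ.along_eventuallyEq (f p) hf hs b).fderiv_eq]
    have d1 : HasFDerivAt Z (fderiv ℝ Z p) p := (h1.differentiableAt (by simp)).hasFDerivAt
    have d2 : HasFDerivAt (θ.cov (f p)) (fderiv ℝ (θ.cov (f p)) (Z p)) (Z p) :=
      (h2.differentiableAt (by simp)).hasFDerivAt
    have d3 : HasFDerivAt (fderiv ℝ Z) (fderiv ℝ (fderiv ℝ Z) p) p :=
      ((h1.fderiv_right (m := ∞) (by simp)).differentiableAt (by simp)).hasFDerivAt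
    have d4 := (d2.comp p d1).clm_apply (d3.clm_apply (hasFDerivAt_const b p))
    have d5 := congrArg (fun A : V →L[ℝ] ℝ => A a) d4.fderiv
    refine d5.trans ?_
    simp [add_comm]
  -- The terms with the second derivative of the map cancel by symmetry: `d` commutes with
  -- pull-back.
  rw [hder, hder, fderiv_fderiv_comm h1 v w]
  have h3 := PForm.d_apply hθ hp hs (mfderiv 𝓘(ℝ, V) 𝓘(ℝ, H) f p v : H)
    (mfderiv 𝓘(ℝ, V) 𝓘(ℝ, H) f p w : H)
  have h4 := fderiv_chart_comp hd hs v
  have h5 := fderiv_chart_comp hd hs w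
  refine Eq.trans ?_ h3.symm
  rw [← h4, ← h5, covD_apply]
  ring

end Pullback

/-! ### Variational equivalence, and the vanishing of higher momenta. -/

section PoincareCartan

variable {n k : ℕ} {M : Type*} [TopologicalSpace M] [ChartedSpace (EuclideanSpace ℝ (Fin n)) M]
  [IsManifold (𝓡 n) ∞ M]

lemma HolonomicOn.apply_eq_zero {U : Set (Jet n M k)} {lam : JForm n k M 1}
    (h : HolonomicOn U lam) {u : Jet n M k} (hu : u ∈ U) {v : JetModel n k}
    (hv : v ∈ holonomicDist u) : lam u ![v] = 0 := by
  have h1 := h u hu v hv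
  exact congrArg (fun A : JetModel n k [⋀^Fin 0]→L[ℝ] ℝ => A ![]) h1

lemma HolonomicOn.apply_two_eq_zero {U : Set (Jet n M k)} {lam : JForm n k M 2}
    (h : HolonomicOn U lam) {u : Jet n M k} (hu : u ∈ U) {v : JetModel n k}
    (hv : v ∈ holonomicDist u) (w : JetModel n k) : lam u ![v, w] = 0 := by
  have h1 := h u hu v hv
  exact congrArg (fun A : JetModel n k [⋀^Fin 1]→L[ℝ] ℝ => A ![w]) h1

/-- For `1`-forms this removes the term `d μ` from variational equivalence, as a holonomic `0`-form
is zero on an open set. Equivalent `1`-forms thus differ by a holonomic form. -/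
lemma HolonomicOn.d_eq_zero {U : Set (Jet n M k)} (hU : IsOpen U) {mu : JForm n k M 0}
    (h : HolonomicOn U mu) {u : Jet n M k} (hu : u ∈ U) : mu.d u = 0 := by
  have hs := mem_extChartAt_source (I := 𝓘(ℝ, JetModel n k)) u
  have hev : mu.inChart u =ᶠ[𝓝 (extChartAt 𝓘(ℝ, JetModel n k) u u)] fun _ => 0 := by
    filter_upwards [(isOpen_chartDomain u hU).mem_nhds (mem_chartDomain hs hu)] with z hz
    ext v
    rw [PForm.inChart_apply, h _ hz.2]
    rfl
  have h2 : extDeriv (mu.inChart u) (extChartAt 𝓘(ℝ, JetModel n k) u u) = 0 := by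
    rw [extDeriv, hev.fderiv_eq]
    ext v
    simp [ContinuousAlternatingMap.alternatizeUncurryFin_apply]
  show (extDeriv (mu.inChart u) (extChartAt 𝓘(ℝ, JetModel n k) u u)).compContinuousLinearMap _ = 0
  rw [h2]
  rfl

/-- Variationally equivalent `1`-forms agree on the holonomic distribution. -/
lemma VarEquivOn.apply_eq {U : Set (Jet n M k)} (hU : IsOpen U) {θ θ' : JForm n k M 1}
    (h : VarEquivOn U θ θ') {u : Jet n M k} (hu : u ∈ U) {v : JetModel n k}
    (hv : v ∈ holonomicDist u) : θ u ![v] = θ' u ![v] := by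
  obtain ⟨lam, mu, -, -, hlam, hmu, h⟩ := h
  have h1 := h u hu
  rw [hmu.d_eq_zero hU hu, add_zero] at h1
  have h2 : (θ u - θ' u) ![v] = 0 := by
    rw [h1]
    exact hlam.apply_eq_zero hu hv
  exact sub_eq_zero.1 h2

lemma apply_pair_swap {H : Type*} [NormedAddCommGroup H] [NormedSpace ℝ H]
    (A : H [⋀^Fin 2]→L[ℝ] ℝ) (v w : H) : A ![v, w] = -A ![w, v] := by
  have h := A.toAlternatingMap.map_swap ![w, v] (i := 0) (j := 1) (by simp)
  have h2 : (![w, v] ∘ Equiv.swap (0 : Fin 2) 1) = ![v, w] := by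
    funext i
    fin_cases i <;> simp
  rw [h2] at h
  exact h

/-- The differential of a form of Poincaré-Cartan type vanishes on pairs of a holonomic vector and
a vertical vector. -/
lemma IsPoincareCartanOn.covD_vertical {U : Set (Jet n M k)} {α α₀ : JForm n k M 1}
    (h : IsPoincareCartanOn U α α₀) {u₁ : Jet n M k} {z : JetModel n k}
    (hz : z ∈ chartDomain u₁ U) {v w : JetModel n k} (hv : contactForm z v = 0) (hw1 : w.1 = 0)
    (hw2 : w.2 0 = 0) : covD (α₀.cov u₁) z w v = 0 := by
  obtain ⟨hα₀, -, σ, lam, -, -, hσ, hlam, hd⟩ := h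
  set e := extChartAt 𝓘(ℝ, JetModel n k) u₁ with he
  have hu : e.symm z ∈ e.source := e.map_target hz.1
  have hr : e (e.symm z) = z := e.right_inv hz.1
  have h1 := PForm.d_apply hα₀ hz.2 hu (chartDsymm u₁ z w) (chartDsymm u₁ z v)
  rw [chartD_chartDsymm hz.1, chartD_chartDsymm hz.1] at h1
  have h1' : α₀.d (e.symm z) ![chartDsymm u₁ z w, chartDsymm u₁ z v] =
    covD (α₀.cov u₁) (e (e.symm z)) w v := h1
  rw [hr] at h1'
  rw [← h1', hd _ hz.2]
  have h2 : lam (e.symm z) ![chartDsymm u₁ z w, chartDsymm u₁ z v] = 0 := by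
    rw [apply_pair_swap, hlam.apply_two_eq_zero hz.2, neg_zero]
    rw [mem_holonomicDist_iff u₁ hu, chartD_chartDsymm hz.1]
    show contactForm (e (e.symm z)) v = 0
    rw [hr, hv]
  have h3 : σ (e.symm z) ![chartDsymm u₁ z w, chartDsymm u₁ z v] = 0 := by
    have h4 := hσ _ hz.2 (chartDsymm u₁ z w) (mfderiv_base_eq_zero u₁ hu
      (by rw [chartD_chartDsymm hz.1, hw1]) (by rw [chartD_chartDsymm hz.1, hw2]))
    exact congrArg (fun A : JetModel n k [⋀^Fin 1]→L[ℝ] ℝ => A ![chartDsymm u₁ z v]) h4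
  show σ (e.symm z) _ + lam (e.symm z) _ = 0
  rw [h2, h3, add_zero]

/-- The expression of `α₀` and `α` agree on contact vectors. -/
lemma IsPoincareCartanOn.cov_eq {U : Set (Jet n M k)} (hU : IsOpen U) {α α₀ : JForm n k M 1}
    (h : IsPoincareCartanOn U α α₀) {u₁ : Jet n M k} {z : JetModel n k}
    (hz : z ∈ chartDomain u₁ U) {v : JetModel n k} (hv : contactForm z v = 0) :
    α₀.cov u₁ z v = α.cov u₁ z v := by
  rw [PForm.cov_apply, PForm.cov_apply]
  refine VarEquivOn.apply_eq hU h.2.1 hz.2 ?_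
  have hu := (extChartAt 𝓘(ℝ, JetModel n k) u₁).map_target hz.1
  rw [mem_holonomicDist_iff u₁ hu, chartD_chartDsymm hz.1,
    (extChartAt 𝓘(ℝ, JetModel n k) u₁).right_inv hz.1, hv]

lemma contDiff_totalVec : ContDiff ℝ ∞ (totalVec : JetModel n k → JetModel n k) := by
  refine contDiff_const.prodMk (contDiff_pi.2 fun a => ?_)
  split_ifs
  · fun_prop
  · exact contDiff_const

/-- The coordinate form of the bracket of `∂/∂y_(a+1)` with `d/dt`, which is `∂/∂y_(a)`. It is what
lowers the order in the induction on momenta. -/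
lemma fderiv_totalVec_single (z : JetModel n k) (a : Fin k) (y : EuclideanSpace ℝ (Fin n)) :
    fderiv ℝ (totalVec : JetModel n k → JetModel n k) z (0, Pi.single a.succ y) =
      (0, Pi.single a.castSucc y) := by
  have h1 : HasDerivAt (fun s : ℝ => z + s • ((0, Pi.single a.succ y) : JetModel n k))
      (0, Pi.single a.succ y) 0 := by
    simpa using ((hasDerivAt_id (0 : ℝ)).smul_const
      ((0, Pi.single a.succ y) : JetModel n k)).const_add z
  have h2 : HasFDerivAt (totalVec : JetModel n k → JetModel n k) (fderiv ℝ totalVec z)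
      (z + (0 : ℝ) • ((0, Pi.single a.succ y) : JetModel n k)) := by
    rw [zero_smul, add_zero]
    exact (contDiff_totalVec.differentiable (by simp) z).hasFDerivAt
  have h3 := h2.comp_hasDerivAt (0 : ℝ) h1
  refine h3.unique ?_
  have h4 : HasDerivAt (fun s : ℝ => totalVec z + s • ((0, Pi.single a.castSucc y) : JetModel n k))
      (0, Pi.single a.castSucc y) 0 := by
    simpa using ((hasDerivAt_id (0 : ℝ)).smul_const
      ((0, Pi.single a.castSucc y) : JetModel n k)).const_add (totalVec z)
  refine h4.congr_of_eventuallyEq (Eventually.of_forall fun s => ?_)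
  refine Prod.ext (by simp [totalVec]) (funext fun b => ?_)
  refine Fin.lastCases ?_ (fun c => ?_) b
  · have : a.castSucc ≠ Fin.last k := (Fin.castSucc_lt_last a).ne
    simp [totalVec_last, this.symm]
  · simp only [Function.comp_apply, totalVec_castSucc, Prod.snd_add, Prod.smul_snd, Pi.add_apply,
      Pi.smul_apply, Pi.single_apply, Fin.succ_inj, Fin.castSucc_inj]

/-- The higher momenta of a form of Poincaré-Cartan type vanish. -/
lemma IsPoincareCartanOn.cov_single_eq_zero {U : Set (Jet n M k)} (hU : IsOpen U)
    {α α₀ : JForm n k M 1} (h : IsPoincareCartanOn U α α₀) {r r' : ℕ} (hr : HasOrderOn U α r)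
    (hr' : r' + 1 ≤ k) (hα₀r : HasOrderOn U α₀ r') (u₁ : Jet n M k) (a : Fin (k + 1))
    (har : r < a) (y : EuclideanSpace ℝ (Fin n)) :
    ∀ z ∈ chartDomain u₁ U, α₀.cov u₁ z (0, Pi.single a y) = 0 := by
  induction a using Fin.reverseInduction with
  -- A form of order at most `k - 1` has no component along `y_(k)`.
  | last =>
    intro z hz
    obtain ⟨hk, β, hβ⟩ := hα₀r.exists_cov u₁
    rw [hβ z hz.1 hz.2]
    have : truncCLM hk ((0, Pi.single (Fin.last k) y) : JetModel n k) = 0 := by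
      refine Prod.ext rfl (funext fun b => ?_)
      show (Pi.single (Fin.last k) y : Fin (k + 1) → EuclideanSpace ℝ (Fin n)) _ = 0
      refine Pi.single_eq_of_ne ?_ _
      intro hb
      have := congrArg Fin.val hb
      simp at this
      omega
    rw [this, map_zero]
  -- The relation `d α₀(∂/∂y_(a+1), d/dt) = 0` is expanded. One of its two terms vanishes by the
  -- induction hypothesis, the other is minus the momentum of order `a`.
  | cast a ih =>
    have har' : r < (a.succ : ℕ) := by
      simp only [Fin.val_castSucc, Fin.val_succ] at har ⊢
      omega
    specialize ih har'
    intro z hz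
    obtain ⟨hk, β, hβ⟩ := hr.exists_cov u₁
    set T : JetModel n k → JetModel n k := totalVec with hT
    have hO : IsOpen (chartDomain (H := JetModel n k) u₁ U) := isOpen_chartDomain u₁ hU
    have hev : ∀ᶠ z' in 𝓝 z, z' ∈ chartDomain u₁ U := hO.mem_nhds hz
    have hϑ : ContDiffAt ℝ ∞ (α₀.cov u₁) z := h.1.cov hz.1 hz.2
    have dϑ : HasFDerivAt (α₀.cov u₁) (fderiv ℝ (α₀.cov u₁) z) z :=
      (hϑ.differentiableAt (by simp)).hasFDerivAt
    have dT : HasFDerivAt T (fderiv ℝ T z) z :=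
      (contDiff_totalVec.differentiable (by simp) z).hasFDerivAt
    -- On the holonomic vector `d/dt` the form `α₀` may be replaced by `α`. The resulting function
    -- does not depend on `y_(a+1)`, and the product rule gives the identity.
    have h1 : fderiv ℝ (α₀.cov u₁) z (0, Pi.single a.succ y) (T z) +
        α₀.cov u₁ z (0, Pi.single a.castSucc y) = 0 := by
      have hL := dϑ.clm_apply dT
      have hline : HasDerivAt (fun s : ℝ => z + s • ((0, Pi.single a.succ y) : JetModel n k))
          (0, Pi.single a.succ y) 0 := by
        simpa using ((hasDerivAt_id (0 : ℝ)).smul_const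
          ((0, Pi.single a.succ y) : JetModel n k)).const_add z
      have h2 := hL.comp_hasDerivAt_of_eq (0 : ℝ) hline (by simp)
      have h3 : HasDerivAt ((fun z => α₀.cov u₁ z (T z)) ∘
          fun s : ℝ => z + s • ((0, Pi.single a.succ y) : JetModel n k)) 0 0 := by
        refine (hasDerivAt_const (0 : ℝ) (α₀.cov u₁ z (T z))).congr_of_eventuallyEq ?_
        have hct : Tendsto (fun s : ℝ => z + s • ((0, Pi.single a.succ y) : JetModel n k))
            (𝓝 0) (𝓝 z) := by
          have := hline.continuousAt
          rw [ContinuousAt, zero_smul, add_zero] at this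
          exact this
        filter_upwards [hct.eventually hev] with s hs
        have hcT : ∀ z' : JetModel n k, contactForm z' (T z') = 0 := contactForm_totalVec
        rw [Function.comp_apply, h.cov_eq hU hs (hcT _), h.cov_eq hU hz (hcT _),
          hβ _ hs.1 hs.2, hβ _ hz.1 hz.2]
        have e1 : truncCLM hk (z + s • ((0, Pi.single a.succ y) : JetModel n k)) =
            truncCLM hk z := by
          refine Prod.ext (by simp [truncCLM]) (funext fun b => ?_)
          show z.2 _ + s • (Pi.single a.succ y : Fin (k + 1) → EuclideanSpace ℝ (Fin n)) _ = z.2 _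
          rw [Pi.single_eq_of_ne, smul_zero, add_zero]
          intro hb
          have := congrArg Fin.val hb
          simp only [Fin.val_castLE, Fin.val_succ] at this har'
          omega
        -- Truncated at order `r`, the vector `d/dt` involves coordinates of order at most `r + 1`.
        -- This is less than `a + 1` exactly because `r < a`.
        have e2 : truncCLM hk (T (z + s • ((0, Pi.single a.succ y) : JetModel n k))) =
            truncCLM hk (T z) := by
          refine Prod.ext rfl (funext fun b => ?_)
          show (T (z + s • ((0, Pi.single a.succ y) : JetModel n k))).2
            (Fin.castLE _ b) = (T z).2 (Fin.castLE _ b)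
          have hb2 := b.2
          have hb : ((Fin.castLE (Nat.succ_le_succ hk) b : Fin (k + 1)) : ℕ) = b := rfl
          simp only [hT, totalVec]
          split_ifs with hlt
          · show z.2 _ + s • (Pi.single a.succ y : Fin (k + 1) → EuclideanSpace ℝ (Fin n)) _ = z.2 _
            rw [Pi.single_eq_of_ne, smul_zero, add_zero]
            intro hb
            have := congrArg Fin.val hb
            simp only [Fin.val_castLE, Fin.val_succ, Fin.val_castSucc] at this har
            omega
          · rfl
        rw [e1, e2]
      have h4 := h2.unique h3
      simp only [add_apply, ContinuousLinearMap.comp_apply,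
        ContinuousLinearMap.flip_apply] at h4
      rw [fderiv_totalVec_single] at h4
      rw [add_comm]
      exact h4
    -- A direction of order `a + 1 ≥ 1` is vertical over `E`.
    have h5 : covD (α₀.cov u₁) z (0, Pi.single a.succ y) (T z) = 0 := by
      refine h.covD_vertical hz (contactForm_totalVec z) rfl ?_
      exact Pi.single_eq_of_ne (Fin.succ_ne_zero a).symm y
    -- The momentum of order `a + 1` vanishes on a whole neighbourhood, hence so does its derivative
    -- along `d/dt`.
    have h6 : fderiv ℝ (α₀.cov u₁) z (T z) (0, Pi.single a.succ y) = 0 := by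
      have h7 : fderiv ℝ (fun z => α₀.cov u₁ z ((0, Pi.single a.succ y) : JetModel n k)) z (T z) =
          0 := by
        have : (fun z => α₀.cov u₁ z ((0, Pi.single a.succ y) : JetModel n k)) =ᶠ[𝓝 z]
            fun _ => 0 := by
          filter_upwards [hev] with z' hz'
          exact ih z' hz'
        rw [this.fderiv_eq]
        simp
      have h8 := (dϑ.clm_apply
        (hasFDerivAt_const ((0, Pi.single a.succ y) : JetModel n k) z)).fderiv
      rw [h8] at h7
      simpa using h7
    rw [covD_apply, h6, sub_zero] at h5
    rw [h5, zero_add] at h1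
    exact h1

end PoincareCartan

/-! ### Locality of lifts and their behaviour under projections. -/

section JetLift

variable {n : ℕ} {M : Type*} [TopologicalSpace M] [ChartedSpace (EuclideanSpace ℝ (Fin n)) M]

/-- Smoothness at `t` depends only on the germ of the curve, and the junk value only on its value at
`t`. -/
lemma jetLift_congr {k : ℕ} {γ γ' : ℝ → M} {t : ℝ} (h : γ =ᶠ[𝓝 t] γ') :
    jetLift n k γ t = jetLift n k γ' t := by
  by_cases hγ : ContMDiffAt 𝓘(ℝ, ℝ) (𝓡 n) ∞ γ t
  · have hγ' : ContMDiffAt 𝓘(ℝ, ℝ) (𝓡 n) ∞ γ' t := hγ.congr_of_eventuallyEq h.symm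
    rw [jetLift_eq hγ, jetLift_eq hγ']
    exact Quotient.sound ⟨rfl, h.eq_of_nhds, fun φ _ _ a _ =>
      (h.fun_comp φ).iteratedDeriv_eq a⟩
  · have hγ' : ¬ContMDiffAt 𝓘(ℝ, ℝ) (𝓡 n) ∞ γ' t := fun h' => hγ (h'.congr_of_eventuallyEq h)
    rw [jetLift, jetLift, dif_neg hγ, dif_neg hγ']
    congr 3
    simp only [h.eq_of_nhds]

lemma proj_jetLift {k r : ℕ} (hr : r ≤ k) (γ : ℝ → M) (t : ℝ) :
    Jet.proj hr (jetLift n k γ t) = jetLift n r γ t := by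
  unfold jetLift
  split_ifs <;> rfl

end JetLift

/-! ### The first variation formula and the sufficiency of criticality. -/

section FirstVariation

variable {n k : ℕ} {M : Type*} [TopologicalSpace M] [ChartedSpace (EuclideanSpace ℝ (Fin n)) M]
  [IsManifold (𝓡 n) ∞ M]

lemma jetVelocity_congr {γ γ' : ℝ → M} {t : ℝ} (h : γ =ᶠ[𝓝 t] γ') :
    jetVelocity n k γ t = jetVelocity n k γ' t := by
  have h2 : jetLift n k γ =ᶠ[𝓝 t] jetLift n k γ' := by
    filter_upwards [h.eventuallyEq_nhds] with s hs
    exact jetLift_congr hs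
  have h3 := h2.mfderiv_eq (I := 𝓘(ℝ, ℝ)) (I' := 𝓘(ℝ, JetModel n k))
  exact congrArg (fun A : ℝ →L[ℝ] JetModel n k => A 1) h3

lemma eventually_contMDiffAt_jetLiftFamily {F : ℝ × ℝ → M} {O : Set (ℝ × ℝ)}
    (hO : IsOpen O) (hF : ContMDiffOn 𝓘(ℝ, ℝ × ℝ) (𝓡 n) ∞ F O) {p : ℝ × ℝ} (hp : p ∈ O) :
    ∀ᶠ q in 𝓝 p, ContMDiffAt 𝓘(ℝ, ℝ × ℝ) 𝓘(ℝ, JetModel n k) ∞ (jetLiftFamily n k F) q := by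
  filter_upwards [hO.mem_nhds hp] with q hq
  exact contMDiffAt_jetLiftFamily hO hF hq

lemma jetVelocity_family {F : ℝ × ℝ → M} {O : Set (ℝ × ℝ)}
    (hO : IsOpen O) (hF : ContMDiffOn 𝓘(ℝ, ℝ × ℝ) (𝓡 n) ∞ F O) {p : ℝ × ℝ} (hp : p ∈ O) :
    jetVelocity n k (fun τ => F (τ, p.2)) p.1 =
      mfderiv 𝓘(ℝ, ℝ × ℝ) 𝓘(ℝ, JetModel n k) (jetLiftFamily n k F) p ((1, 0) : ℝ × ℝ) := by
  have h1 : MDifferentiableAt 𝓘(ℝ, ℝ × ℝ) 𝓘(ℝ, JetModel n k) (jetLiftFamily n k F)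
      ((fun τ => (τ, p.2)) p.1) :=
    (contMDiffAt_jetLiftFamily hO hF hp).mdifferentiableAt (by simp)
  have h2 : HasFDerivAt (fun τ : ℝ => (τ, p.2))
      ((ContinuousLinearMap.id ℝ ℝ).prod (0 : ℝ →L[ℝ] ℝ)) p.1 :=
    (hasFDerivAt_id p.1).prodMk (hasFDerivAt_const p.2 p.1)
  have h3 := (HasMFDerivAt.comp p.1 h1.hasMFDerivAt
    (hasMFDerivAt_iff_hasFDerivAt.2 h2)).mfderiv
  have h4 := congrArg (fun A : ℝ →L[ℝ] JetModel n k => A 1) h3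
  exact h4

/-- A criticality condition: the contraction of `dα₀` with the velocity vanishes. -/
def IsCritical (α₀ : JForm n k M 1) (γ : ℝ → M) (t : ℝ) : Prop :=
  ∀ w : JetModel n k, α₀.d (jetLift n k γ t) ![w, jetVelocity n k γ t] = 0

lemma jetVelocity_mem_holonomicDist {γ : ℝ → M} {t : ℝ} (h : SmoothCurveNear n γ t) :
    jetVelocity n k γ t ∈ holonomicDist (jetLift n k γ t) :=
  Submodule.subset_span ⟨γ, t, h, rfl, rfl⟩

lemma smoothCurveNear_family {F : ℝ × ℝ → M} {O : Set (ℝ × ℝ)}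
    (hO : IsOpen O) (hF : ContMDiffOn 𝓘(ℝ, ℝ × ℝ) (𝓡 n) ∞ F O) {p : ℝ × ℝ} (hp : p ∈ O) :
    SmoothCurveNear n (fun τ => F (τ, p.2)) p.1 := by
  have h : Tendsto (fun τ : ℝ => (τ, p.2)) (𝓝 p.1) (𝓝 p) :=
    (continuous_id.prodMk continuous_const).continuousAt
  filter_upwards [h.eventually (hO.mem_nhds hp)] with s hs
  exact contMDiffAt_of_family hO hF (p := (s, p.2)) hs

/-- The first variation formula. -/
lemma hasDerivAt_action {W : Set (Jet n M k)} (hW : IsOpen W) {α α₀ : JForm n k M 1}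
    (hPC : IsPoincareCartanOn W α α₀) {a b ε : ℝ} (hab : a < b) (hε : 0 < ε)
    {F : ℝ × ℝ → M} {O : Set (ℝ × ℝ)} (hO : IsOpen O) (hRO : Icc a b ×ˢ Icc (-ε) ε ⊆ O)
    (hF : ContMDiffOn 𝓘(ℝ, ℝ × ℝ) (𝓡 n) ∞ F O)
    (hFW : ∀ s ∈ Icc (-ε) ε, ∀ t ∈ Icc a b, jetLift n k (fun τ => F (τ, s)) t ∈ W) :
    HasDerivAt (fun s => action α (fun τ => F (τ, s)) a b)
      (α₀.along (jetLiftFamily n k F) ((0, 1) : ℝ × ℝ) (b, 0) -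
        α₀.along (jetLiftFamily n k F) ((0, 1) : ℝ × ℝ) (a, 0) +
      ∫ t in a..b, α₀.d (jetLiftFamily n k F (t, 0))
        ![(mfderiv 𝓘(ℝ, ℝ × ℝ) 𝓘(ℝ, JetModel n k) (jetLiftFamily n k F) (t, 0)
            ((0, 1) : ℝ × ℝ) : JetModel n k),
          (mfderiv 𝓘(ℝ, ℝ × ℝ) 𝓘(ℝ, JetModel n k) (jetLiftFamily n k F) (t, 0)
            ((1, 0) : ℝ × ℝ) : JetModel n k)]) 0 := by
  set L := jetLiftFamily n k F with hL
  set G := α₀.along L ((1, 0) : ℝ × ℝ) with hG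
  set B := α₀.along L ((0, 1) : ℝ × ℝ) with hB
  have hLe : ∀ p ∈ Icc a b ×ˢ Icc (-ε) ε,
      ∀ᶠ q in 𝓝 p, ContMDiffAt 𝓘(ℝ, ℝ × ℝ) 𝓘(ℝ, JetModel n k) ∞ L q :=
    fun p hp => eventually_contMDiffAt_jetLiftFamily hO hF (hRO hp)
  have hLW : ∀ p ∈ Icc a b ×ˢ Icc (-ε) ε, L p ∈ W := fun p hp => hFW p.2 hp.2 p.1 hp.1
  have hGs : ∀ p ∈ Icc a b ×ˢ Icc (-ε) ε, ContDiffAt ℝ ∞ G p :=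
    fun p hp => hPC.1.contDiffAt_along (hLe p hp) (hLW p hp) _
  have hBs : ∀ p ∈ Icc a b ×ˢ Icc (-ε) ε, ContDiffAt ℝ ∞ B p :=
    fun p hp => hPC.1.contDiffAt_along (hLe p hp) (hLW p hp) _
  have h0 : (0 : ℝ) ∈ Icc (-ε) ε := ⟨by linarith, hε.le⟩
  have hline : ∀ s t : ℝ, HasDerivAt (fun τ : ℝ => (τ, s)) ((1, 0) : ℝ × ℝ) t := fun s t =>
    (hasDerivAt_id t).prodMk (hasDerivAt_const t s)
  have hline' : ∀ t s : ℝ, HasDerivAt (fun σ : ℝ => (t, σ)) ((0, 1) : ℝ × ℝ) s := fun t s =>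
    (hasDerivAt_const s t).prodMk (hasDerivAt_id s)
  -- Velocities of lifts are holonomic, so `α` may be replaced by `α₀` in the action.
  have hact : (fun s => action α (fun τ => F (τ, s)) a b) =ᶠ[𝓝 0]
      fun s => ∫ t in a..b, G (t, s) := by
    filter_upwards [Icc_mem_nhds (by linarith : -ε < 0) hε] with s hs
    refine intervalIntegral.integral_congr fun t ht => ?_
    rw [uIcc_of_le hab.le] at ht
    have hp : (t, s) ∈ Icc a b ×ˢ Icc (-ε) ε := ⟨ht, hs⟩
    have h1 := hPC.2.1.apply_eq hW (hLW _ hp)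
      (jetVelocity_mem_holonomicDist (smoothCurveNear_family hO hF (hRO hp)))
    refine h1.symm.trans ?_
    rw [jetVelocity_family hO hF (hRO hp)]
    rfl
  refine HasDerivAt.congr_of_eventuallyEq ?_ hact
  have hcG : ContinuousOn (fun p => fderiv ℝ G p ((0, 1) : ℝ × ℝ)) (Icc a b ×ˢ Icc (-ε) ε) :=
    fun p hp => ((((hGs p hp).fderiv_right (m := ∞) (by simp)).clm_apply
      contDiffAt_const).continuousAt).continuousWithinAt
  have hcB : ContinuousOn (fun p => fderiv ℝ B p ((1, 0) : ℝ × ℝ)) (Icc a b ×ˢ Icc (-ε) ε) :=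
    fun p hp => ((((hBs p hp).fderiv_right (m := ∞) (by simp)).clm_apply
      contDiffAt_const).continuousAt).continuousWithinAt
  have hslice : ∀ s ∈ Icc (-ε) ε, MapsTo (fun t : ℝ => (t, s)) (Icc a b)
      (Icc a b ×ˢ Icc (-ε) ε) := fun s hs t ht => ⟨ht, hs⟩
  have hsc : ∀ s : ℝ, ContinuousOn (fun t : ℝ => (t, s)) (Icc a b) := fun s =>
    (continuous_id.prodMk continuous_const).continuousOn
  have hint1 : IntervalIntegrable (fun t => fderiv ℝ G (t, 0) ((0, 1) : ℝ × ℝ))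
      MeasureTheory.volume a b :=
    ContinuousOn.intervalIntegrable_of_Icc hab.le (hcG.comp (hsc 0) (hslice 0 h0))
  have hint2 : IntervalIntegrable (fun t => fderiv ℝ B (t, 0) ((1, 0) : ℝ × ℝ))
      MeasureTheory.volume a b :=
    ContinuousOn.intervalIntegrable_of_Icc hab.le (hcB.comp (hsc 0) (hslice 0 h0))
  -- By the differential along the family, `∂G/∂s - ∂B/∂t` is `d α₀` on the two partial velocities.
  -- The integral of `∂B/∂t` gives the boundary terms.
  have hval : ∫ t in a..b, fderiv ℝ G (t, 0) ((0, 1) : ℝ × ℝ) = B (b, 0) - B (a, 0) +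
      ∫ t in a..b, α₀.d (L (t, 0))
        ![(mfderiv 𝓘(ℝ, ℝ × ℝ) 𝓘(ℝ, JetModel n k) L (t, 0) ((0, 1) : ℝ × ℝ) : JetModel n k),
          (mfderiv 𝓘(ℝ, ℝ × ℝ) 𝓘(ℝ, JetModel n k) L (t, 0) ((1, 0) : ℝ × ℝ) : JetModel n k)] := by
    have e1 : ∫ t in a..b, fderiv ℝ B (t, 0) ((1, 0) : ℝ × ℝ) = B (b, 0) - B (a, 0) := by
      refine intervalIntegral.integral_eq_sub_of_hasDerivAt (f := fun t => B (t, 0))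
        (fun t ht => ?_) hint2
      rw [uIcc_of_le hab.le] at ht
      exact (((hBs (t, 0) ⟨ht, h0⟩).differentiableAt (by simp)).hasFDerivAt).comp_hasDerivAt
        t (hline 0 t)
    rw [← e1, ← sub_eq_iff_eq_add', ← intervalIntegral.integral_sub hint1 hint2]
    refine intervalIntegral.integral_congr fun t ht => ?_
    rw [uIcc_of_le hab.le] at ht
    exact hPC.1.d_along (hLe (t, 0) ⟨ht, h0⟩) (hLW (t, 0) ⟨ht, h0⟩) _ _
  rw [← hval]
  -- A bound on the compact rectangle justifies differentiation under the integral sign.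
  obtain ⟨C, hC⟩ := (isCompact_Icc.prod isCompact_Icc).exists_bound_of_continuousOn hcG
  have hI : uIoc a b ⊆ Icc a b := by
    rw [uIoc_of_le hab.le]
    exact Ioc_subset_Icc_self
  refine (intervalIntegral.hasDerivAt_integral_of_dominated_loc_of_deriv_le
    (F := fun s t => G (t, s)) (F' := fun s t => fderiv ℝ G (t, s) ((0, 1) : ℝ × ℝ))
    (bound := fun _ => C) (Icc_mem_nhds (by linarith : -ε < 0) hε) ?_ ?_ ?_ ?_ ?_ ?_).2
  · filter_upwards [Icc_mem_nhds (by linarith : -ε < 0) hε] with s hs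
    have : ContinuousOn (fun t => G (t, s)) (Icc a b) := fun t ht =>
      ((hGs (t, s) ⟨ht, hs⟩).continuousAt.comp_of_eq (f := fun t : ℝ => (t, s))
        (by fun_prop) rfl).continuousWithinAt
    exact (this.mono hI).aestronglyMeasurable measurableSet_uIoc
  · refine ContinuousOn.intervalIntegrable_of_Icc hab.le fun t ht => ?_
    exact ((hGs (t, 0) ⟨ht, h0⟩).continuousAt.comp_of_eq (f := fun t : ℝ => (t, (0 : ℝ)))
        (by fun_prop) rfl).continuousWithinAt
  · exact ((hcG.comp (hsc 0) (hslice 0 h0)).mono hI).aestronglyMeasurable measurableSet_uIoc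
  · exact Eventually.of_forall fun t ht s hs => hC (t, s) ⟨hI ht, hs⟩
  · exact intervalIntegrable_const
  · refine Eventually.of_forall fun t ht s hs => ?_
    exact (((hGs (t, s) ⟨hI ht, hs⟩).differentiableAt (by simp)).hasFDerivAt).comp_hasDerivAt
        s (hline' t s)

/-- The boundary terms of the first variation vanish. -/
lemma along_boundary_eq_zero {W : Set (Jet n M k)} (hW : IsOpen W) {α α₀ : JForm n k M 1}
    (hPC : IsPoincareCartanOn W α α₀) {r r' : ℕ} (hr : HasOrderOn W α r)
    (hr' : r' + 1 ≤ k) (hα₀r : HasOrderOn W α₀ r') {F : ℝ × ℝ → M} {O : Set (ℝ × ℝ)}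
    (hO : IsOpen O) (hF : ContMDiffOn 𝓘(ℝ, ℝ × ℝ) (𝓡 n) ∞ F O) {t : ℝ} (ht : (t, (0 : ℝ)) ∈ O)
    (hFW : jetLiftFamily n k F (t, 0) ∈ W) (v : Jet n M r)
    (hv : ∀ᶠ s in 𝓝 (0 : ℝ), jetLift n r (fun τ => F (τ, s)) t = v) :
    α₀.along (jetLiftFamily n k F) ((0, 1) : ℝ × ℝ) (t, 0) = 0 := by
  set L := jetLiftFamily n k F with hL
  set u₁ := L (t, 0) with hu₁
  have hs := mem_extChartAt_source (I := 𝓘(ℝ, JetModel n k)) u₁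
  have hLs : ContMDiffAt 𝓘(ℝ, ℝ × ℝ) 𝓘(ℝ, JetModel n k) ∞ L (t, 0) :=
    contMDiffAt_jetLiftFamily hO hF ht
  rw [α₀.along_eq (hLs.mdifferentiableAt (by simp)) hs]
  set Z : ℝ × ℝ → JetModel n k := fun q => extChartAt 𝓘(ℝ, JetModel n k) u₁ (L q) with hZ
  have hZs : ContDiffAt ℝ ∞ Z (t, 0) := contDiffAt_chart_comp_map hLs hs
  obtain ⟨V, hV⟩ : ∃ V, V = fderiv ℝ Z (t, 0) ((0, 1) : ℝ × ℝ) := ⟨_, rfl⟩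
  have hk : r ≤ k := hr.1
  have h1 : HasDerivAt (fun s => Z (t, s)) V 0 := by
    rw [hV]
    exact ((hZs.differentiableAt (by simp)).hasFDerivAt).comp_hasDerivAt (0 : ℝ)
      ((hasDerivAt_const (0 : ℝ) t).prodMk (hasDerivAt_id (0 : ℝ)))
  have h2 : HasDerivAt (fun s => truncCLM hk (Z (t, s))) (truncCLM hk V) 0 :=
    (truncCLM hk).hasFDerivAt.comp_hasDerivAt (0 : ℝ) h1
  -- The `r`-jet at the endpoint does not move, so the variation vector has only components of order
  -- greater than `r`.
  have h3 : truncCLM hk V = 0 := by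
    refine h2.unique ((hasDerivAt_const (0 : ℝ)
      (extChartAt 𝓘(ℝ, JetModel n r) (Jet.proj hk u₁) v)).congr_of_eventuallyEq ?_)
    filter_upwards [hv] with s hs'
    rw [← jetChartAt_proj hk, hL, jetLiftFamily, proj_jetLift]
    exact congrArg _ hs'
  have hV1 : V.1 = 0 := congrArg Prod.fst h3
  have hVa : ∀ a : Fin (k + 1), (a : ℕ) ≤ r → V.2 a = 0 := fun a ha => by
    have := congrFun (congrArg Prod.snd h3) ⟨a, Nat.lt_succ_of_le ha⟩
    exact this
  have hdec : V = ∑ a : Fin (k + 1), ((0, Pi.single a (V.2 a)) : JetModel n k) := by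
    refine Prod.ext ?_ ?_
    · rw [hV1, Prod.fst_sum]
      simp
    · rw [Prod.snd_sum]
      exact (Finset.univ_sum_single V.2).symm
  rw [← hV, hdec, map_sum]
  -- Components of order at most `r` are zero, and on the remaining ones the momenta of `α₀` vanish.
  refine Finset.sum_eq_zero fun a _ => ?_
  by_cases ha : (a : ℕ) ≤ r
  · rw [hVa a ha, Pi.single_zero]
    exact map_zero _
  · exact hPC.cov_single_eq_zero hW hr hr' hα₀r u₁ a (not_le.1 ha) _ _ (mem_chartDomain hs hFW)

/-- Critical curves are solutions. -/
lemma isSolution_of_isCritical {W : Set (Jet n M k)} (hW : IsOpen W) {α α₀ : JForm n k M 1}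
    (hPC : IsPoincareCartanOn W α α₀) {r r' : ℕ} (hr : HasOrderOn W α r)
    (hr' : r' + 1 ≤ k) (hα₀r : HasOrderOn W α₀ r') {I : Set ℝ} {γ : ℝ → M} (hI : IsOpen I)
    (hIc : I.OrdConnected) (hγ : ContMDiffOn 𝓘(ℝ, ℝ) (𝓡 n) ∞ γ I)
    (hγW : ∀ t ∈ I, jetLift n k γ t ∈ W) (hcrit : ∀ t ∈ I, IsCritical α₀ γ t) :
    IsSolution W α r I γ := by
  refine ⟨hI, hIc, hγ, hγW, fun a b hab habI ε hε F hF => ?_⟩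
  obtain ⟨⟨O, hO, hRO, hFs⟩, hF0, hFW, hFb⟩ := hF
  have h := hasDerivAt_action hW hPC hab hε hO hRO hFs hFW
  have h0 : (0 : ℝ) ∈ Icc (-ε) ε := ⟨by linarith, hε.le⟩
  have hnh : Icc (-ε) ε ∈ 𝓝 (0 : ℝ) := Icc_mem_nhds (by linarith) hε
  have ha : a ∈ Icc a b := left_mem_Icc.2 hab.le
  have hb : b ∈ Icc a b := right_mem_Icc.2 hab.le
  rw [along_boundary_eq_zero hW hPC hr hr' hα₀r hO hFs (hRO ⟨ha, h0⟩) (hFW 0 h0 a ha)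
      (jetLift n r γ a) (by filter_upwards [hnh] with s hs using (hFb s hs).1),
    along_boundary_eq_zero hW hPC hr hr' hα₀r hO hFs (hRO ⟨hb, h0⟩) (hFW 0 h0 b hb)
      (jetLift n r γ b) (by filter_upwards [hnh] with s hs using (hFb s hs).2), sub_zero,
    zero_add] at h
  convert h using 1
  refine (intervalIntegral.integral_zero_ae ?_).symm
  -- The variation at parameter `0` is known to equal `γ` only on `[a, b]`. Equality of germs,
  -- needed for jets and velocities, is available at interior points, so `b` is discarded as a null
  -- set.
  have hne : ∀ᵐ t ∂(MeasureTheory.volume : MeasureTheory.Measure ℝ), t ≠ b := by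
    rw [MeasureTheory.ae_iff]
    simp
  filter_upwards [hne] with t htb ht
  rw [uIoc_of_le hab.le] at ht
  have htI : t ∈ Ioo a b := ⟨ht.1, lt_of_le_of_ne ht.2 htb⟩
  have hev : (fun τ => F (τ, 0)) =ᶠ[𝓝 t] γ := by
    filter_upwards [Ioo_mem_nhds htI.1 htI.2] with s hs
    exact hF0 s ⟨hs.1.le, hs.2.le⟩
  have hp : (t, (0 : ℝ)) ∈ O := hRO ⟨⟨htI.1.le, htI.2.le⟩, h0⟩
  have h1 := jetVelocity_family (k := k) hO hFs hp
  have h2 : jetLiftFamily n k F (t, 0) = jetLift n k γ t := jetLift_congr hev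
  rw [← h1, h2]
  have h3 : jetVelocity n k (fun τ => F (τ, (t, (0 : ℝ)).2)) (t, (0 : ℝ)).1 =
    jetVelocity n k γ t := jetVelocity_congr hev
  rw [h3]
  exact hcrit t (habI ⟨htI.1.le, htI.2.le⟩) _

end FirstVariation

/-! ### Solutions satisfy the Euler-Lagrange equations. -/

section EulerLagrange

variable {n k : ℕ} {M : Type*} [TopologicalSpace M] [ChartedSpace (EuclideanSpace ℝ (Fin n)) M]
  [IsManifold (𝓡 n) ∞ M]

/-- A vector without time component differs from its part of order `0` by a vector vertical over
`E`, on which `IsPoincareCartanOn.covD_vertical` applies. -/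
lemma IsPoincareCartanOn.covD_eq_base {U : Set (Jet n M k)} {α α₀ : JForm n k M 1}
    (h : IsPoincareCartanOn U α α₀) {u₁ : Jet n M k} {z : JetModel n k}
    (hz : z ∈ chartDomain u₁ U) {v w : JetModel n k} (hv : contactForm z v = 0) (hw1 : w.1 = 0) :
    covD (α₀.cov u₁) z w v = covD (α₀.cov u₁) z (0, Pi.single 0 (w.2 0)) v := by
  have h1 := h.covD_vertical (w := w - (0, Pi.single 0 (w.2 0))) hz hv (by simp [hw1]) (by simp)
  rw [map_sub] at h1
  exact sub_eq_zero.1 h1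

/-- The Euler-Lagrange expressions of a curve, in the adapted coordinates around `u₁`. -/
def eulerExpr (α₀ : JForm n k M 1) (u₁ : Jet n M k) (γ : ℝ → M) (y : EuclideanSpace ℝ (Fin n))
    (t : ℝ) : ℝ :=
  covD (α₀.cov u₁) (extChartAt 𝓘(ℝ, JetModel n k) u₁ (jetLift n k γ t)) (0, Pi.single 0 y)
    (deriv (fun s => extChartAt 𝓘(ℝ, JetModel n k) u₁ (jetLift n k γ s)) t)

lemma deriv_coord_jetLift (u₁ : Jet n M k) {γ : ℝ → M} {t : ℝ} (h : SmoothCurveNear n γ t)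
    (hs : γ t ∈ (chartAt (EuclideanSpace ℝ (Fin n)) u₁.point).source) :
    deriv (fun s => extChartAt 𝓘(ℝ, JetModel n k) u₁ (jetLift n k γ s)) t =
      chartD u₁ (jetLift n k γ t) (jetVelocity n k γ t) :=
  (hasDerivAt_coord_jetLift u₁ h hs).deriv

lemma continuousAt_covD_deriv {H : Type*} [NormedAddCommGroup H] [NormedSpace ℝ H]
    {ϑ : H → H →L[ℝ] ℝ} {c : ℝ → H} {t : ℝ} (hϑ : ContDiffAt ℝ ∞ ϑ (c t))
    (hc : ContDiffAt ℝ ∞ c t) (w : H) : ContinuousAt (fun s => covD ϑ (c s) w (deriv c s)) t := by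
  have h3 : ContinuousAt (deriv c) t :=
    ((hc.fderiv_right (m := ∞) (by simp)).clm_apply (contDiffAt_const (c := (1 : ℝ)))).continuousAt
  have h4 : ContinuousAt (fun s => covD ϑ (c s)) t :=
    (contDiffAt_covD hϑ).continuousAt.comp hc.continuousAt
  exact (h4.clm_apply continuousAt_const).clm_apply h3

/-- Continuity upgrades the almost-everywhere vanishing given by the fundamental lemma of the
calculus of variations to vanishing at every time. -/
lemma continuousOn_eulerExpr {W : Set (Jet n M k)} {α₀ : JForm n k M 1} (hα₀ : α₀.SmoothOn W)
    (u₁ : Jet n M k) {γ : ℝ → M} {J : Set ℝ}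
    (hγ : ∀ t ∈ J, SmoothCurveNear n γ t) (hγW : ∀ t ∈ J, jetLift n k γ t ∈ W)
    (hs : ∀ t ∈ J, γ t ∈ (chartAt (EuclideanSpace ℝ (Fin n)) u₁.point).source)
    (y : EuclideanSpace ℝ (Fin n)) : ContinuousOn (eulerExpr α₀ u₁ γ y) J := by
  intro t ht
  have hsrc := (jetLift_mem_source (k := k) u₁).2 (hs t ht)
  have hm := mem_chartDomain hsrc (hγW t ht)
  have h1 : ContDiffAt ℝ ∞ (fun s => extChartAt 𝓘(ℝ, JetModel n k) u₁ (jetLift n k γ s)) t :=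
    contDiffAt_chart_comp_map (contMDiffAt_jetLift (hγ t ht)) hsrc
  have h2 : ContDiffAt ℝ ∞ (α₀.cov u₁) (extChartAt 𝓘(ℝ, JetModel n k) u₁ (jetLift n k γ t)) :=
    hα₀.cov hm.1 hm.2
  have h3 := continuousAt_covD_deriv (ϑ := α₀.cov u₁)
    (c := fun s => extChartAt 𝓘(ℝ, JetModel n k) u₁ (jetLift n k γ s)) h2 h1
    ((0, Pi.single 0 y) : JetModel n k)
  unfold eulerExpr
  exact h3.continuousWithinAt

lemma eulerExpr_smul (α₀ : JForm n k M 1) (u₁ : Jet n M k) (γ : ℝ → M) (c : ℝ)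
    (y : EuclideanSpace ℝ (Fin n)) (t : ℝ) :
    eulerExpr α₀ u₁ γ (c • y) t = c • eulerExpr α₀ u₁ γ y t := by
  have h4 : ((0, Pi.single 0 (c • y)) : JetModel n k) = c • (0, Pi.single 0 y) := by
    refine Prod.ext (by simp) ?_
    show _ = c • (Pi.single 0 y : Fin (k + 1) → EuclideanSpace ℝ (Fin n))
    rw [Pi.single_smul]
  rw [eulerExpr, h4, map_smul]
  rfl

/-- The differential of `α₀` on the velocities of a family of lifts. -/
lemma IsPoincareCartanOn.d_family_eq {W : Set (Jet n M k)} {α α₀ : JForm n k M 1}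
    (hPC : IsPoincareCartanOn W α α₀) (u₁ : Jet n M k) {F : ℝ × ℝ → M} {O : Set (ℝ × ℝ)}
    (hO : IsOpen O) (hF : ContMDiffOn 𝓘(ℝ, ℝ × ℝ) (𝓡 n) ∞ F O) {t : ℝ} (hpO : (t, (0 : ℝ)) ∈ O)
    (hLW : jetLiftFamily n k F (t, 0) ∈ W)
    (hFsrc : F (t, 0) ∈ (chartAt (EuclideanSpace ℝ (Fin n)) u₁.point).source)
    {γ : ℝ → M} (hγ : (fun τ => F (τ, 0)) =ᶠ[𝓝 t] γ) {η : EuclideanSpace ℝ (Fin n)}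
    (hη : HasDerivAt (fun s => chartAt (EuclideanSpace ℝ (Fin n)) u₁.point (F (t, s))) η 0) :
    α₀.d (jetLiftFamily n k F (t, 0))
      ![(mfderiv 𝓘(ℝ, ℝ × ℝ) 𝓘(ℝ, JetModel n k) (jetLiftFamily n k F) (t, 0)
          ((0, 1) : ℝ × ℝ) : JetModel n k),
        (mfderiv 𝓘(ℝ, ℝ × ℝ) 𝓘(ℝ, JetModel n k) (jetLiftFamily n k F) (t, 0)
          ((1, 0) : ℝ × ℝ) : JetModel n k)] = eulerExpr α₀ u₁ γ η t := by
  set L := jetLiftFamily n k F with hL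
  have hLs : ContMDiffAt 𝓘(ℝ, ℝ × ℝ) 𝓘(ℝ, JetModel n k) ∞ L (t, 0) :=
    contMDiffAt_jetLiftFamily hO hF hpO
  have hLm := hLs.mdifferentiableAt (by simp : (∞ : WithTop ℕ∞) ≠ 0)
  have hL0 : (fun τ => L (τ, 0)) =ᶠ[𝓝 t] jetLift n k γ := by
    filter_upwards [hγ.eventuallyEq_nhds] with s hs
    exact jetLift_congr hs
  have hsrc : L (t, 0) ∈ (extChartAt 𝓘(ℝ, JetModel n k) u₁).source :=
    (jetLift_mem_source u₁).2 hFsrc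
  have hm := mem_chartDomain hsrc hLW
  have hcoord := (eventually_coord_jetLiftFamily (k := k) u₁ hO hF hpO hFsrc).2
  have e1 := PForm.d_apply hPC.1 hLW hsrc
    (mfderiv 𝓘(ℝ, ℝ × ℝ) 𝓘(ℝ, JetModel n k) L (t, 0) ((0, 1) : ℝ × ℝ) : JetModel n k)
    (mfderiv 𝓘(ℝ, ℝ × ℝ) 𝓘(ℝ, JetModel n k) L (t, 0) ((1, 0) : ℝ × ℝ) : JetModel n k)
  have e2 := fderiv_chart_comp hLm hsrc ((0, 1) : ℝ × ℝ)
  have e3 := fderiv_chart_comp hLm hsrc ((1, 0) : ℝ × ℝ)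
  rw [← e2, ← e3] at e1
  refine e1.trans ?_
  obtain ⟨Z, hZ⟩ : ∃ Z : ℝ × ℝ → JetModel n k,
      Z = fun q => extChartAt 𝓘(ℝ, JetModel n k) u₁ (L q) := ⟨_, rfl⟩
  have hZs : ContDiffAt ℝ ∞ Z (t, 0) := by
    rw [hZ]
    exact contDiffAt_chart_comp_map hLs hsrc
  have hZd := (hZs.differentiableAt (by simp)).hasFDerivAt
  have hZt : Z (t, 0) = extChartAt 𝓘(ℝ, JetModel n k) u₁ (jetLift n k γ t) := by
    rw [hZ, ← hL0.eq_of_nhds]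
  rw [← hZ]
  have hmZ : Z (t, 0) ∈ chartDomain u₁ W := by
    rw [hZ]
    exact hm
  have hZL : extChartAt 𝓘(ℝ, JetModel n k) u₁ (L (t, 0)) = Z (t, 0) := by rw [hZ]
  rw [hZL]
  have hsm : SmoothCurveNear n (fun τ => F (τ, 0)) t :=
    smoothCurveNear_family hO hF (p := (t, 0)) hpO
  have hv1 : HasDerivAt (fun τ => Z (τ, 0)) (fderiv ℝ Z (t, 0) ((1, 0) : ℝ × ℝ)) t :=
    hZd.comp_hasDerivAt t ((hasDerivAt_id t).prodMk (hasDerivAt_const t (0 : ℝ)))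
  have hv2 : HasDerivAt (fun τ => extChartAt 𝓘(ℝ, JetModel n k) u₁ (jetLift n k γ τ))
      (fderiv ℝ Z (t, 0) ((1, 0) : ℝ × ℝ)) t := by
    refine hv1.congr_of_eventuallyEq ?_
    filter_upwards [hL0] with τ hτ
    rw [hZ, ← hτ]
  have hcontact : contactForm (Z (t, 0)) (fderiv ℝ Z (t, 0) ((1, 0) : ℝ × ℝ)) = 0 := by
    have h1 := contactForm_jetVelocity (k := k) u₁ hsm hFsrc
    rw [← deriv_coord_jetLift u₁ hsm hFsrc] at h1
    have h2 : deriv (fun s => extChartAt 𝓘(ℝ, JetModel n k) u₁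
        (jetLift n k (fun τ => F (τ, 0)) s)) t = fderiv ℝ Z (t, 0) ((1, 0) : ℝ × ℝ) := by
      rw [← hv1.deriv, hZ]
      rfl
    rw [h2] at h1
    rw [hZ]
    rw [hZ] at h1
    exact h1
  obtain ⟨V, hVdef⟩ : ∃ V, V = fderiv ℝ Z (t, 0) ((0, 1) : ℝ × ℝ) := ⟨_, rfl⟩
  have hVd : HasDerivAt (fun s => Z (t, s)) V 0 := by
    rw [hVdef]
    exact hZd.comp_hasDerivAt (0 : ℝ) ((hasDerivAt_const (0 : ℝ) t).prodMk (hasDerivAt_id (0 : ℝ)))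
  have hline : Tendsto (fun s : ℝ => (t, s)) (𝓝 0) (𝓝 (t, 0)) :=
    (continuous_const.prodMk continuous_id).continuousAt
  -- The family varies curves as sections over a fixed time, so its variation vector has no time
  -- component.
  have hV1 : V.1 = 0 := by
    have h1 : HasDerivAt (fun s => (Z (t, s)).1) V.1 0 := hVd.fst
    refine h1.unique ((hasDerivAt_const (0 : ℝ) t).congr_of_eventuallyEq ?_)
    filter_upwards [hline.eventually hcoord] with s hs'
    rw [hZ]
    exact congrArg Prod.fst hs'.2.2
  have hV0 : V.2 0 = η := by
    have h1 : HasDerivAt (fun s => (Z (t, s)).2 0) (V.2 0) 0 := hasDerivAt_pi.1 hVd.snd 0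
    refine h1.unique (hη.congr_of_eventuallyEq ?_)
    filter_upwards [hline.eventually hcoord] with s hs'
    rw [hZ]
    refine (congrFun (congrArg Prod.snd hs'.2.2) 0).trans ?_
    show iteratedDeriv 0 _ t = _
    rw [iteratedDeriv_zero]
    rfl
  rw [← hVdef, hPC.covD_eq_base hmZ hcontact hV1, hV0, eulerExpr, hv2.deriv, hZt]

/-- The variations `t ↦ φ⁻¹ (φ (γ t) + s χ(t) y)` of a curve. -/
def bumpFamily (φ : OpenPartialHomeomorph M (EuclideanSpace ℝ (Fin n))) (γ : ℝ → M) (χ : ℝ → ℝ)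
    (y : EuclideanSpace ℝ (Fin n)) (p : ℝ × ℝ) : M :=
  φ.symm (φ (γ p.1) + (p.2 * χ p.1) • y)

/-- The domain of smoothness of `bumpFamily`. -/
def bumpDomain (φ : OpenPartialHomeomorph M (EuclideanSpace ℝ (Fin n))) (γ : ℝ → M) (χ : ℝ → ℝ)
    (y : EuclideanSpace ℝ (Fin n)) (J : Set ℝ) : Set (ℝ × ℝ) :=
  (J ×ˢ univ) ∩ (fun p : ℝ × ℝ => φ (γ p.1) + (p.2 * χ p.1) • y) ⁻¹' φ.target

lemma bumpFamily_smooth {φ : OpenPartialHomeomorph M (EuclideanSpace ℝ (Fin n))}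
    (hφ : φ ∈ IsManifold.maximalAtlas (𝓡 n) ∞ M) {γ : ℝ → M} {χ : ℝ → ℝ} (hχ : ContDiff ℝ ∞ χ)
    (y : EuclideanSpace ℝ (Fin n)) {J : Set ℝ} (hJ : IsOpen J)
    (hγ : ∀ t ∈ J, ContMDiffAt 𝓘(ℝ, ℝ) (𝓡 n) ∞ γ t) (hs : ∀ t ∈ J, γ t ∈ φ.source) :
    IsOpen (bumpDomain φ γ χ y J) ∧
      ContMDiffOn 𝓘(ℝ, ℝ × ℝ) (𝓡 n) ∞ (bumpFamily φ γ χ y) (bumpDomain φ γ χ y J) := by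
  have h1 : ∀ p ∈ J ×ˢ (univ : Set ℝ),
      ContDiffAt ℝ ∞ (fun p : ℝ × ℝ => φ (γ p.1) + (p.2 * χ p.1) • y) p := by
    intro p hp
    have h2 : ContDiffAt ℝ ∞ (φ ∘ γ) p.1 := contDiffAt_chart_comp hφ (hγ _ hp.1) (hs _ hp.1)
    exact (h2.comp p contDiffAt_fst).add ((contDiffAt_snd.mul
      (hχ.contDiffAt.comp p contDiffAt_fst)).smul contDiffAt_const)
  constructor
  · exact ContinuousOn.isOpen_inter_preimage (fun p hp => (h1 p hp).continuousAt.continuousWithinAt)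
      (hJ.prod isOpen_univ) φ.open_target
  · intro p hp
    exact (ContMDiffAt.comp p (contMDiffAt_symm_of_mem_maximalAtlas hφ hp.2)
      (h1 p hp.1).contMDiffAt).contMDiffWithinAt

lemma bumpFamily_of_eq_zero {φ : OpenPartialHomeomorph M (EuclideanSpace ℝ (Fin n))}
    {γ : ℝ → M} {χ : ℝ → ℝ} {y : EuclideanSpace ℝ (Fin n)} {t s : ℝ} (hs : γ t ∈ φ.source)
    (h : s * χ t = 0) : bumpFamily φ γ χ y (t, s) = γ t := by
  rw [bumpFamily]
  simp only [h, zero_smul, add_zero]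
  exact φ.left_inv hs

/-- The Euler-Lagrange expressions of a solution vanish weakly. -/
lemma integral_eulerExpr_eq_zero {W : Set (Jet n M k)} (hW : IsOpen W) {α α₀ : JForm n k M 1}
    (hPC : IsPoincareCartanOn W α α₀) {r r' : ℕ} (hr : HasOrderOn W α r)
    (hr' : r' + 1 ≤ k) (hα₀r : HasOrderOn W α₀ r') {I : Set ℝ} {γ : ℝ → M}
    (hsol : IsSolution W α r I γ) (u₁ : Jet n M k) {a b : ℝ} (hab : a < b) {J : Set ℝ}
    (hJ : IsOpen J) (hJI : J ⊆ I) (habJ : Icc a b ⊆ J)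
    (hs : ∀ t ∈ J, γ t ∈ (chartAt (EuclideanSpace ℝ (Fin n)) u₁.point).source)
    (y : EuclideanSpace ℝ (Fin n)) {χ : ℝ → ℝ} (hχ : ContDiff ℝ ∞ χ)
    (hχs : tsupport χ ⊆ Ioo a b) :
    ∫ t, χ t • eulerExpr α₀ u₁ γ y t = 0 := by
  obtain ⟨hI, -, hγ, hγW, hvar⟩ := hsol
  set φ := chartAt (EuclideanSpace ℝ (Fin n)) u₁.point with hφ
  have hφm : φ ∈ IsManifold.maximalAtlas (𝓡 n) ∞ M := IsManifold.chart_mem_maximalAtlas u₁.point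
  have hγa : ∀ t ∈ J, ContMDiffAt 𝓘(ℝ, ℝ) (𝓡 n) ∞ γ t := fun t ht =>
    hγ.contMDiffAt (hI.mem_nhds (hJI ht))
  have hγn : ∀ t ∈ J, SmoothCurveNear n γ t := fun t ht => by
    filter_upwards [hJ.mem_nhds ht] with s hs' using hγa s hs'
  obtain ⟨hO, hF⟩ := bumpFamily_smooth hφm hχ y hJ hγa hs
  set F := bumpFamily φ γ χ y with hFdef
  set O := bumpDomain φ γ χ y J with hOdef
  set L := jetLiftFamily n k F with hL
  have hLc : ContinuousOn L O := fun p hp =>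
    (contMDiffAt_jetLiftFamily hO hF hp).continuousAt.continuousWithinAt
  have hO' : IsOpen (O ∩ L ⁻¹' W) := hLc.isOpen_inter_preimage hO hW
  have hFev : ∀ t ∈ J, (fun τ => F (τ, 0)) =ᶠ[𝓝 t] γ := fun t ht => by
    filter_upwards [hJ.mem_nhds ht] with s hs'
    exact bumpFamily_of_eq_zero (hs s hs') (zero_mul _)
  have hL0 : ∀ t ∈ J, L (t, 0) = jetLift n k γ t := fun t ht => jetLift_congr (hFev t ht)
  have hO0 : ∀ t ∈ J, (t, (0 : ℝ)) ∈ O := fun t ht => by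
    refine ⟨⟨ht, mem_univ _⟩, ?_⟩
    simp only [mem_preimage, zero_mul, zero_smul, add_zero]
    exact φ.map_source (hs t ht)
  have hsub : Icc a b ×ˢ {(0 : ℝ)} ⊆ O ∩ L ⁻¹' W := by
    rintro ⟨t, s⟩ ⟨ht, rfl⟩
    refine ⟨hO0 t (habJ ht), ?_⟩
    rw [mem_preimage, hL0 t (habJ ht)]
    exact hγW t (hJI (habJ ht))
  -- The tube lemma keeps the whole varied lift inside the open set `W` for all small parameters at
  -- once.
  obtain ⟨A, B, -, hB, hA1, hB1, hAB⟩ :=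
    generalized_tube_lemma isCompact_Icc isCompact_singleton hO' hsub
  obtain ⟨ε, hε, hεB⟩ := Metric.nhds_basis_closedBall.mem_iff.1
    (hB.mem_nhds (hB1 (mem_singleton (0 : ℝ))))
  rw [Real.closedBall_eq_Icc, zero_sub, zero_add] at hεB
  have hrect : Icc a b ×ˢ Icc (-ε) ε ⊆ O ∩ L ⁻¹' W := (prod_mono hA1 hεB).trans hAB
  have hRO : Icc a b ×ˢ Icc (-ε) ε ⊆ O := hrect.trans inter_subset_left
  have hRW : ∀ s ∈ Icc (-ε) ε, ∀ t ∈ Icc a b, jetLift n k (fun τ => F (τ, s)) t ∈ W := by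
    intro s hs' t ht
    have h1 : ((t, s) : ℝ × ℝ) ∈ O ∩ L ⁻¹' W := hrect ⟨ht, hs'⟩
    exact h1.2
  -- The support of `χ` lies strictly inside the interval. Near the endpoints the varied curves
  -- equal `γ`, which fixes jets of every order there.
  have hend : ∀ t ∈ Icc a b, t ∉ Ioo a b → ∀ s, (fun τ => F (τ, s)) =ᶠ[𝓝 t] γ := by
    intro t ht hnt s
    have h1 : χ =ᶠ[𝓝 t] 0 := notMem_tsupport_iff_eventuallyEq.1 fun h => hnt (hχs h)
    filter_upwards [h1, hJ.mem_nhds (habJ ht)] with τ hτ hτJ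
    exact bumpFamily_of_eq_zero (hs τ hτJ) (by rw [hτ]; exact mul_zero _)
  have ha : a ∈ Icc a b := left_mem_Icc.2 hab.le
  have hb : b ∈ Icc a b := right_mem_Icc.2 hab.le
  have hea := hend a ha (by simp)
  have heb := hend b hb (by simp)
  have hV : IsVariation W r γ a b ε F :=
    ⟨⟨O, hO, hRO, hF⟩, fun t ht => (hFev t (habJ ht)).eq_of_nhds, hRW,
      fun s _ => ⟨jetLift_congr (hea s), jetLift_congr (heb s)⟩⟩
  have hd1 := hvar a b hab (habJ.trans hJI) ε hε F hV
  have hd2 := hasDerivAt_action hW hPC hab hε hO hRO hF hRW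
  have h0 : (0 : ℝ) ∈ Icc (-ε) ε := ⟨by linarith, hε.le⟩
  rw [along_boundary_eq_zero hW hPC hr hr' hα₀r hO hF (hO0 a (habJ ha)) (hRW 0 h0 a ha)
      (jetLift n r γ a) (Eventually.of_forall fun s => jetLift_congr (hea s)),
    along_boundary_eq_zero hW hPC hr hr' hα₀r hO hF (hO0 b (habJ hb)) (hRW 0 h0 b hb)
      (jetLift n r γ b) (Eventually.of_forall fun s => jetLift_congr (heb s)),
    sub_zero, zero_add] at hd2
  have hint := hd2.unique hd1
  have hsupp : Function.support (fun t => χ t • eulerExpr α₀ u₁ γ y t) ⊆ Ioc a b := by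
    intro t ht
    have h1 : t ∈ tsupport χ := subset_tsupport χ fun h0 => ht (by simp [h0])
    exact ⟨(hχs h1).1, (hχs h1).2.le⟩
  rw [← intervalIntegral.integral_eq_integral_of_support_subset hsupp, ← hint]
  refine intervalIntegral.integral_congr fun t ht => ?_
  rw [uIcc_of_le hab.le] at ht
  have htJ := habJ ht
  have hpO := hO0 t htJ
  have hFsrc : F (t, 0) ∈ φ.source := by
    have hFp : F (t, 0) = γ t := (hFev t htJ).eq_of_nhds
    rw [hFp]
    exact hs t htJ
  -- In the chart, the variation field in order `0` is `χ(t) y`.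
  have hη : HasDerivAt (fun s => φ (F (t, s))) (χ t • y) 0 := by
    have h2 : HasDerivAt (fun s : ℝ => φ (γ t) + (s * χ t) • y) (χ t • y) 0 := by
      simpa using (((hasDerivAt_id (0 : ℝ)).mul_const (χ t)).smul_const y).const_add (φ (γ t))
    refine h2.congr_of_eventuallyEq ?_
    have hline : Tendsto (fun s : ℝ => (t, s)) (𝓝 0) (𝓝 (t, 0)) :=
      (continuous_const.prodMk continuous_id).continuousAt
    filter_upwards [hline.eventually (hO.mem_nhds hpO)] with s hs'
    exact φ.right_inv hs'.2
  have hfin := hPC.d_family_eq u₁ hO hF hpO (hRW 0 h0 t ht) hFsrc (hFev t htJ) hη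
  exact (eulerExpr_smul α₀ u₁ γ (χ t) y t).symm.trans hfin.symm

/-- Solutions are critical. -/
lemma IsSolution.isCritical {W : Set (Jet n M k)} (hW : IsOpen W) {α α₀ : JForm n k M 1}
    (hPC : IsPoincareCartanOn W α α₀) {r r' : ℕ} (hr : HasOrderOn W α r)
    (hr' : r' + 1 ≤ k) (hα₀r : HasOrderOn W α₀ r') {I : Set ℝ} {γ : ℝ → M}
    (hsol : IsSolution W α r I γ) {t₀ : ℝ} (ht₀ : t₀ ∈ I) : IsCritical α₀ γ t₀ := by
  have hsol' := hsol
  obtain ⟨hI, -, hγ, hγW, -⟩ := hsol'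
  set u₁ := jetLift n k γ t₀ with hu₁
  have hpt : u₁.point = γ t₀ := jetLift_point _ _
  set φ := chartAt (EuclideanSpace ℝ (Fin n)) u₁.point with hφ
  have hJ : IsOpen (I ∩ γ ⁻¹' φ.source) := hγ.continuousOn.isOpen_inter_preimage hI φ.open_source
  have ht₀J : t₀ ∈ I ∩ γ ⁻¹' φ.source := by
    refine ⟨ht₀, ?_⟩
    rw [mem_preimage, hφ, hpt]
    exact mem_chart_source _ _
  -- The argument is localised to a time interval on which the curve stays in a single chart.
  obtain ⟨a, b, -, habn, hsub⟩ := exists_Icc_mem_subset_of_mem_nhds (hJ.mem_nhds ht₀J)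
  have hab0 := Icc_mem_nhds_iff.1 habn
  have hab : a < b := hab0.1.trans hab0.2
  have hs : ∀ t ∈ I ∩ γ ⁻¹' φ.source, γ t ∈ φ.source := fun t ht => ht.2
  have hγn : ∀ t ∈ I ∩ γ ⁻¹' φ.source, SmoothCurveNear n γ t := fun t ht => by
    filter_upwards [hI.mem_nhds ht.1] with s hs' using hγ.contMDiffAt (hI.mem_nhds hs')
  have hIoo : Ioo a b ⊆ I ∩ γ ⁻¹' φ.source := Ioo_subset_Icc_self.trans hsub
  have hzero : ∀ y, eulerExpr α₀ u₁ γ y t₀ = 0 := by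
    intro y
    have hc : ContinuousOn (eulerExpr α₀ u₁ γ y) (Ioo a b) :=
      continuousOn_eulerExpr hPC.1 u₁ (fun t ht => hγn t (hIoo ht))
        (fun t ht => hγW t (hIoo ht).1) (fun t ht => (hIoo ht).2) y
    -- The fundamental lemma of the calculus of variations, for the scalar function attached to each
    -- direction `y`.
    have hae := isOpen_Ioo.ae_eq_zero_of_integral_contDiff_smul_eq_zero
      (μ := MeasureTheory.volume) (hc.locallyIntegrableOn measurableSet_Ioo)
      (fun g hg _ hgs => integral_eulerExpr_eq_zero hW hPC hr hr' hα₀r hsol u₁ hab hJ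
        inter_subset_left hsub hs y hg hgs)
    have hae2 : eulerExpr α₀ u₁ γ y =ᵐ[MeasureTheory.volume.restrict (Ioo a b)] fun _ => 0 :=
      (MeasureTheory.ae_restrict_iff' measurableSet_Ioo).2 hae
    exact MeasureTheory.Measure.eqOn_open_of_ae_eq hae2 isOpen_Ioo hc continuousOn_const hab0
  intro w
  have hsrc : u₁ ∈ (extChartAt 𝓘(ℝ, JetModel n k) u₁).source := mem_extChartAt_source u₁
  have hm := mem_chartDomain hsrc (hγW t₀ ht₀)
  rw [PForm.d_apply hPC.1 (hγW t₀ ht₀) hsrc]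
  have hvel := chartD_jetVelocity (k := k) u₁ (hγn t₀ ht₀J) ht₀J.2
  have hcon := contactForm_jetVelocity (k := k) u₁ (hγn t₀ ht₀J) ht₀J.2
  have hder := deriv_coord_jetLift (k := k) u₁ (hγn t₀ ht₀J) ht₀J.2
  set v := chartD u₁ u₁ (jetVelocity n k γ t₀) with hv
  have hv1 : v.1 = 1 := congrArg Prod.fst hvel
  set z := extChartAt 𝓘(ℝ, JetModel n k) u₁ u₁ with hz
  set w' := chartD u₁ u₁ w with hw'
  -- The velocity has time component `1`. Subtracting a multiple of it from `w'` removes the time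
  -- component, and costs nothing since `covD` is alternating.
  have h1 : covD (α₀.cov u₁) z (w' - w'.1 • v) v = 0 := by
    rw [hPC.covD_eq_base hm hcon (by simp [hv1])]
    have h2 := hzero ((w' - w'.1 • v).2 0)
    rw [eulerExpr, hder] at h2
    exact h2
  have h3 : covD (α₀.cov u₁) z v v = 0 := by rw [covD_apply, sub_self]
  rw [map_sub, map_smul] at h1
  have h4 : covD (α₀.cov u₁) z w' v - w'.1 • covD (α₀.cov u₁) z v v = 0 := h1
  rw [h3, smul_zero, sub_zero] at h4
  exact h4

end EulerLagrange

/-! Objects preserved by flows. -/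

section FlowInvariance

variable {H : Type*} [NormedAddCommGroup H] [NormedSpace ℝ H]

lemma hasDerivAt_comp_fderiv {E F : Type*} [NormedAddCommGroup E] [NormedSpace ℝ E]
    [NormedAddCommGroup F] [NormedSpace ℝ F] {g : E → F} {c : ℝ → E} {c' : E} {s : ℝ}
    (hg : DifferentiableAt ℝ g (c s)) (hc : HasDerivAt c c' s) :
    HasDerivAt (fun s => g (c s)) (fderiv ℝ g (c s) c') s :=
  hg.hasFDerivAt.comp_hasDerivAt s hc

lemma hasDerivAt_covD_along {ϑ : H → H →L[ℝ] ℝ} {c v : ℝ → H} {s : ℝ} {c' v' : H}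
    (hϑ : ContDiffAt ℝ ∞ ϑ (c s)) (hc : HasDerivAt c c' s) (hv : HasDerivAt v v' s) :
    HasDerivAt (fun s => covD ϑ (c s) (v s))
      (fderiv ℝ (covD ϑ) (c s) c' (v s) + covD ϑ (c s) v') s := by
  have d0 : DifferentiableAt ℝ (covD ϑ) (c s) := (contDiffAt_covD hϑ).differentiableAt (by simp)
  have d1 := hasDerivAt_comp_fderiv (F := H →L[ℝ] H →L[ℝ] ℝ) d0 hc
  exact d1.clm_apply hv

/-- The kernel of the differential of an invariant covector field is preserved by the flow. -/
lemma covD_flow_eq_zero {ξ : H → H} {ϑ : H → H →L[ℝ] ℝ} {O : Set H} (hO : IsOpen O)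
    (hξ : ∀ z ∈ O, ContDiffAt ℝ ∞ ξ z) (hϑ : ∀ z ∈ O, ContDiffAt ℝ ∞ ϑ z)
    (hinv : ∀ z ∈ O, covLie ξ ϑ z = 0) {ε : ℝ} {c v : ℝ → H}
    (hcO : ∀ s ∈ Ioo (-ε) ε, c s ∈ O)
    (hc : ∀ s ∈ Ioo (-ε) ε, HasDerivAt c (ξ (c s)) s)
    (hv : ∀ s ∈ Ioo (-ε) ε, HasDerivAt v (fderiv ℝ ξ (c s) (v s)) s)
    (h0 : covD ϑ (c 0) (v 0) = 0) : ∀ s ∈ Ioo (-ε) ε, covD ϑ (c s) (v s) = 0 := by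
  have hcc : ContinuousOn c (Ioo (-ε) ε) := fun s hs => (hc s hs).continuousAt.continuousWithinAt
  have hfd : ContinuousOn (fun s => fderiv ℝ ξ (c s)) (Ioo (-ε) ε) := fun s hs =>
    ContinuousAt.continuousWithinAt (ContinuousAt.comp (g := fderiv ℝ ξ)
      ((hξ _ (hcO s hs)).fderiv_right (m := ∞) (by simp)).continuousAt (hc s hs).continuousAt)
  -- By invariance of `covD ϑ`, the covector `covD ϑ (c s) (v s)` has derivative equal to minus its
  -- composition with `fderiv ℝ ξ (c s)`. This is a homogeneous linear ODE.
  refine eq_zero_of_linear_ode (y := fun s => covD ϑ (c s) (v s))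
    (A := fun s => -((ContinuousLinearMap.compL ℝ H H ℝ).flip (fderiv ℝ ξ (c s)))) ?_ ?_ h0
  · have hk : Continuous fun B : H →L[ℝ] H => -((ContinuousLinearMap.compL ℝ H H ℝ).flip B) :=
      (ContinuousLinearMap.compL ℝ H H ℝ).flip.continuous.neg
    exact hk.comp_continuousOn hfd
  · intro s hs
    refine (hasDerivAt_covD_along (hϑ _ (hcO s hs)) (hc s hs) (hv s hs)).congr_deriv ?_
    have hev : covLie ξ ϑ =ᶠ[𝓝 (c s)] 0 := by
      filter_upwards [hO.mem_nhds (hcO s hs)] with z hz using hinv z hz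
    refine ContinuousLinearMap.ext fun w => ?_
    have h1 := covD_invariant (hξ _ (hcO s hs)) (hϑ _ (hcO s hs)) hev (v s) w
    have h2 : fderiv ℝ (covD ϑ) (c s) (ξ (c s)) (v s) w +
        covD ϑ (c s) (fderiv ℝ ξ (c s) (v s)) w =
        -(covD ϑ (c s) (v s) (fderiv ℝ ξ (c s) w)) := by linarith
    exact h2

end FlowInvariance

/-! ### Flows and Lie derivatives of contact fields. -/

section ContactFlow

variable {n k : ℕ}

/-- The inclusion of the components of order `< k`. -/
def lowerInclusion : (Fin k → EuclideanSpace ℝ (Fin n)) →L[ℝ] JetModel n k :=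
  (0 : (Fin k → EuclideanSpace ℝ (Fin n)) →L[ℝ] ℝ).prod (ContinuousLinearMap.pi fun a =>
    if h : (a : ℕ) < k then ContinuousLinearMap.proj (R := ℝ) (⟨a, h⟩ : Fin k) else 0)

lemma lowerInclusion_fst (y : Fin k → EuclideanSpace ℝ (Fin n)) :
    (lowerInclusion y : JetModel n k).1 = 0 := rfl

lemma lowerInclusion_castSucc (y : Fin k → EuclideanSpace ℝ (Fin n)) (a : Fin k) :
    (lowerInclusion y : JetModel n k).2 a.castSucc = y a := by
  simp [lowerInclusion]

/-- Since `lowerInclusion` is a right inverse of the contact form, a vector splits into a contact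
vector and a term linear in its contact components. This closes the ODE for the contact components
along the flow. -/
lemma contactForm_sub_lowerInclusion (z v : JetModel n k) :
    contactForm z (v - lowerInclusion (contactForm z v)) = 0 := by
  funext a
  rw [map_sub, Pi.sub_apply, contactForm_apply z (lowerInclusion _), lowerInclusion_castSucc,
    lowerInclusion_fst]
  simp

lemma continuous_contactForm : Continuous (contactForm (n := n) (k := k)) := by
  rw [continuous_clm_apply]
  intro v
  refine continuous_pi fun a => ?_
  simp only [contactForm_apply]
  fun_prop

/-- A vector field in coordinates whose flow preserves the contact forms, infinitesimally. -/
def IsContactField (O : Set (JetModel n k)) (ξ : JetModel n k → JetModel n k) : Prop :=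
  ∀ z ∈ O, ∀ v, contactForm z v = 0 →
    ∀ a : Fin k, contactForm z (fderiv ℝ ξ z v) a = v.1 • (ξ z).2 a.succ

/-- The contact vectors are preserved by the flow of a contact field. -/
lemma IsContactField.flow_eq_zero {O : Set (JetModel n k)} {ξ : JetModel n k → JetModel n k}
    (hξ : ∀ z ∈ O, ContDiffAt ℝ ∞ ξ z) (hcon : IsContactField O ξ) {ε : ℝ}
    {c v : ℝ → JetModel n k} (hcO : ∀ s ∈ Ioo (-ε) ε, c s ∈ O)
    (hc : ∀ s ∈ Ioo (-ε) ε, HasDerivAt c (ξ (c s)) s)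
    (hv : ∀ s ∈ Ioo (-ε) ε, HasDerivAt v (fderiv ℝ ξ (c s) (v s)) s)
    (h0 : contactForm (c 0) (v 0) = 0) : ∀ s ∈ Ioo (-ε) ε, contactForm (c s) (v s) = 0 := by
  have hcc : ContinuousOn c (Ioo (-ε) ε) := fun s hs => (hc s hs).continuousAt.continuousWithinAt
  have hfd : ContinuousOn (fun s => fderiv ℝ ξ (c s)) (Ioo (-ε) ε) := fun s hs =>
    ContinuousAt.continuousWithinAt (ContinuousAt.comp (g := fderiv ℝ ξ)
      ((hξ _ (hcO s hs)).fderiv_right (m := ∞) (by simp)).continuousAt (hc s hs).continuousAt)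
  -- The derivative of the contact components along the flow vanishes whenever `v s` is a contact
  -- vector. It is therefore a linear function of those components alone.
  refine eq_zero_of_linear_ode (y := fun s => contactForm (c s) (v s))
    (A := fun s => (contactForm (c s)).comp ((fderiv ℝ ξ (c s)).comp lowerInclusion)) ?_ ?_ h0
  · exact (continuous_contactForm.comp_continuousOn hcc).clm_comp
      (hfd.clm_comp continuousOn_const)
  · intro s hs
    refine hasDerivAt_pi.2 fun a => ?_
    have hv1 : HasDerivAt (fun s => (v s).1) (fderiv ℝ ξ (c s) (v s)).1 s := (hv s hs).fst
    have hv2 : HasDerivAt (fun s => (v s).2 a.castSucc)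
        ((fderiv ℝ ξ (c s) (v s)).2 a.castSucc) s := hasDerivAt_pi.1 (hv s hs).snd _
    have hc2 : HasDerivAt (fun s => (c s).2 a.succ) ((ξ (c s)).2 a.succ) s :=
      hasDerivAt_pi.1 (hc s hs).snd _
    have h1 := hv2.sub (hv1.smul hc2)
    refine h1.congr_deriv ?_
    -- The contact part of `v s` contributes nothing to the derivative, by the contact condition on
    -- `ξ`. Only the part in the image of `lowerInclusion` remains.
    have h2 := hcon (c s) (hcO s hs) _ (contactForm_sub_lowerInclusion (c s) (v s)) a
    rw [map_sub, map_sub, Pi.sub_apply, Prod.fst_sub, lowerInclusion_fst, sub_zero,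
      sub_eq_iff_eq_add] at h2
    have h3 : contactForm (c s) (fderiv ℝ ξ (c s) (v s)) a = (fderiv ℝ ξ (c s) (v s)).2 a.castSucc -
      (fderiv ℝ ξ (c s) (v s)).1 • (c s).2 a.succ := rfl
    rw [h3] at h2
    show (fderiv ℝ ξ (c s) (v s)).2 a.castSucc - ((v s).1 • (ξ (c s)).2 a.succ +
      (fderiv ℝ ξ (c s) (v s)).1 • (c s).2 a.succ) =
      contactForm (c s) (fderiv ℝ ξ (c s) (lowerInclusion (contactForm (c s) (v s)))) a
    rw [← sub_eq_iff_eq_add'] at h2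
    rw [← h2]
    abel

/-- The contact field extending a contact vector. -/
def contactExtension (v z : JetModel n k) : JetModel n k :=
  v.1 • totalVec z + (0, Pi.single (Fin.last k) (v.2 (Fin.last k)))

lemma contDiff_contactExtension (v : JetModel n k) : ContDiff ℝ ∞ (contactExtension v) :=
  (contDiff_totalVec.const_smul v.1).add contDiff_const

lemma contactForm_contactExtension (v z : JetModel n k) :
    contactForm z (contactExtension v z) = 0 := by
  rw [contactForm_eq_zero_iff]
  simp [contactExtension, totalVec]

/-- Differentiate along `ζ` the identity saying that the extension is a contact vector at every
point. The right-hand side comes from the dependence of the contact form itself on the point. -/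
lemma contactForm_fderiv_contactExtension {z v : JetModel n k} (hv : contactForm z v = 0)
    (ζ : JetModel n k) (a : Fin k) :
    contactForm z (fderiv ℝ (contactExtension v) z ζ) a = v.1 • ζ.2 a.succ := by
  have hvz : contactExtension v z = v := (contactForm_eq_zero_iff.1 hv).symm
  obtain ⟨Y, hY⟩ : ∃ Y, Y = fderiv ℝ (contactExtension v) z := ⟨_, rfl⟩
  rw [← hY]
  have hd : HasFDerivAt (contactExtension v) Y z := by
    rw [hY]
    exact ((contDiff_contactExtension v).differentiable (by simp) z).hasFDerivAt
  have hl : HasDerivAt (fun s : ℝ => z + s • ζ) ζ 0 := by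
    simpa using ((hasDerivAt_id (0 : ℝ)).smul_const ζ).const_add z
  have hd2 : HasDerivAt (fun s : ℝ => contactExtension v (z + s • ζ)) (Y ζ) 0 :=
    hd.comp_hasDerivAt_of_eq (0 : ℝ) hl (by simp)
  have e1 : HasDerivAt (fun s : ℝ => (contactExtension v (z + s • ζ)).2 a.castSucc)
    ((Y ζ).2 a.castSucc) 0 := hasDerivAt_pi.1 hd2.snd _
  have e2 : HasDerivAt (fun s : ℝ => (contactExtension v (z + s • ζ)).1) ((Y ζ).1) 0 := hd2.fst
  have e3 : HasDerivAt (fun s : ℝ => (z + s • ζ).2 a.succ) (ζ.2 a.succ) 0 :=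
    hasDerivAt_pi.1 hl.snd _
  have e4 := e2.smul e3
  have e5 : (fun s : ℝ => (contactExtension v (z + s • ζ)).2 a.castSucc) =
      (fun s : ℝ => (contactExtension v (z + s • ζ)).1) • fun s : ℝ => (z + s • ζ).2 a.succ := by
    funext s
    have := congrFun (contactForm_contactExtension v (z + s • ζ)) a
    rw [contactForm_apply] at this
    exact sub_eq_zero.1 this
  rw [e5] at e1
  rw [contactForm_apply, e1.unique e4]
  simp [hvz]

/-- A field is a contact field if its brackets with contact fields are contact fields. -/
lemma isContactField_of_lieBracket {O : Set (JetModel n k)} {ξ : JetModel n k → JetModel n k}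
    (hbr : ∀ z ∈ O, ∀ v, contactForm z
      (VectorField.lieBracket ℝ ξ (contactExtension v) z) = 0) : IsContactField O ξ := by
  intro z hz v hv a
  have hvz : contactExtension v z = v := (contactForm_eq_zero_iff.1 hv).symm
  have h1 := congrFun (hbr z hz v) a
  rw [VectorField.lieBracket, hvz, map_sub, Pi.sub_apply,
    contactForm_fderiv_contactExtension hv] at h1
  exact (sub_eq_zero.1 h1).symm

/-- The Lie derivative along a contact field preserves the covector fields that vanish on contact
vectors. -/
lemma IsContactField.covLie_eq_zero {O : Set (JetModel n k)} (hO : IsOpen O)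
    {ξ : JetModel n k → JetModel n k} (hcon : IsContactField O ξ)
    {ϑ : JetModel n k → JetModel n k →L[ℝ] ℝ}
    (hϑ : ∀ z ∈ O, ∀ v, contactForm z v = 0 → ϑ z v = 0) {z : JetModel n k} (hz : z ∈ O)
    (hd : DifferentiableAt ℝ ϑ z) {v : JetModel n k} (hv : contactForm z v = 0) :
    covLie ξ ϑ z v = 0 := by
  have hvz : contactExtension v z = v := (contactForm_eq_zero_iff.1 hv).symm
  have hY : HasFDerivAt (contactExtension v) (fderiv ℝ (contactExtension v) z) z :=
    ((contDiff_contactExtension v).differentiable (by simp) z).hasFDerivAt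
  have h1 := hd.hasFDerivAt.clm_apply hY
  -- Extending `v` to a contact field keeps the evaluation identically zero near `z`, so it can be
  -- differentiated along `ξ`.
  have hev : (fun z => ϑ z (contactExtension v z)) =ᶠ[𝓝 z] fun _ => 0 := by
    filter_upwards [hO.mem_nhds hz] with z' hz'
    exact hϑ z' hz' _ (contactForm_contactExtension v z')
  have h2 := congrArg (fun A : JetModel n k →L[ℝ] ℝ => A (ξ z))
    (h1.unique ((hasFDerivAt_const (0 : ℝ) z).congr_of_eventuallyEq hev))
  have h3 : ϑ z (fderiv ℝ (contactExtension v) z (ξ z)) + fderiv ℝ ϑ z (ξ z) v = 0 := by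
    have h4 : ϑ z (fderiv ℝ (contactExtension v) z (ξ z)) +
      fderiv ℝ ϑ z (ξ z) (contactExtension v z) = 0 := h2
    rwa [hvz] at h4
  -- The argument is minus the bracket of `ξ` with the extension of `v`, hence a contact vector, and
  -- `ϑ` annihilates it.
  have h5 : ϑ z (fderiv ℝ ξ z v - fderiv ℝ (contactExtension v) z (ξ z)) = 0 := by
    refine hϑ z hz _ (funext fun a => ?_)
    rw [map_sub, Pi.sub_apply, hcon z hz v hv, contactForm_fderiv_contactExtension hv, sub_self]
    rfl
  rw [map_sub] at h5
  rw [covLie_apply]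
  linarith

end ContactFlow

/-! ### Infinitesimal symmetries in adapted coordinates. -/

section Symmetry

variable {n k : ℕ} {M : Type*} [TopologicalSpace M] [ChartedSpace (EuclideanSpace ℝ (Fin n)) M]
  [IsManifold (𝓡 n) ∞ M]

/-- A `𝒟`-symmetry is a contact field in adapted coordinates. -/
lemma IsDSymmetryOn.isContactField {U : Set (Jet n M k)} (hU : IsOpen U) {X : JField n k M}
    (hX : ∀ u ∈ U, X.SmoothAt u) (hD : IsDSymmetryOn U X) (u₁ : Jet n M k) :
    IsContactField (chartDomain u₁ U) (X.inChart u₁) := by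
  refine isContactField_of_lieBracket fun z hz v => ?_
  set e := extChartAt 𝓘(ℝ, JetModel n k) u₁ with he
  have hopen : IsOpen (U ∩ e.source) := hU.inter (isOpen_extChartAt_source u₁)
  have hu : e.symm z ∈ e.source := e.map_target hz.1
  have hr : e (e.symm z) = z := e.right_inv hz.1
  -- The symmetry condition is tested on the local holonomic field whose chart expression is the
  -- contact extension of `v`.
  obtain ⟨Y, hY⟩ : ∃ Y : JField n k M, Y = fieldOfChart u₁ (contactExtension v) := ⟨_, rfl⟩
  have hYs : ∀ u ∈ U ∩ e.source, Y.SmoothAt u := fun u hu => by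
    rw [hY]
    exact smoothAt_fieldOfChart hu.2 (contDiff_contactExtension v).contDiffAt
  have h1 := hD (U ∩ e.source) hopen inter_subset_left Y hYs (fun u hu => by
    refine (mem_holonomicDist_iff u₁ hu.2).2 ?_
    rw [hY]
    have h2 := chartD_chartDsymm' hu.2 (contactExtension v (e u))
    have h3 := contactForm_contactExtension v (e u)
    rw [← h2] at h3
    exact h3) (e.symm z) ⟨hz.2, hu⟩
  replace h1 := (mem_holonomicDist_iff u₁ hu).1 h1
  have h4 := chartD_mlieBracket hu (hX _ hz.2) (hYs _ ⟨hz.2, hu⟩)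
  have h5 : contactForm (e (e.symm z)) (VectorField.lieBracket ℝ (X.inChart u₁) (Y.inChart u₁)
      (e (e.symm z))) = 0 := (congrArg _ h4).symm.trans h1
  rw [hr] at h5
  have h6 : Y.inChart u₁ =ᶠ[𝓝 z] contactExtension v := by
    filter_upwards [(isOpen_chart_target u₁).mem_nhds hz.1] with z' hz'
    rw [hY]
    exact inChart_fieldOfChart u₁ _ hz'
  have h7 : VectorField.lieBracket ℝ (X.inChart u₁) (Y.inChart u₁) z =
      VectorField.lieBracket ℝ (X.inChart u₁) (contactExtension v) z := by
    rw [VectorField.lieBracket, VectorField.lieBracket, h6.fderiv_eq, h6.eq_of_nhds]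
  rw [h7] at h5
  exact h5

lemma covLie_eq_zero_of_lieDeriv {U W : Set (Jet n M k)} (hUW : U ⊆ W) {α₀ : JForm n k M 1}
    (hα₀ : α₀.SmoothOn W) {X : JField n k M} (hX : ∀ u ∈ U, X.SmoothAt u)
    (hL : ∀ u ∈ U, PForm.lieDeriv X α₀ u = 0) (u₁ : Jet n M k) {z : JetModel n k}
    (hz : z ∈ chartDomain u₁ U) : covLie (X.inChart u₁) (α₀.cov u₁) z = 0 := by
  set e := extChartAt 𝓘(ℝ, JetModel n k) u₁ with he
  have hu : e.symm z ∈ e.source := e.map_target hz.1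
  have hr : e (e.symm z) = z := e.right_inv hz.1
  refine ContinuousLinearMap.ext fun w => ?_
  have h1 := PForm.lieDeriv_apply hα₀ (hUW hz.2) hu (hX _ hz.2) (chartDsymm u₁ z w)
  have h2 : PForm.lieDeriv X α₀ (e.symm z) ![chartDsymm u₁ z w] =
    covLie (X.inChart u₁) (α₀.cov u₁) (e (e.symm z))
      (chartD u₁ (e.symm z) (chartDsymm u₁ z w)) := h1
  rw [hr, hL _ hz.2, chartD_chartDsymm hz.1] at h2
  exact h2.symm

end Symmetry

/-! ### Reparametrising contact curves as lifts of sections. -/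

section Reparametrisation

variable {n k : ℕ} {M : Type*} [TopologicalSpace M] [ChartedSpace (EuclideanSpace ℝ (Fin n)) M]
  [IsManifold (𝓡 n) ∞ M]

/-- The inverse function theorem in one variable. The inverse is restricted to an interval because
the domain of a solution must be order-connected. -/
lemma exists_local_inverse {τ : ℝ → ℝ} {J : Set ℝ} (hJ : IsOpen J) {t : ℝ} (ht : t ∈ J)
    (hτ : ∀ t ∈ J, ContDiffAt ℝ ∞ τ t) (hτ' : ∀ t ∈ J, deriv τ t ≠ 0) :
    ∃ (g : ℝ → ℝ) (I : Set ℝ), IsOpen I ∧ I.OrdConnected ∧ τ t ∈ I ∧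
      (∀ x ∈ I, g x ∈ J ∧ τ (g x) = x ∧ ContDiffAt ℝ ∞ g x ∧
        HasDerivAt g (deriv τ (g x))⁻¹ x) ∧ ∀ᶠ t' in 𝓝 t, τ t' ∈ I ∧ g (τ t') = t' := by
  have hs : HasStrictDerivAt τ (deriv τ t) t := (hτ t ht).hasStrictDerivAt (by simp)
  set f := (hs.hasStrictFDerivAt_equiv (hτ' t ht)).toOpenPartialHomeomorph τ with hf
  have hcoe : (f : ℝ → ℝ) = τ :=
    (hs.hasStrictFDerivAt_equiv (hτ' t ht)).toOpenPartialHomeomorph_coe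
  have htf : t ∈ f.source :=
    (hs.hasStrictFDerivAt_equiv (hτ' t ht)).mem_toOpenPartialHomeomorph_source
  have hT : IsOpen (f.target ∩ f.symm ⁻¹' J) := f.isOpen_inter_preimage_symm hJ
  have hl : ∀ t' ∈ f.source, f.symm (τ t') = t' := fun t' ht' => by
    rw [← hcoe]
    exact f.left_inv ht'
  have htT : τ t ∈ f.target ∩ f.symm ⁻¹' J := by
    refine ⟨?_, ?_⟩
    · rw [← hcoe]
      exact f.map_source htf
    · rw [mem_preimage, hl t htf]
      exact ht
  obtain ⟨δ, hδ, hball⟩ := Metric.isOpen_iff.1 hT _ htT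
  refine ⟨f.symm, Metric.ball (τ t) δ, Metric.isOpen_ball, (convex_ball _ _).ordConnected,
    Metric.mem_ball_self hδ, fun x hx => ?_, ?_⟩
  · obtain ⟨hx1, hx2⟩ := hball hx
    have hd : HasDerivAt f (deriv τ (f.symm x)) (f.symm x) := by
      rw [hcoe]
      exact ((hτ _ hx2).differentiableAt (by simp)).hasDerivAt
    have hr : f (f.symm x) = x := f.right_inv hx1
    refine ⟨hx2, by rw [← hcoe]; exact hr, ?_, f.hasDerivAt_symm hx1 (hτ' _ hx2) hd⟩
    refine f.contDiffAt_symm_deriv (hτ' _ hx2) hx1 hd ?_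
    rw [hcoe]
    exact hτ _ hx2
  · filter_upwards [f.open_source.mem_nhds htf,
      (hτ t ht).continuousAt (Metric.ball_mem_nhds _ hδ)] with t' h1 h2
    exact ⟨h2, hl t' h1⟩

/-- A curve of contact vectors in the kernel of `dα₀` is a reparametrised lift of a solution. -/
lemma exists_solution_of_contact_curve {W : Set (Jet n M k)} (hW : IsOpen W)
    {α α₀ : JForm n k M 1} (hPC : IsPoincareCartanOn W α α₀) {r r' : ℕ} (hr : HasOrderOn W α r)
    (hr' : r' + 1 ≤ k) (hα₀r : HasOrderOn W α₀ r') (u₁ : Jet n M k) {σ : ℝ → JetModel n k}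
    {J : Set ℝ} (hJ : IsOpen J) (hσ : ∀ t ∈ J, ContDiffAt ℝ ∞ σ t)
    (hσW : ∀ t ∈ J, σ t ∈ chartDomain u₁ W)
    (hσc : ∀ t ∈ J, contactForm (σ t) (deriv σ t) = 0)
    (hσd : ∀ t ∈ J, covD (α₀.cov u₁) (σ t) (deriv σ t) = 0)
    (hσ1 : ∀ t ∈ J, (deriv σ t).1 ≠ 0) {t : ℝ} (ht : t ∈ J) :
    ∃ (I : Set ℝ) (γ : ℝ → M), IsSolution W α r I γ ∧ (σ t).1 ∈ I ∧
      ∀ᶠ t' in 𝓝 t, (extChartAt 𝓘(ℝ, JetModel n k) u₁).symm (σ t') =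
        jetLift n k γ (σ t').1 := by
  set e := extChartAt 𝓘(ℝ, JetModel n k) u₁ with he
  set φ := chartAt (EuclideanSpace ℝ (Fin n)) u₁.point with hφ
  have hφm : φ ∈ IsManifold.maximalAtlas (𝓡 n) ∞ M := IsManifold.chart_mem_maximalAtlas u₁.point
  have hσd' : ∀ t ∈ J, HasDerivAt σ (deriv σ t) t := fun t ht =>
    ((hσ t ht).differentiableAt (by simp)).hasDerivAt
  have hτd : ∀ t ∈ J, deriv (fun t => (σ t).1) t = (deriv σ t).1 := fun t ht => by
    have h1 : HasDerivAt (fun t => (σ t).1) (deriv σ t).1 t := (hσd' t ht).fst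
    exact h1.deriv
  -- The time coordinate has nonzero speed along `σ`, so it can serve as the new parameter.
  obtain ⟨g, I, hI, hIc, htI, hg, hgev⟩ := exists_local_inverse (τ := fun t => (σ t).1) hJ ht
    (fun t ht => contDiff_fst.contDiffAt.comp t (hσ t ht))
    (fun t ht => by rw [hτd t ht]; exact hσ1 t ht)
  have hρd : ∀ x ∈ I, HasDerivAt (fun x => σ (g x))
      (((deriv σ (g x)).1)⁻¹ • deriv σ (g x)) x := fun x hx => by
    have h1 := (hg x hx).2.2.2
    rw [hτd _ (hg x hx).1] at h1
    exact (hσd' _ (hg x hx).1).scomp x h1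
  -- With time as parameter, the contact equations say that the component of order `a + 1` is the
  -- derivative of that of order `a`. By induction the curve is the lift of its component of order
  -- `0`.
  have hit : ∀ (a : ℕ) (ha : a < k + 1), ∀ x ∈ I,
      iteratedDeriv a (fun x => (σ (g x)).2 0) x = (σ (g x)).2 ⟨a, ha⟩ := by
    intro a
    induction a with
    | zero =>
      intro ha x _
      rw [iteratedDeriv_zero]
      rfl
    | succ a ih =>
      intro ha x hx
      have ha' : a < k + 1 := by omega
      have hev : iteratedDeriv a (fun x => (σ (g x)).2 0) =ᶠ[𝓝 x]
          fun x => (σ (g x)).2 ⟨a, ha'⟩ := by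
        filter_upwards [hI.mem_nhds hx] with x' hx' using ih ha' x' hx'
      rw [iteratedDeriv_succ, hev.deriv_eq]
      have h1 : HasDerivAt (fun x => (σ (g x)).2 ⟨a, ha'⟩) _ x :=
        hasDerivAt_pi.1 (hρd x hx).snd ⟨a, ha'⟩
      rw [h1.deriv]
      have hak : a < k := by omega
      have h2 := congrFun (hσc _ (hg x hx).1) ⟨a, hak⟩
      rw [contactForm_apply] at h2
      have h3 : (deriv σ (g x)).2 ⟨a, ha'⟩ = (deriv σ (g x)).1 • (σ (g x)).2 ⟨a + 1, ha⟩ :=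
        sub_eq_zero.1 h2
      show ((deriv σ (g x)).1)⁻¹ • (deriv σ (g x)).2 ⟨a, ha'⟩ = _
      rw [h3, smul_smul, inv_mul_cancel₀ (hσ1 _ (hg x hx).1), one_smul]
  set y : ℝ → EuclideanSpace ℝ (Fin n) := fun x => (σ (g x)).2 0 with hy
  have hyt : ∀ x ∈ I, y x ∈ φ.target := fun x hx => by
    have h1 := (hσW _ (hg x hx).1).1
    rw [jetChartAt_target] at h1
    exact h1
  have hys : ∀ x ∈ I, ContDiffAt ℝ ∞ y x := fun x hx => by
    have h1 : ContDiffAt ℝ ∞ (fun x => σ (g x)) x :=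
      (hσ _ (hg x hx).1).comp x (hg x hx).2.2.1
    have h2 : ContDiff ℝ ∞ fun z : JetModel n k => z.2 0 := by fun_prop
    exact h2.contDiffAt.comp x h1
  have hγs : ∀ x ∈ I, ContMDiffAt 𝓘(ℝ, ℝ) (𝓡 n) ∞ (φ.symm ∘ y) x := fun x hx =>
    (contMDiffAt_symm_of_mem_maximalAtlas hφm (hyt x hx)).comp x (hys x hx).contMDiffAt
  have hγn : ∀ x ∈ I, SmoothCurveNear n (φ.symm ∘ y) x := fun x hx => by
    filter_upwards [hI.mem_nhds hx] with x' hx' using hγs x' hx'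
  have hsrc : ∀ x ∈ I, (φ.symm ∘ y) x ∈ φ.source := fun x hx => φ.map_target (hyt x hx)
  have hcoord : ∀ x ∈ I, e (jetLift n k (φ.symm ∘ y) x) = σ (g x) := fun x hx => by
    have h1 := jetChartAt_jetLift (k := k) u₁ (hγs x hx) (hsrc x hx)
    refine h1.trans (Prod.ext (hg x hx).2.1.symm (funext fun a => ?_))
    have h2 : φ ∘ (φ.symm ∘ y) =ᶠ[𝓝 x] y := by
      filter_upwards [hI.mem_nhds hx] with x' hx' using φ.right_inv (hyt x' hx')
    exact (h2.iteratedDeriv_eq a).trans (hit a a.2 x hx)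
  have hmem : ∀ x ∈ I, jetLift n k (φ.symm ∘ y) x ∈ e.source := fun x hx =>
    (jetLift_mem_source u₁).2 (hsrc x hx)
  have hlift : ∀ x ∈ I, jetLift n k (φ.symm ∘ y) x = e.symm (σ (g x)) := fun x hx => by
    rw [← hcoord x hx, e.left_inv (hmem x hx)]
  have hliftW : ∀ x ∈ I, jetLift n k (φ.symm ∘ y) x ∈ W := fun x hx => by
    rw [hlift x hx]
    exact (hσW _ (hg x hx).1).2
  refine ⟨I, φ.symm ∘ y, isSolution_of_isCritical hW hPC hr hr' hα₀r hI hIc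
    (fun x hx => (hγs x hx).contMDiffWithinAt) hliftW ?_, htI, ?_⟩
  -- The velocity of the new lift is a multiple of that of `σ`, so it remains in the kernel of `d
  -- α₀`.
  · intro x hx w
    rw [PForm.d_apply hPC.1 (hliftW x hx) (hmem x hx), ← deriv_coord_jetLift u₁ (hγn x hx)
      (hsrc x hx)]
    have h1 : deriv (fun s => extChartAt 𝓘(ℝ, JetModel n k) u₁ (jetLift n k (φ.symm ∘ y) s)) x =
        ((deriv σ (g x)).1)⁻¹ • deriv σ (g x) := by
      refine ((hρd x hx).congr_of_eventuallyEq ?_).deriv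
      filter_upwards [hI.mem_nhds hx] with x' hx' using hcoord x' hx'
    have h2 : extChartAt 𝓘(ℝ, JetModel n k) u₁ (jetLift n k (φ.symm ∘ y) x) = σ (g x) := hcoord x hx
    rw [h1, h2, map_smul, covD_neg_swap, hσd _ (hg x hx).1]
    simp
  · filter_upwards [hgev] with t' ht'
    rw [hlift _ ht'.1, ht'.2]

end Reparametrisation

/-! ### Symmetries transport solutions and constants of motion. -/

section FlowOfSolutions

variable {n k : ℕ} {M : Type*} [TopologicalSpace M] [ChartedSpace (EuclideanSpace ℝ (Fin n)) M]
  [IsManifold (𝓡 n) ∞ M]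

lemma IsCritical.covD_eq_zero {W : Set (Jet n M k)} {α₀ : JForm n k M 1} (hα₀ : α₀.SmoothOn W)
    {γ : ℝ → M} {t : ℝ} (hcrit : IsCritical α₀ γ t) (hγ : SmoothCurveNear n γ t)
    (hW : jetLift n k γ t ∈ W) (u₁ : Jet n M k)
    (hs : γ t ∈ (chartAt (EuclideanSpace ℝ (Fin n)) u₁.point).source) :
    covD (α₀.cov u₁) (extChartAt 𝓘(ℝ, JetModel n k) u₁ (jetLift n k γ t))
      (deriv (fun s => extChartAt 𝓘(ℝ, JetModel n k) u₁ (jetLift n k γ s)) t) = 0 := by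
  have hsrc := (jetLift_mem_source (k := k) u₁).2 hs
  refine ContinuousLinearMap.ext fun w => ?_
  have h1 := hcrit (chartDsymm u₁ (extChartAt 𝓘(ℝ, JetModel n k) u₁ (jetLift n k γ t)) w)
  rw [PForm.d_apply hα₀ hW hsrc, chartD_chartDsymm' hsrc, ← deriv_coord_jetLift u₁ hγ hs] at h1
  rw [covD_neg_swap, h1]
  simp

/-- The local flow of an `α₀`-symmetry maps solutions to solutions. -/
lemma exists_flow_of_solutions {W : Set (Jet n M k)} (hW : IsOpen W)
    {α α₀ : JForm n k M 1} (hPC : IsPoincareCartanOn W α α₀) {r r' : ℕ} (hr : HasOrderOn W α r)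
    (hr' : r' + 1 ≤ k) (hα₀r : HasOrderOn W α₀ r') {U : Set (Jet n M k)} (hU : IsOpen U)
    (hUW : U ⊆ W) {X : JField n k M} (hX : ∀ u ∈ U, X.SmoothAt u) (hD : IsDSymmetryOn U X)
    (hL : ∀ u ∈ U, PForm.lieDeriv X α₀ u = 0) {I : Set ℝ} {γ : ℝ → M}
    (hsol : IsSolution W α r I γ) {t₁ : ℝ} (ht₁ : t₁ ∈ I) (ht₁U : jetLift n k γ t₁ ∈ U) :
    ∃ (δ : ℝ) (Γ : ℝ → ℝ → JetModel n k), 0 < δ ∧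
      (∀ t ∈ Ioo (t₁ - δ) (t₁ + δ), t ∈ I ∧ jetLift n k γ t ∈ U ∧ jetLift n k γ t ∈
        (extChartAt 𝓘(ℝ, JetModel n k) (jetLift n k γ t₁)).source ∧
        Γ t 0 = extChartAt 𝓘(ℝ, JetModel n k) (jetLift n k γ t₁) (jetLift n k γ t) ∧
        HasDerivAt (Γ t) (X.inChart (jetLift n k γ t₁) (Γ t 0)) 0) ∧
      (∀ t ∈ Ioo (t₁ - δ) (t₁ + δ), ∀ s ∈ Ioo (-δ) δ,
        Γ t s ∈ chartDomain (jetLift n k γ t₁) U ∧ DifferentiableAt ℝ (fun t => Γ t s) t ∧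
        ∃ (I' : Set ℝ) (γ' : ℝ → M), IsSolution W α r I' γ' ∧ (Γ t s).1 ∈ I' ∧
          ∀ᶠ t' in 𝓝 t, (extChartAt 𝓘(ℝ, JetModel n k) (jetLift n k γ t₁)).symm (Γ t' s) =
            jetLift n k γ' (Γ t' s).1) := by
  have hcrit : ∀ t ∈ I, IsCritical α₀ γ t := fun t ht => hsol.isCritical hW hPC hr hr' hα₀r ht
  obtain ⟨hI, -, hγ, hγW, -⟩ := hsol
  set u₁ := jetLift n k γ t₁ with hu₁
  have hpt : u₁.point = γ t₁ := jetLift_point _ _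
  set e := extChartAt 𝓘(ℝ, JetModel n k) u₁ with he
  set φ := chartAt (EuclideanSpace ℝ (Fin n)) u₁.point with hφ
  have hJ : IsOpen (I ∩ γ ⁻¹' φ.source) := hγ.continuousOn.isOpen_inter_preimage hI φ.open_source
  have ht₁J : t₁ ∈ I ∩ γ ⁻¹' φ.source := by
    refine ⟨ht₁, ?_⟩
    rw [mem_preimage, hφ, hpt]
    exact mem_chart_source _ _
  have hγn : ∀ t ∈ I ∩ γ ⁻¹' φ.source, SmoothCurveNear n γ t := fun t ht => by
    filter_upwards [hI.mem_nhds ht.1] with s hs' using hγ.contMDiffAt (hI.mem_nhds hs')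
  have hsrc : ∀ t ∈ I ∩ γ ⁻¹' φ.source, jetLift n k γ t ∈ e.source := fun t ht =>
    (jetLift_mem_source u₁).2 ht.2
  obtain ⟨c, hc⟩ : ∃ c : ℝ → JetModel n k, c = fun t => e (jetLift n k γ t) := ⟨_, rfl⟩
  have hct : ∀ t, c t = e (jetLift n k γ t) := fun t => by rw [hc]
  have hcs : ∀ t ∈ I ∩ γ ⁻¹' φ.source, ContDiffAt ℝ ∞ c t := fun t ht => by
    rw [hc]
    exact contDiffAt_chart_comp_map (contMDiffAt_jetLift (hγn t ht)) (hsrc t ht)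
  have hO : IsOpen (chartDomain (H := JetModel n k) u₁ U) := isOpen_chartDomain u₁ hU
  have hξ : ∀ z ∈ chartDomain u₁ U, ContDiffAt ℝ ∞ (X.inChart u₁) z := fun z hz =>
    VField.SmoothAt.inChart hz.1 (hX _ hz.2)
  have hϑ : ∀ z ∈ chartDomain u₁ U, ContDiffAt ℝ ∞ (α₀.cov u₁) z := fun z hz =>
    hPC.1.cov hz.1 (hUW hz.2)
  have hx₀ : c t₁ ∈ chartDomain u₁ U := by
    rw [hct]
    exact mem_chartDomain (hsrc t₁ ht₁J) ht₁U
  obtain ⟨ε, hε, V, hV, hxV, Φ, hΦ0, hΦ, hΦs, hΦv, hΦc, hΦd⟩ :=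
    exists_local_flow hO (fun z hz => (hξ z hz).contDiffWithinAt) hx₀
  have hdc : ContinuousAt (deriv c) t₁ :=
    (((hcs t₁ ht₁J).fderiv_right (m := ∞) (by simp)).clm_apply
      (contDiffAt_const (c := (1 : ℝ)))).continuousAt
  have hderiv0 : ∀ x w : JetModel n k, fderiv ℝ (fun x => Φ x 0) x w = w := fun x w => by
    have : (fun x => Φ x 0) = id := funext hΦ0
    rw [this, fderiv_id]
    rfl
  -- The time component of the transported velocity is continuous in `(t, s)` and equals `1` at
  -- `(t₁, 0)`. It stays nonzero nearby, which is what permits the reparametrisation.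
  have hm : ContinuousAt (fun p : ℝ × ℝ =>
      (fderiv ℝ (fun x => Φ x p.2) (c p.1) (deriv c p.1)).1) (t₁, 0) := by
    have hc1 : ContinuousAt (fun p : ℝ × ℝ => c p.1) (t₁, 0) :=
      (hcs t₁ ht₁J).continuousAt.comp_of_eq (f := Prod.fst) (by fun_prop) rfl
    have hc2 : ContinuousAt (fun p : ℝ × ℝ => deriv c p.1) (t₁, 0) :=
      hdc.comp_of_eq (f := Prod.fst) (by fun_prop) rfl
    have hc3 : ContinuousAt (fun p : ℝ × ℝ => fderiv ℝ (fun x => Φ x p.2) (c p.1)) (t₁, 0) :=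
      hΦd.continuousAt.comp (f := fun p : ℝ × ℝ => (c p.1, p.2))
        (hc1.prodMk (by fun_prop))
    exact continuousAt_fst.comp (hc3.clm_apply hc2)
  have hm0 : (fderiv ℝ (fun x => Φ x (0 : ℝ)) (c t₁) (deriv c t₁)).1 ≠ 0 := by
    rw [hderiv0, hc, deriv_coord_jetLift u₁ (hγn t₁ ht₁J) ht₁J.2,
      chartD_jetVelocity u₁ (hγn t₁ ht₁J) ht₁J.2]
    exact one_ne_zero
  have hev : ∀ᶠ p : ℝ × ℝ in 𝓝 (t₁, 0), (p.1 ∈ I ∩ γ ⁻¹' φ.source ∧ c p.1 ∈ V ∧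
      c p.1 ∈ chartDomain u₁ U) ∧
      p.2 ∈ Ioo (-ε) ε ∧ (fderiv ℝ (fun x => Φ x p.2) (c p.1) (deriv c p.1)).1 ≠ 0 := by
    have h1 : ∀ᶠ t in 𝓝 t₁, t ∈ I ∩ γ ⁻¹' φ.source ∧ c t ∈ V ∧ c t ∈ chartDomain u₁ U :=
      (eventually_mem_set.2 (hJ.mem_nhds ht₁J)).and
        (((hcs t₁ ht₁J).continuousAt.eventually (hV.mem_nhds hxV)).and
          ((hcs t₁ ht₁J).continuousAt.eventually (hO.mem_nhds hx₀)))
    have h2 : ∀ᶠ s in 𝓝 (0 : ℝ), s ∈ Ioo (-ε) ε := Ioo_mem_nhds (by linarith) hε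
    exact ((continuousAt_fst (p := ((t₁, 0) : ℝ × ℝ))).eventually h1).and
      (((continuousAt_snd (p := ((t₁, 0) : ℝ × ℝ))).eventually h2).and (hm.eventually_ne hm0))
  -- The maximum metric turns the ball into a product of intervals, so one `δ` serves both the time
  -- and the flow parameter.
  obtain ⟨δ, hδ, hbox⟩ := Metric.eventually_nhds_iff_ball.1 hev
  rw [← ball_prod_same] at hbox
  have hbox' : ∀ t ∈ Ioo (t₁ - δ) (t₁ + δ), ∀ s ∈ Ioo (-δ) δ,
      (t ∈ I ∩ γ ⁻¹' φ.source ∧ c t ∈ V ∧ c t ∈ chartDomain u₁ U) ∧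
      s ∈ Ioo (-ε) ε ∧ (fderiv ℝ (fun x => Φ x s) (c t) (deriv c t)).1 ≠ 0 := by
    intro t ht s hs
    refine hbox (t, s) ⟨?_, ?_⟩
    · rw [Real.ball_eq_Ioo]
      exact ht
    · rw [Real.ball_eq_Ioo, zero_sub, zero_add]
      exact hs
  have h0δ : (0 : ℝ) ∈ Ioo (-δ) δ := ⟨by linarith, hδ⟩
  have h0ε : (0 : ℝ) ∈ Ioo (-ε) ε := ⟨by linarith, hε⟩
  have hcd : ∀ t ∈ I ∩ γ ⁻¹' φ.source, HasDerivAt c (deriv c t) t := fun t ht =>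
    ((hcs t ht).differentiableAt (by simp)).hasDerivAt
  have hσd : ∀ t ∈ I ∩ γ ⁻¹' φ.source, ∀ s, HasDerivAt (fun t => Φ (c t) s)
      (fderiv ℝ (fun x => Φ x s) (c t) (deriv c t)) t := fun t ht s =>
    (((hΦs s).differentiable (by simp) (c t)).hasFDerivAt).comp_hasDerivAt t (hcd t ht)
  refine ⟨δ, fun t s => Φ (c t) s, hδ, fun t ht => ?_, fun t ht s hs => ?_⟩
  · have h1 := (hbox' t ht 0 h0δ).1
    have h2 := (hΦ (c t) h1.2.1 0 h0ε).2
    have h3 : e.symm (c t) = jetLift n k γ t := by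
      rw [hct]
      exact e.left_inv (hsrc t h1.1)
    refine ⟨h1.1.1, ?_, hsrc t h1.1, (hΦ0 _).trans (hct t), h2⟩
    have h4 := h1.2.2.2
    rw [mem_preimage, h3] at h4
    exact h4
  · refine ⟨(hΦ (c t) (hbox' t ht s hs).1.2.1 s (hbox' t ht s hs).2.1).1,
      (hσd t (hbox' t ht s hs).1.1 s).differentiableAt, ?_⟩
    refine exists_solution_of_contact_curve hW hPC hr hr' hα₀r u₁ (σ := fun t => Φ (c t) s)
      (J := Ioo (t₁ - δ) (t₁ + δ)) isOpen_Ioo (fun t ht => ?_) (fun t ht => ?_) (fun t ht => ?_)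
      (fun t ht => ?_) (fun t ht => ?_) ht
    · exact (hΦs s).contDiffAt.comp t (hcs t (hbox' t ht s hs).1.1)
    · have h1 := (hΦ (c t) (hbox' t ht s hs).1.2.1 s (hbox' t ht s hs).2.1).1
      exact ⟨h1.1, hUW h1.2⟩
    · have hb := hbox' t ht s hs
      rw [(hσd t hb.1.1 s).deriv]
      -- The tangent vector of the flowed curve is the derivative of the flow applied to the
      -- original velocity. As a function of `s` it solves the variational equation.
      refine (hD.isContactField hU hX u₁).flow_eq_zero hξ (c := Φ (c t))
        (v := fun s => fderiv ℝ (fun x => Φ x s) (c t) (deriv c t))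
        (fun s hs => (hΦ (c t) hb.1.2.1 s hs).1) (fun s hs => (hΦ (c t) hb.1.2.1 s hs).2)
        (fun s hs => hΦv (c t) hb.1.2.1 (deriv c t) s hs) ?_ s hb.2.1
      simp only [hderiv0]
      rw [hΦ0]
      have h1 := contactForm_jetVelocity (k := k) u₁ (hγn t hb.1.1) hb.1.1.2
      rw [← deriv_coord_jetLift u₁ (hγn t hb.1.1) hb.1.1.2] at h1
      rw [hc]
      exact h1
    · have hb := hbox' t ht s hs
      rw [(hσd t hb.1.1 s).deriv]
      refine covD_flow_eq_zero hO hξ hϑ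
        (fun z hz => covLie_eq_zero_of_lieDeriv hUW hPC.1 hX hL u₁ hz) (c := Φ (c t))
        (v := fun s => fderiv ℝ (fun x => Φ x s) (c t) (deriv c t))
        (fun s hs => (hΦ (c t) hb.1.2.1 s hs).1) (fun s hs => (hΦ (c t) hb.1.2.1 s hs).2)
        (fun s hs => hΦv (c t) hb.1.2.1 (deriv c t) s hs) ?_ s hb.2.1
      simp only [hderiv0]
      rw [hΦ0]
      rw [hc]
      exact (hcrit t hb.1.1.1).covD_eq_zero hPC.1 (hγn t hb.1.1) (hγW t hb.1.1.1) u₁ hb.1.1.2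
    · have hb := hbox' t ht s hs
      rw [(hσd t hb.1.1 s).deriv]
      exact hb.2.2

lemma ContMDiffOn.differentiableAt_chart_symm {U : Set (Jet n M k)} (hU : IsOpen U)
    {f : Jet n M k → ℝ} (hf : ContMDiffOn 𝓘(ℝ, JetModel n k) 𝓘(ℝ, ℝ) ∞ f U) (u₁ : Jet n M k)
    {z : JetModel n k} (hz : z ∈ chartDomain u₁ U) :
    DifferentiableAt ℝ (f ∘ (extChartAt 𝓘(ℝ, JetModel n k) u₁).symm) z := by
  have h1 : ContMDiffAt 𝓘(ℝ, JetModel n k) 𝓘(ℝ, ℝ) ∞ f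
      ((extChartAt 𝓘(ℝ, JetModel n k) u₁).symm z) := hf.contMDiffAt (hU.mem_nhds hz.2)
  exact (h1.comp z (contMDiffAt_chart_symm hz.1)).contDiffAt.differentiableAt (by simp)

/-- The derivative at `s = 0` of a function along the flow. -/
lemma hasDerivAt_flow_apply {U : Set (Jet n M k)} (hU : IsOpen U) {f : Jet n M k → ℝ}
    (hf : ContMDiffOn 𝓘(ℝ, JetModel n k) 𝓘(ℝ, ℝ) ∞ f U) (X : JField n k M) (u₁ u : Jet n M k)
    (huU : u ∈ U) (hu : u ∈ (extChartAt 𝓘(ℝ, JetModel n k) u₁).source) {c : ℝ → JetModel n k}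
    (hc0 : c 0 = extChartAt 𝓘(ℝ, JetModel n k) u₁ u)
    (hc : HasDerivAt c (X.inChart u₁ (c 0)) 0) :
    HasDerivAt (fun s => f ((extChartAt 𝓘(ℝ, JetModel n k) u₁).symm (c s))) (X.apply f u) 0 := by
  rw [X.apply_eq_fderiv hu ((hf.contMDiffAt (hU.mem_nhds huU)).mdifferentiableAt (by simp)), ← hc0]
  have h1 := ContMDiffOn.differentiableAt_chart_symm hU hf u₁ (mem_chartDomain hu huU)
  rw [← hc0] at h1
  exact h1.hasFDerivAt.comp_hasDerivAt (0 : ℝ) hc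

/-- `X(f)` is constant along solutions if `f` is. -/
lemma hasDerivAt_apply_of_constant {W : Set (Jet n M k)} (hW : IsOpen W)
    {α α₀ : JForm n k M 1} (hPC : IsPoincareCartanOn W α α₀) {r r' : ℕ} (hr : HasOrderOn W α r)
    (hr' : r' + 1 ≤ k) (hα₀r : HasOrderOn W α₀ r') {U : Set (Jet n M k)} (hU : IsOpen U)
    (hUW : U ⊆ W) {X : JField n k M} (hX : ∀ u ∈ U, X.SmoothAt u) (hD : IsDSymmetryOn U X)
    (hL : ∀ u ∈ U, PForm.lieDeriv X α₀ u = 0) {f : Jet n M k → ℝ}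
    (hf : IsConstantOfMotionOn W α r U f) {I : Set ℝ} {γ : ℝ → M}
    (hsol : IsSolution W α r I γ) {t₁ : ℝ} (ht₁ : t₁ ∈ I) (ht₁U : jetLift n k γ t₁ ∈ U) :
    HasDerivAt (fun t => X.apply f (jetLift n k γ t)) 0 t₁ := by
  obtain ⟨δ, Γ, hδ, hΓ0, hΓ⟩ :=
    exists_flow_of_solutions hW hPC hr hr' hα₀r hU hUW hX hD hL hsol ht₁ ht₁U
  set u₁ := jetLift n k γ t₁ with hu₁
  set e := extChartAt 𝓘(ℝ, JetModel n k) u₁ with he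
  have hmem : t₁ ∈ Ioo (t₁ - δ) (t₁ + δ) := ⟨by linarith, by linarith⟩
  -- At a fixed flow time, the flowed curve is locally a reparametrised lift of a solution. The
  -- chain rule gives `f` derivative zero along it, hence `f` is constant on the interval.
  have hconst : ∀ s ∈ Ioo (-δ) δ, ∀ t ∈ Ioo (t₁ - δ) (t₁ + δ),
      f (e.symm (Γ t s)) = f (e.symm (Γ t₁ s)) := by
    intro s hs t ht
    have hder : ∀ t ∈ Ioo (t₁ - δ) (t₁ + δ), HasDerivAt (fun t => f (e.symm (Γ t s))) 0 t := by
      intro t ht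
      obtain ⟨hΓU, hΓd, I', γ', hsol', htI', hev⟩ := hΓ t ht s hs
      have h1 : jetLift n k γ' (Γ t s).1 ∈ U := by
        rw [← hev.self_of_nhds]
        exact hΓU.2
      have h2 := hf.2 I' γ' hsol' _ htI' h1
      have h3 : HasDerivAt (fun t => (Γ t s).1) (deriv (fun t => Γ t s) t).1 t :=
        hΓd.hasDerivAt.fst
      have h4 := h2.scomp t h3
      rw [smul_zero] at h4
      refine h4.congr_of_eventuallyEq ?_
      filter_upwards [hev] with t' ht'
      rw [ht']
      rfl
    exact (convex_Ioo (t₁ - δ) (t₁ + δ)).is_const_of_fderivWithin_eq_zero (𝕜 := ℝ)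
      (f := fun t => f (e.symm (Γ t s))) (fun t ht => (hder t ht).differentiableAt.differentiableWithinAt)
      (fun t ht => by
        rw [fderivWithin_of_isOpen isOpen_Ioo ht]
        exact (hder t ht).hasFDerivAt.fderiv.trans (by ext; simp)) ht hmem
  have hsder : ∀ t ∈ Ioo (t₁ - δ) (t₁ + δ), HasDerivAt (fun s => f (e.symm (Γ t s)))
      (X.apply f (jetLift n k γ t)) 0 := by
    intro t ht
    obtain ⟨-, h1, h2, h3, h4⟩ := hΓ0 t ht
    exact hasDerivAt_flow_apply hU hf.1 X u₁ _ h1 h2 h3 h4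
  have hX0 : ∀ t ∈ Ioo (t₁ - δ) (t₁ + δ), X.apply f (jetLift n k γ t) = X.apply f u₁ := by
    intro t ht
    -- The two functions of `s` agree near `0`, so their derivatives there, the values of `X(f)` at
    -- the two points of the lift, coincide.
    refine (hsder t ht).unique ((hsder t₁ hmem).congr_of_eventuallyEq ?_)
    filter_upwards [Ioo_mem_nhds (by linarith : -δ < 0) hδ] with s hs using hconst s hs t ht
  refine (hasDerivAt_const t₁ (X.apply f u₁)).congr_of_eventuallyEq ?_
  filter_upwards [Ioo_mem_nhds hmem.1 hmem.2] with t ht using hX0 t ht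

/-- `X(f)` vanishes at the points of solutions if `f` does. -/
lemma apply_eq_zero_of_vanishes {W : Set (Jet n M k)} (hW : IsOpen W)
    {α α₀ : JForm n k M 1} (hPC : IsPoincareCartanOn W α α₀) {r r' : ℕ} (hr : HasOrderOn W α r)
    (hr' : r' + 1 ≤ k) (hα₀r : HasOrderOn W α₀ r') {U : Set (Jet n M k)} (hU : IsOpen U)
    (hUW : U ⊆ W) {X : JField n k M} (hX : ∀ u ∈ U, X.SmoothAt u) (hD : IsDSymmetryOn U X)
    (hL : ∀ u ∈ U, PForm.lieDeriv X α₀ u = 0) {f : Jet n M k → ℝ}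
    (hf : ContMDiffOn 𝓘(ℝ, JetModel n k) 𝓘(ℝ, ℝ) ∞ f U)
    (hf0 : VanishesOnSolutions W α r U f) {I : Set ℝ} {γ : ℝ → M}
    (hsol : IsSolution W α r I γ) {t₁ : ℝ} (ht₁ : t₁ ∈ I) (ht₁U : jetLift n k γ t₁ ∈ U) :
    X.apply f (jetLift n k γ t₁) = 0 := by
  obtain ⟨δ, Γ, hδ, hΓ0, hΓ⟩ :=
    exists_flow_of_solutions hW hPC hr hr' hα₀r hU hUW hX hD hL hsol ht₁ ht₁U
  have hmem : t₁ ∈ Ioo (t₁ - δ) (t₁ + δ) := ⟨by linarith, by linarith⟩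
  obtain ⟨-, h1, h2, h3, h4⟩ := hΓ0 t₁ hmem
  refine (hasDerivAt_flow_apply hU hf X _ _ h1 h2 h3 h4).unique
    ((hasDerivAt_const (0 : ℝ) (0 : ℝ)).congr_of_eventuallyEq ?_)
  -- Each flowed point lies on the lift of another solution, where `f` vanishes.
  filter_upwards [Ioo_mem_nhds (by linarith : -δ < 0) hδ] with s hs
  obtain ⟨hΓU, -, I', γ', hsol', htI', hev⟩ := hΓ t₁ hmem s hs
  rw [hev.self_of_nhds]
  refine hf0 I' γ' hsol' _ htI' ?_
  rw [← hev.self_of_nhds]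
  exact hΓU.2

end FlowOfSolutions

/-! The action of vector fields on functions. -/

section Action

variable {H : Type*} [NormedAddCommGroup H] [NormedSpace ℝ H]
  {N : Type*} [TopologicalSpace N] [ChartedSpace H N] [IsManifold 𝓘(ℝ, H) ∞ N]

lemma eventually_apply_chart (X : VField H N) {f : N → ℝ} {u : N}
    (hf : ∀ᶠ w in 𝓝 u, ContMDiffAt 𝓘(ℝ, H) 𝓘(ℝ, ℝ) ∞ f w) :
    ∀ᶠ z in 𝓝 (extChartAt 𝓘(ℝ, H) u u), X.apply f ((extChartAt 𝓘(ℝ, H) u).symm z) =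
      fderiv ℝ (f ∘ (extChartAt 𝓘(ℝ, H) u).symm) z (X.inChart u z) := by
  have hz := mem_extChartAt_target (I := 𝓘(ℝ, H)) u
  have hc : Tendsto (extChartAt 𝓘(ℝ, H) u).symm (𝓝 (extChartAt 𝓘(ℝ, H) u u)) (𝓝 u) := by
    have := (contMDiffAt_chart_symm hz).continuousAt
    rwa [ContinuousAt, extChartAt_to_inv] at this
  filter_upwards [hc.eventually hf, (isOpen_chart_target u).mem_nhds hz] with z h1 h2
  have h3 := X.apply_eq_fderiv ((extChartAt 𝓘(ℝ, H) u).map_target h2)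
    (h1.mdifferentiableAt (by simp))
  rwa [(extChartAt 𝓘(ℝ, H) u).right_inv h2] at h3

lemma contDiffAt_comp_chart_symm {f : N → ℝ} {u : N} (hf : ContMDiffAt 𝓘(ℝ, H) 𝓘(ℝ, ℝ) ∞ f u) :
    ContDiffAt ℝ ∞ (f ∘ (extChartAt 𝓘(ℝ, H) u).symm) (extChartAt 𝓘(ℝ, H) u u) := by
  have hz := mem_extChartAt_target (I := 𝓘(ℝ, H)) u
  have h1 : ContMDiffAt 𝓘(ℝ, H) 𝓘(ℝ, ℝ) ∞ f
      ((extChartAt 𝓘(ℝ, H) u).symm (extChartAt 𝓘(ℝ, H) u u)) := by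
    rw [extChartAt_to_inv]
    exact hf
  exact (h1.comp _ (contMDiffAt_chart_symm hz)).contDiffAt

lemma VField.apply_congr {X X' : VField H N} {f f' : N → ℝ} {u : N} (hX : X u = X' u)
    (hf : f =ᶠ[𝓝 u] f') : X.apply f u = X'.apply f' u := by
  have h1 := hf.mfderiv_eq (I := 𝓘(ℝ, H)) (I' := 𝓘(ℝ, ℝ))
  have h2 : X.apply f u = (mfderiv 𝓘(ℝ, H) 𝓘(ℝ, ℝ) f u : H →L[ℝ] ℝ) (X u : H) := rfl
  have h3 : X'.apply f' u = (mfderiv 𝓘(ℝ, H) 𝓘(ℝ, ℝ) f' u : H →L[ℝ] ℝ) (X' u : H) := rfl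
  rw [h2, h3, hX]
  exact congrArg (fun A : H →L[ℝ] ℝ => A (X' u : H)) h1

lemma VField.add_apply_fun (X Y : VField H N) (f : N → ℝ) (u : N) :
    VField.apply (X + Y) f u = X.apply f u + Y.apply f u :=
  map_add (mfderiv 𝓘(ℝ, H) 𝓘(ℝ, ℝ) f u) (X u) (Y u)

lemma VField.smul_apply_fun (c : ℝ) (X : VField H N) (f : N → ℝ) (u : N) :
    VField.apply (c • X) f u = c * X.apply f u :=
  map_smul (mfderiv 𝓘(ℝ, H) 𝓘(ℝ, ℝ) f u) c (X u)

lemma VField.apply_add (X : VField H N) {f g : N → ℝ} {u : N}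
    (hf : MDifferentiableAt 𝓘(ℝ, H) 𝓘(ℝ, ℝ) f u) (hg : MDifferentiableAt 𝓘(ℝ, H) 𝓘(ℝ, ℝ) g u) :
    X.apply (f + g) u = X.apply f u + X.apply g u := by
  have h := mfderiv_add hf hg
  exact congrArg (fun A : H →L[ℝ] ℝ => A (X u : H)) h

lemma VField.apply_smul (X : VField H N) (c : ℝ) {f : N → ℝ} {u : N}
    (hf : MDifferentiableAt 𝓘(ℝ, H) 𝓘(ℝ, ℝ) f u) :
    X.apply (c • f) u = c * X.apply f u := by
  have h := const_smul_mfderiv hf c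
  exact congrArg (fun A : H →L[ℝ] ℝ => A (X u : H)) h

variable [CompleteSpace H]

lemma VField.SmoothAt.contMDiffAt_apply {X : VField H N} {f : N → ℝ} {u : N} (hX : X.SmoothAt u)
    (hf : ∀ᶠ w in 𝓝 u, ContMDiffAt 𝓘(ℝ, H) 𝓘(ℝ, ℝ) ∞ f w) :
    ContMDiffAt 𝓘(ℝ, H) 𝓘(ℝ, ℝ) ∞ (X.apply f) u := by
  have hz := mem_extChartAt_target (I := 𝓘(ℝ, H)) u
  have hs := mem_extChartAt_source (I := 𝓘(ℝ, H)) u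
  have h1 : ContDiffAt ℝ ∞ (fun z => fderiv ℝ (f ∘ (extChartAt 𝓘(ℝ, H) u).symm) z
      (X.inChart u z)) (extChartAt 𝓘(ℝ, H) u u) :=
    ((contDiffAt_comp_chart_symm hf.self_of_nhds).fderiv_right (by simp)).clm_apply
      (VField.SmoothAt.inChart hz (by rwa [extChartAt_to_inv]))
  refine (h1.contMDiffAt.comp u (contMDiffAt_chart hs)).congr_of_eventuallyEq ?_
  filter_upwards [(contMDiffAt_chart hs).continuousAt.eventually (eventually_apply_chart X hf),
    (isOpen_extChartAt_source (I := 𝓘(ℝ, H)) u).mem_nhds hs] with w hw hws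
  rw [(extChartAt 𝓘(ℝ, H) u).left_inv hws] at hw
  exact hw

/-- The bracket of vector fields acts as the commutator. -/
lemma VField.mlieBracket_apply_fun {X Y : VField H N} {f : N → ℝ} {u : N}
    (hX : X.SmoothAt u) (hY : Y.SmoothAt u)
    (hf : ∀ᶠ w in 𝓝 u, ContMDiffAt 𝓘(ℝ, H) 𝓘(ℝ, ℝ) ∞ f w) :
    VField.apply (VectorField.mlieBracket 𝓘(ℝ, H) X Y) f u =
      X.apply (Y.apply f) u - Y.apply (X.apply f) u := by
  have hz := mem_extChartAt_target (I := 𝓘(ℝ, H)) u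
  have hs := mem_extChartAt_source (I := 𝓘(ℝ, H)) u
  have hXc := VField.SmoothAt.inChart (X := X) hz (by rwa [extChartAt_to_inv])
  have hYc := VField.SmoothAt.inChart (X := Y) hz (by rwa [extChartAt_to_inv])
  have hF := contDiffAt_comp_chart_symm hf.self_of_nhds
  rw [VField.apply_eq_fderiv _ hs (hf.self_of_nhds.mdifferentiableAt (by simp)),
    VField.apply_eq_fderiv X hs ((hY.contMDiffAt_apply hf).mdifferentiableAt (by simp)),
    VField.apply_eq_fderiv Y hs ((hX.contMDiffAt_apply hf).mdifferentiableAt (by simp))]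
  have h1 := VField.inChart_apply_chart (VectorField.mlieBracket 𝓘(ℝ, H) X Y) hs
  rw [chartD_mlieBracket hs hX hY] at h1
  have e1 : (Y.apply f ∘ (extChartAt 𝓘(ℝ, H) u).symm) =ᶠ[𝓝 (extChartAt 𝓘(ℝ, H) u u)]
      fun z => fderiv ℝ (f ∘ (extChartAt 𝓘(ℝ, H) u).symm) z (Y.inChart u z) :=
    eventually_apply_chart Y hf
  have e2 : (X.apply f ∘ (extChartAt 𝓘(ℝ, H) u).symm) =ᶠ[𝓝 (extChartAt 𝓘(ℝ, H) u u)]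
      fun z => fderiv ℝ (f ∘ (extChartAt 𝓘(ℝ, H) u).symm) z (X.inChart u z) :=
    eventually_apply_chart X hf
  rw [h1, e1.fderiv_eq, e2.fderiv_eq]
  have d1 := ((hF.fderiv_right (m := ∞) (by simp)).differentiableAt (by simp)).hasFDerivAt
  have d2 := (hXc.differentiableAt (by simp)).hasFDerivAt
  have d3 := (hYc.differentiableAt (by simp)).hasFDerivAt
  rw [(d1.clm_apply d2).fderiv, (d1.clm_apply d3).fderiv, VectorField.lieBracket, map_sub]
  -- Symmetry of the second derivative of `f` removes the second-order terms of the commutator.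
  have hsym := fderiv_fderiv_comm hF (X.inChart u (extChartAt 𝓘(ℝ, H) u u))
    (Y.inChart u (extChartAt 𝓘(ℝ, H) u u))
  simp only [add_apply, ContinuousLinearMap.comp_apply, ContinuousLinearMap.flip_apply]
  rw [hsym]
  ring

end Action

/-! The Lie algebra of `α₀`-symmetries. -/

section Symmetries

variable {n k : ℕ} {M : Type*} [TopologicalSpace M] [ChartedSpace (EuclideanSpace ℝ (Fin n)) M]
  [IsManifold (𝓡 n) ∞ M]

lemma oneForm_ext {H : Type*} [NormedAddCommGroup H] [NormedSpace ℝ H]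
    {A B : H [⋀^Fin 1]→L[ℝ] ℝ} (h : ∀ w, A ![w] = B ![w]) : A = B := by
  ext v
  have hv : v = ![v 0] := by
    funext i
    fin_cases i
    rfl
  rw [hv]
  exact h _

lemma covLie_add_left {H : Type*} [NormedAddCommGroup H] [NormedSpace ℝ H] {ξ η : H → H}
    {ϑ : H → H →L[ℝ] ℝ} {z : H} (hξ : DifferentiableAt ℝ ξ z) (hη : DifferentiableAt ℝ η z) :
    covLie (ξ + η) ϑ z = covLie ξ ϑ z + covLie η ϑ z := by
  refine ContinuousLinearMap.ext fun w => ?_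
  rw [add_apply, covLie_apply, covLie_apply, covLie_apply, fderiv_add hξ hη]
  simp only [Pi.add_apply, map_add, add_apply]
  ring

lemma covLie_smul_left {H : Type*} [NormedAddCommGroup H] [NormedSpace ℝ H] (c : ℝ) {ξ : H → H}
    {ϑ : H → H →L[ℝ] ℝ} {z : H} (hξ : DifferentiableAt ℝ ξ z) :
    covLie (c • ξ) ϑ z = c • covLie ξ ϑ z := by
  refine ContinuousLinearMap.ext fun w => ?_
  rw [smul_apply, covLie_apply, covLie_apply, fderiv_const_smul hξ]
  simp only [Pi.smul_apply, map_smul, smul_apply, smul_eq_mul]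
  ring

section LieDeriv

variable {H : Type*} [NormedAddCommGroup H] [NormedSpace ℝ H] [CompleteSpace H]
  {N : Type*} [TopologicalSpace N] [ChartedSpace H N] [IsManifold 𝓘(ℝ, H) ∞ N]

lemma lieDeriv_add {θ : PForm H N 1} {U : Set N} (hθ : θ.SmoothOn U) {X Y : VField H N} {u : N}
    (hu : u ∈ U) (hX : X.SmoothAt u) (hY : Y.SmoothAt u) :
    PForm.lieDeriv (X + Y) θ u = PForm.lieDeriv X θ u + PForm.lieDeriv Y θ u := by
  have hz := mem_extChartAt_target (I := 𝓘(ℝ, H)) u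
  have hs := mem_extChartAt_source (I := 𝓘(ℝ, H)) u
  have hXY : VField.SmoothAt (X + Y) u := ContMDiffAt.add_section hX hY
  refine oneForm_ext fun w => ?_
  have h1 := PForm.lieDeriv_apply hθ hu hs hXY w
  have h2 := PForm.lieDeriv_apply hθ hu hs hX w
  have h3 := PForm.lieDeriv_apply hθ hu hs hY w
  have hXc := VField.SmoothAt.inChart (X := X) hz (by rwa [extChartAt_to_inv])
  have hYc := VField.SmoothAt.inChart (X := Y) hz (by rwa [extChartAt_to_inv])
  have h4 : VField.inChart (X + Y) u = X.inChart u + Y.inChart u :=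
    funext fun z => map_add (chartD (H := H) u _) _ _
  rw [h4, covLie_add_left (hXc.differentiableAt (by simp)) (hYc.differentiableAt (by simp))] at h1
  exact h1.trans (congrArg₂ (· + ·) h2.symm h3.symm)

lemma lieDeriv_smul {θ : PForm H N 1} {U : Set N} (hθ : θ.SmoothOn U) (c : ℝ) {X : VField H N}
    {u : N} (hu : u ∈ U) (hX : X.SmoothAt u) :
    PForm.lieDeriv (c • X) θ u = c • PForm.lieDeriv X θ u := by
  have hz := mem_extChartAt_target (I := 𝓘(ℝ, H)) u
  have hs := mem_extChartAt_source (I := 𝓘(ℝ, H)) u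
  have hcX : VField.SmoothAt (c • X) u := ContMDiffAt.const_smul_section hX
  refine oneForm_ext fun w => ?_
  have h1 := PForm.lieDeriv_apply hθ hu hs hcX w
  have h2 := PForm.lieDeriv_apply hθ hu hs hX w
  have hXc := VField.SmoothAt.inChart (X := X) hz (by rwa [extChartAt_to_inv])
  have h4 : VField.inChart (c • X) u = c • X.inChart u :=
    funext fun z => map_smul (chartD (H := H) u _) c _
  rw [h4, covLie_smul_left c (hXc.differentiableAt (by simp))] at h1
  exact h1.trans (congrArg (c • ·) h2.symm)

/-- The Lie derivative along a bracket in a chart. -/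
lemma lieDeriv_mlieBracket_apply {θ : PForm H N 1} {U : Set N} (hθ : θ.SmoothOn U)
    {X Y : VField H N} {u : N} (hu : u ∈ U) (hX : ∀ᶠ w in 𝓝 u, X.SmoothAt w)
    (hY : ∀ᶠ w in 𝓝 u, Y.SmoothAt w) (w : H) :
    PForm.lieDeriv (VectorField.mlieBracket 𝓘(ℝ, H) X Y) θ u ![w] =
      covLie (X.inChart u) (covLie (Y.inChart u) (θ.cov u)) (extChartAt 𝓘(ℝ, H) u u)
        (chartD u u w) -
      covLie (Y.inChart u) (covLie (X.inChart u) (θ.cov u)) (extChartAt 𝓘(ℝ, H) u u)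
        (chartD u u w) := by
  have hz := mem_extChartAt_target (I := 𝓘(ℝ, H)) u
  have hs := mem_extChartAt_source (I := 𝓘(ℝ, H)) u
  have hXc := VField.SmoothAt.inChart (X := X) hz
    (by rw [extChartAt_to_inv]; exact hX.self_of_nhds)
  have hYc := VField.SmoothAt.inChart (X := Y) hz
    (by rw [extChartAt_to_inv]; exact hY.self_of_nhds)
  have hϑ : ContDiffAt ℝ ∞ (θ.cov u) (extChartAt 𝓘(ℝ, H) u u) :=
    hθ.cov hz (by rwa [extChartAt_to_inv])
  rw [PForm.lieDeriv_apply hθ hu hs (hX.self_of_nhds.lie hY.self_of_nhds)]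
  have hc : Tendsto (extChartAt 𝓘(ℝ, H) u).symm (𝓝 (extChartAt 𝓘(ℝ, H) u u)) (𝓝 u) := by
    have := (contMDiffAt_chart_symm hz).continuousAt
    rwa [ContinuousAt, extChartAt_to_inv] at this
  have hev : VField.inChart (VectorField.mlieBracket 𝓘(ℝ, H) X Y) u
      =ᶠ[𝓝 (extChartAt 𝓘(ℝ, H) u u)]
      VectorField.lieBracket ℝ (X.inChart u) (Y.inChart u) := by
    filter_upwards [hc.eventually hX, hc.eventually hY, (isOpen_chart_target u).mem_nhds hz]
      with z h1 h2 h3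
    have h4 := (extChartAt 𝓘(ℝ, H) u).map_target h3
    have h5 := VField.inChart_apply_chart (VectorField.mlieBracket 𝓘(ℝ, H) X Y) h4
    rw [chartD_mlieBracket h4 h1 h2, (extChartAt 𝓘(ℝ, H) u).right_inv h3] at h5
    exact h5
  rw [covLie_congr hev EventuallyEq.rfl, covLie_lieBracket hXc hYc hϑ]
  rfl

end LieDeriv

lemma IsDSymmetryOn.mono {U V : Set (Jet n M k)} {X : JField n k M} (h : IsDSymmetryOn U X)
    (hVU : V ⊆ U) : IsDSymmetryOn V X :=
  fun V' hV' hV'V => h V' hV' (hV'V.trans hVU)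

lemma IsInfSymmetryOn.mono {U V : Set (Jet n M k)} {α : JForm n k M 1} {X : JField n k M}
    (h : IsInfSymmetryOn U α X) (hVU : V ⊆ U) : IsInfSymmetryOn V α X :=
  ⟨fun u hu => h.1 u (hVU hu), h.2.1.mono hVU, fun u hu => h.2.2 u (hVU hu)⟩

lemma IsInfSymmetryOn.zero {U : Set (Jet n M k)} {α : JForm n k M 1} (hα : α.SmoothOn U) :
    IsInfSymmetryOn U α (0 : JField n k M) ∧
      ∀ α₀ : JForm n k M 1, α₀.SmoothOn U → ∀ u ∈ U, PForm.lieDeriv (0 : JField n k M) α₀ u = 0 := by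
  have hs : ∀ u : Jet n M k, VField.SmoothAt (0 : JField n k M) u := fun u =>
    (Bundle.contMDiff_zeroSection ℝ (TangentSpace 𝓘(ℝ, JetModel n k) : Jet n M k → Type _)) u
  have hL : ∀ α₀ : JForm n k M 1, α₀.SmoothOn U → ∀ u ∈ U,
      PForm.lieDeriv (0 : JField n k M) α₀ u = 0 := fun α₀ hα₀ u hu => by
    -- The zero field is `0` times itself, so homogeneity of the Lie derivative in the field
    -- suffices.
    have h1 := lieDeriv_smul hα₀ (0 : ℝ) hu (hs u)
    rwa [zero_smul, zero_smul] at h1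
  refine ⟨⟨fun u _ => hs u, fun V _ _ Y _ _ u _ => ?_, fun u hu v _ => ?_⟩, hL⟩
  · rw [VectorField.mlieBracket_zero_left]
    exact (holonomicDist u).zero_mem
  · rw [hL α hα u hu]
    rfl

lemma IsInfSymmetryOn.add {U : Set (Jet n M k)} {α : JForm n k M 1} (hα : α.SmoothOn U)
    {X Y : JField n k M} (hX : IsInfSymmetryOn U α X) (hY : IsInfSymmetryOn U α Y) :
    IsInfSymmetryOn U α (X + Y) := by
  refine ⟨fun u hu => ContMDiffAt.add_section (hX.1 u hu) (hY.1 u hu),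
    fun V hV hVU Z hZ hZD u hu => ?_, fun u hu v hv => ?_⟩
  · have h1 := VectorField.mlieBracket_add_left (I := 𝓘(ℝ, JetModel n k)) (W := Z)
      (hX.1 u (hVU hu)).mdiff (hY.1 u (hVU hu)).mdiff
    have h2 := (holonomicDist u).add_mem (hX.2.1 V hV hVU Z hZ hZD u hu)
      (hY.2.1 V hV hVU Z hZ hZD u hu)
    exact Eq.mpr (congrArg (· ∈ holonomicDist u) h1) h2
  · rw [lieDeriv_add hα hu (hX.1 u hu) (hY.1 u hu)]
    have h1 := hX.2.2 u hu v hv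
    have h2 := hY.2.2 u hu v hv
    have h3 : (PForm.lieDeriv X α u + PForm.lieDeriv Y α u).curryLeft v =
      (PForm.lieDeriv X α u).curryLeft v + (PForm.lieDeriv Y α u).curryLeft v := rfl
    rw [h3, h1, h2, add_zero]

lemma IsInfSymmetryOn.smul {U : Set (Jet n M k)} {α : JForm n k M 1} (hα : α.SmoothOn U) (c : ℝ)
    {X : JField n k M} (hX : IsInfSymmetryOn U α X) : IsInfSymmetryOn U α (c • X) := by
  refine ⟨fun u hu => ContMDiffAt.const_smul_section (hX.1 u hu),
    fun V hV hVU Z hZ hZD u hu => ?_, fun u hu v hv => ?_⟩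
  · have h1 := VectorField.mlieBracket_const_smul_left (I := 𝓘(ℝ, JetModel n k)) (W := Z) (c := c)
      (hX.1 u (hVU hu)).mdiff
    have h2 := (holonomicDist u).smul_mem c (hX.2.1 V hV hVU Z hZ hZD u hu)
    exact Eq.mpr (congrArg (· ∈ holonomicDist u) h1) h2
  · rw [lieDeriv_smul hα c hu (hX.1 u hu)]
    have h1 := hX.2.2 u hu v hv
    have h3 : (c • PForm.lieDeriv X α u).curryLeft v = c • (PForm.lieDeriv X α u).curryLeft v := rfl
    rw [h3, h1, smul_zero]

/-- By the Jacobi identity `[[X, Y], Z] = [X, [Y, Z]] - [Y, [X, Z]]`, where the inner brackets are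
again smooth holonomic fields. -/
lemma IsDSymmetryOn.lie {U : Set (Jet n M k)} {X Y : JField n k M}
    (hXs : ∀ u ∈ U, X.SmoothAt u) (hYs : ∀ u ∈ U, Y.SmoothAt u) (hX : IsDSymmetryOn U X)
    (hY : IsDSymmetryOn U Y) :
    IsDSymmetryOn U (VectorField.mlieBracket 𝓘(ℝ, JetModel n k) X Y) := by
  intro V hV hVU Z hZ hZD u hu
  have : IsManifold 𝓘(ℝ, JetModel n k) (minSmoothness ℝ 3) (Jet n M k) := by
    rw [minSmoothness_of_isRCLikeNormedField]
    exact IsManifold.of_le (n := ∞) ENat.LEInfty.out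
  have hle : minSmoothness ℝ 2 ≤ ∞ := by
    rw [minSmoothness_of_isRCLikeNormedField]
    exact ENat.LEInfty.out
  have h1 := VectorField.leibniz_identity_mlieBracket_apply (ContMDiffAt.of_le (hXs u (hVU hu)) hle)
      (ContMDiffAt.of_le (hYs u (hVU hu)) hle) (ContMDiffAt.of_le (hZ u hu) hle)
  have h2 := hX V hV hVU (VectorField.mlieBracket 𝓘(ℝ, JetModel n k) Y Z)
    (fun u hu => (hYs u (hVU hu)).lie (hZ u hu)) (hY V hV hVU Z hZ hZD) u hu
  have h3 := hY V hV hVU (VectorField.mlieBracket 𝓘(ℝ, JetModel n k) X Z)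
    (fun u hu => (hXs u (hVU hu)).lie (hZ u hu)) (hX V hV hVU Z hZ hZD) u hu
  have h4 := (holonomicDist u).sub_mem h2 h3
  exact Eq.mpr (congrArg (· ∈ holonomicDist u) (eq_sub_of_add_eq h1.symm)) h4

lemma HolonomicOn.covLie_contact {U W : Set (Jet n M k)} (hUW : U ⊆ W) {α : JForm n k M 1}
    (hα : α.SmoothOn W) {X : JField n k M} (hX : ∀ u ∈ U, X.SmoothAt u)
    (hL : HolonomicOn U (PForm.lieDeriv X α)) (u₁ : Jet n M k) {z : JetModel n k}
    (hz : z ∈ chartDomain u₁ U) {v : JetModel n k} (hv : contactForm z v = 0) :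
    covLie (X.inChart u₁) (α.cov u₁) z v = 0 := by
  have hu := (extChartAt 𝓘(ℝ, JetModel n k) u₁).map_target hz.1
  have hr := (extChartAt 𝓘(ℝ, JetModel n k) u₁).right_inv hz.1
  have h1 := PForm.lieDeriv_apply hα (hUW hz.2) hu (hX _ hz.2) (chartDsymm u₁ z v)
  rw [hr, chartD_chartDsymm hz.1] at h1
  rw [← h1]
  refine hL.apply_eq_zero hz.2 ((mem_holonomicDist_iff u₁ hu).2 ?_)
  rw [hr, chartD_chartDsymm hz.1, hv]

/-- The Lie derivative of `α` along the bracket is the commutator of the two Lie derivatives. The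
inner one is a holonomic form, and the outer field, being a contact field, keeps it holonomic. -/
lemma IsInfSymmetryOn.lie {U : Set (Jet n M k)} (hU : IsOpen U) {α : JForm n k M 1}
    (hα : α.SmoothOn U) {X Y : JField n k M} (hX : IsInfSymmetryOn U α X)
    (hY : IsInfSymmetryOn U α Y) :
    IsInfSymmetryOn U α (VectorField.mlieBracket 𝓘(ℝ, JetModel n k) X Y) := by
  refine ⟨fun u hu => (hX.1 u hu).lie (hY.1 u hu), hX.2.1.lie hX.1 hY.1 hY.2.1,
    fun u hu v hv => ?_⟩
  have hev : ∀ {Z : JField n k M}, (∀ u ∈ U, Z.SmoothAt u) → ∀ᶠ w in 𝓝 u, Z.SmoothAt w :=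
    fun {Z} hZ => by filter_upwards [hU.mem_nhds hu] with w hw using hZ w hw
  have hs := mem_extChartAt_source (I := 𝓘(ℝ, JetModel n k)) u
  have hm := mem_chartDomain hs hu
  have hO : IsOpen (chartDomain (H := JetModel n k) u U) := isOpen_chartDomain u hU
  have hcv := (mem_holonomicDist_iff u hs).1 hv
  have hkey : ∀ {Z Z' : JField n k M}, IsInfSymmetryOn U α Z → IsInfSymmetryOn U α Z' →
      covLie (Z.inChart u) (covLie (Z'.inChart u) (α.cov u))
        (extChartAt 𝓘(ℝ, JetModel n k) u u) (chartD u u v) = 0 := fun {Z Z'} hZ hZ' =>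
    (hZ.2.1.isContactField hU hZ.1 u).covLie_eq_zero hO
      (fun z hz w hw => hZ'.2.2.covLie_contact Subset.rfl hα hZ'.1 u hz hw) hm
      ((contDiffAt_covLie (VField.SmoothAt.inChart hm.1 (hZ'.1 _ hm.2))
        (hα.cov hm.1 hm.2)).differentiableAt (by simp)) hcv
  have h1 := lieDeriv_mlieBracket_apply hα hu (hev hX.1) (hev hY.1) v
  rw [hkey hX hY, hkey hY hX, sub_zero] at h1
  ext w
  have hw : w = ![] := Subsingleton.elim _ _
  rw [hw]
  exact h1

/-- In the commutator both inner Lie derivatives of `α₀` vanish on a neighbourhood, so the outer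
ones vanish too. -/
lemma lieDeriv_mlieBracket_eq_zero {U : Set (Jet n M k)} (hU : IsOpen U) {α₀ : JForm n k M 1}
    (hα₀ : α₀.SmoothOn U) {X Y : JField n k M} (hX : ∀ u ∈ U, X.SmoothAt u)
    (hY : ∀ u ∈ U, Y.SmoothAt u) (hLX : ∀ u ∈ U, PForm.lieDeriv X α₀ u = 0)
    (hLY : ∀ u ∈ U, PForm.lieDeriv Y α₀ u = 0) {u : Jet n M k} (hu : u ∈ U) :
    PForm.lieDeriv (VectorField.mlieBracket 𝓘(ℝ, JetModel n k) X Y) α₀ u = 0 := by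
  have hev : ∀ {Z : JField n k M}, (∀ u ∈ U, Z.SmoothAt u) → ∀ᶠ w in 𝓝 u, Z.SmoothAt w :=
    fun {Z} hZ => by filter_upwards [hU.mem_nhds hu] with w hw using hZ w hw
  have hs := mem_extChartAt_source (I := 𝓘(ℝ, JetModel n k)) u
  have hO : IsOpen (chartDomain (H := JetModel n k) u U) := isOpen_chartDomain u hU
  have hkey : ∀ {Z Z' : JField n k M}, (∀ u ∈ U, Z'.SmoothAt u) →
      (∀ u ∈ U, PForm.lieDeriv Z' α₀ u = 0) →
      covLie (Z.inChart u) (covLie (Z'.inChart u) (α₀.cov u))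
        (extChartAt 𝓘(ℝ, JetModel n k) u u) = 0 := fun {Z Z'} hZ' hL => by
    have h1 : covLie (Z'.inChart u) (α₀.cov u) =ᶠ[𝓝 (extChartAt 𝓘(ℝ, JetModel n k) u u)]
        fun _ => 0 := by
      filter_upwards [hO.mem_nhds (mem_chartDomain hs hu)] with z hz
      exact covLie_eq_zero_of_lieDeriv Subset.rfl hα₀ hZ' hL u hz
    rw [covLie_congr EventuallyEq.rfl h1]
    refine ContinuousLinearMap.ext fun w => ?_
    rw [covLie_apply]
    simp
  refine oneForm_ext fun w => ?_
  rw [lieDeriv_mlieBracket_apply hα₀ hu (hev hX) (hev hY) w, hkey hY hLY, hkey hX hLX]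
  simp

end Symmetries

/-! ### Germs of vector fields acting on germs of functions. -/

section GermAction

variable {H : Type*} [NormedAddCommGroup H] [NormedSpace ℝ H]
  {N : Type*} [TopologicalSpace N] [ChartedSpace H N] [IsManifold 𝓘(ℝ, H) ∞ N]

/-- The germ of `X(f)`, for germs at `u₀` of a vector field `X` and of a function `f`. -/
def VFGerm.apply {u₀ : N} (x : VFGerm H u₀) : (𝓝 u₀).Germ ℝ → (𝓝 u₀).Germ ℝ :=
  Quotient.liftOn' x (fun X => Germ.map' X.1.apply fun _ _ hf =>
    hf.eventuallyEq_nhds.mono fun _ hu => VField.apply_congr rfl hu) (by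
    intro X X' h
    have hX := VFGerm.mk_eq_mk.1 (Quotient.sound' h : VFGerm.mk X = VFGerm.mk X')
    funext g
    refine Germ.inductionOn g fun f => Germ.coe_eq.2 ?_
    filter_upwards [hX] with u hu using VField.apply_congr hu EventuallyEq.rfl)

lemma VFGerm.add_apply {u₀ : N} (x y : VFGerm H u₀) (g : (𝓝 u₀).Germ ℝ) :
    (x + y).apply g = x.apply g + y.apply g := by
  obtain ⟨X, rfl⟩ := VFGerm.mk_surjective x
  obtain ⟨Y, rfl⟩ := VFGerm.mk_surjective y
  refine Germ.inductionOn g fun f => Germ.coe_eq.2 (Eventually.of_forall fun u => ?_)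
  exact VField.add_apply_fun X.1 Y.1 f u

lemma VFGerm.smul_apply {u₀ : N} (c : ℝ) (x : VFGerm H u₀) (g : (𝓝 u₀).Germ ℝ) :
    (c • x).apply g = c • x.apply g := by
  obtain ⟨X, rfl⟩ := VFGerm.mk_surjective x
  refine Germ.inductionOn g fun f => Germ.coe_eq.2 (Eventually.of_forall fun u => ?_)
  exact VField.smul_apply_fun c X.1 f u

/-- Additivity in the function needs differentiable representatives, since `mfderiv` has the default
value `0` elsewhere. This is why the action becomes linear only on spaces such as `ConstMot`. -/
lemma VFGerm.apply_add {u₀ : N} (x : VFGerm H u₀) {f g : N → ℝ}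
    (hf : ∀ᶠ u in 𝓝 u₀, ContMDiffAt 𝓘(ℝ, H) 𝓘(ℝ, ℝ) ∞ f u)
    (hg : ∀ᶠ u in 𝓝 u₀, ContMDiffAt 𝓘(ℝ, H) 𝓘(ℝ, ℝ) ∞ g u) :
    x.apply (f + g : (𝓝 u₀).Germ ℝ) = x.apply (f : (𝓝 u₀).Germ ℝ) + x.apply (g : (𝓝 u₀).Germ ℝ) := by
  obtain ⟨X, rfl⟩ := VFGerm.mk_surjective x
  refine Germ.coe_eq.2 ?_
  filter_upwards [hf, hg] with u h1 h2
  exact VField.apply_add X.1 (h1.mdifferentiableAt (by simp)) (h2.mdifferentiableAt (by simp))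

lemma VFGerm.apply_smul {u₀ : N} (x : VFGerm H u₀) (c : ℝ) {f : N → ℝ}
    (hf : ∀ᶠ u in 𝓝 u₀, ContMDiffAt 𝓘(ℝ, H) 𝓘(ℝ, ℝ) ∞ f u) :
    x.apply (c • (f : (𝓝 u₀).Germ ℝ)) = c • x.apply (f : (𝓝 u₀).Germ ℝ) := by
  obtain ⟨X, rfl⟩ := VFGerm.mk_surjective x
  refine Germ.coe_eq.2 ?_
  filter_upwards [hf] with u h1
  exact VField.apply_smul X.1 c (h1.mdifferentiableAt (by simp))

lemma VFGerm.lie_apply [CompleteSpace H] {u₀ : N} (x y : VFGerm H u₀) {f : N → ℝ}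
    (hf : ∀ᶠ u in 𝓝 u₀, ContMDiffAt 𝓘(ℝ, H) 𝓘(ℝ, ℝ) ∞ f u) :
    ⁅x, y⁆.apply (f : (𝓝 u₀).Germ ℝ) =
      x.apply (y.apply (f : (𝓝 u₀).Germ ℝ)) - y.apply (x.apply (f : (𝓝 u₀).Germ ℝ)) := by
  obtain ⟨X, rfl⟩ := VFGerm.mk_surjective x
  obtain ⟨Y, rfl⟩ := VFGerm.mk_surjective y
  refine Germ.coe_eq.2 ?_
  filter_upwards [X.2, Y.2, hf.eventually_nhds] with u h1 h2 h3
  exact VField.mlieBracket_apply_fun h1 h2 h3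

end GermAction

/-! ### The Lie algebra of symmetries and its representation on constants of motion. -/

section Representation

variable {n k : ℕ} {M : Type*} [TopologicalSpace M] [ChartedSpace (EuclideanSpace ℝ (Fin n)) M]
  [IsManifold (𝓡 n) ∞ M]

/-- The germs of `α₀`-symmetries form a Lie algebra. -/
def alphaSymmetryAlgebra {W : Set (Jet n M k)} (hW : IsOpen W) {u₀ : Jet n M k} (hu₀ : u₀ ∈ W)
    {α α₀ : JForm n k M 1} (hα : α.SmoothOn W) (hα₀ : α₀.SmoothOn W) :
    LieSubalgebra ℝ (VFGerm (JetModel n k) u₀) where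
  carrier := alphaSymmetryGerms W α α₀ u₀
  zero_mem' := ⟨0, W, hW, hu₀, subset_rfl, (IsInfSymmetryOn.zero hα).1,
    (IsInfSymmetryOn.zero hα).2 α₀ hα₀, rfl⟩
  add_mem' := by
    rintro _ _ ⟨X, U, hU, hu, hUW, hX, hXL, rfl⟩ ⟨Y, V, hV, hv, hVW, hY, hYL, rfl⟩
    refine ⟨X + Y, U ∩ V, hU.inter hV, ⟨hu, hv⟩, inter_subset_left.trans hUW,
      IsInfSymmetryOn.add (fun w hw => hα w (hUW hw.1)) (hX.mono inter_subset_left)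
        (hY.mono inter_subset_right), fun w hw => ?_, rfl⟩
    have h := lieDeriv_add hα₀ (hUW hw.1) (hX.1 w hw.1) (hY.1 w hw.2)
    rw [hXL w hw.1, hYL w hw.2, add_zero] at h
    exact h
  smul_mem' := by
    rintro c _ ⟨X, U, hU, hu, hUW, hX, hXL, rfl⟩
    refine ⟨c • X, U, hU, hu, hUW, IsInfSymmetryOn.smul (fun w hw => hα w (hUW hw)) c hX,
      fun w hw => ?_, rfl⟩
    have h := lieDeriv_smul hα₀ c (hUW hw) (hX.1 w hw)
    rw [hXL w hw, smul_zero] at h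
    exact h
  lie_mem' := by
    rintro _ _ ⟨X, U, hU, hu, hUW, hX, hXL, rfl⟩ ⟨Y, V, hV, hv, hVW, hY, hYL, rfl⟩
    have hUV := hU.inter hV
    have hX' := hX.mono (inter_subset_left : U ∩ V ⊆ U)
    have hY' := hY.mono (inter_subset_right : U ∩ V ⊆ V)
    exact ⟨smoothNear.lie X Y, U ∩ V, hUV, ⟨hu, hv⟩, inter_subset_left.trans hUW,
      IsInfSymmetryOn.lie hUV (fun w hw => hα w (hUW hw.1)) hX' hY',
      fun w hw => lieDeriv_mlieBracket_eq_zero hUV (fun w hw => hα₀ w (hUW hw.1)) hX'.1 hY'.1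
        (fun w hw => hXL w hw.1) (fun w hw => hYL w hw.2) hw, rfl⟩

lemma ContMDiffOn.eventually_contMDiffAt {U : Set (Jet n M k)} (hU : IsOpen U)
    {f : Jet n M k → ℝ} (hf : ContMDiffOn 𝓘(ℝ, JetModel n k) 𝓘(ℝ, ℝ) ∞ f U) {u : Jet n M k}
    (hu : u ∈ U) : ∀ᶠ w in 𝓝 u, ContMDiffAt 𝓘(ℝ, JetModel n k) 𝓘(ℝ, ℝ) ∞ f w := by
  filter_upwards [hU.mem_nhds hu] with w hw using hf.contMDiffAt (hU.mem_nhds hw)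

lemma exists_eq_coe_of_mem_constMot {W : Set (Jet n M k)} {α : JForm n k M 1} {r : ℕ}
    {u₀ : Jet n M k} {g : (𝓝 u₀).Germ ℝ} (hg : g ∈ ConstMot W α r u₀) :
    ∃ f : Jet n M k → ℝ, (∀ᶠ u in 𝓝 u₀, ContMDiffAt 𝓘(ℝ, JetModel n k) 𝓘(ℝ, ℝ) ∞ f u) ∧
      g = (f : (𝓝 u₀).Germ ℝ) := by
  obtain ⟨f, U, hU, hu, hf, rfl⟩ := hg
  exact ⟨f, ContMDiffOn.eventually_contMDiffAt hU hf.1 hu, rfl⟩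

lemma IsConstantOfMotionOn.mono {W U V : Set (Jet n M k)} {α : JForm n k M 1} {r : ℕ}
    {f : Jet n M k → ℝ} (h : IsConstantOfMotionOn W α r U f) (hVU : V ⊆ U) :
    IsConstantOfMotionOn W α r V f :=
  ⟨h.1.mono hVU, fun I γ hγ t ht hV => h.2 I γ hγ t ht (hVU hV)⟩

lemma apply_mem_constMot {W : Set (Jet n M k)} (hW : IsOpen W) {u₀ : Jet n M k}
    {α α₀ : JForm n k M 1} (hPC : IsPoincareCartanOn W α α₀) {r r' : ℕ} (hr : HasOrderOn W α r)
    (hr' : r' + 1 ≤ k) (hα₀r : HasOrderOn W α₀ r') {x : VFGerm (JetModel n k) u₀}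
    (hx : x ∈ alphaSymmetryGerms W α α₀ u₀) {g : (𝓝 u₀).Germ ℝ} (hg : g ∈ ConstMot W α r u₀) :
    x.apply g ∈ ConstMot W α r u₀ := by
  obtain ⟨X, U, hU, hu, hUW, hX, hXL, rfl⟩ := hx
  obtain ⟨f, V, hV, hv, hf, rfl⟩ := hg
  have hUV := hU.inter hV
  have hX' := hX.mono (inter_subset_left : U ∩ V ⊆ U)
  have hf' := hf.mono (inter_subset_right : U ∩ V ⊆ V)
  refine ⟨X.1.apply f, U ∩ V, hUV, ⟨hu, hv⟩, ⟨fun w hw => ?_, fun I γ hγ t ht hUt => ?_⟩, rfl⟩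
  · exact ((hX'.1 w hw).contMDiffAt_apply
      (ContMDiffOn.eventually_contMDiffAt hUV hf'.1 hw)).contMDiffWithinAt
  · exact hasDerivAt_apply_of_constant hW hPC hr hr' hα₀r hUV (inter_subset_left.trans hUW) hX'.1
      hX'.2.1 (fun w hw => hXL w hw.1) hf' hγ ht hUt

lemma apply_mem_nullMot {W : Set (Jet n M k)} (hW : IsOpen W) {u₀ : Jet n M k}
    {α α₀ : JForm n k M 1} (hPC : IsPoincareCartanOn W α α₀) {r r' : ℕ} (hr : HasOrderOn W α r)
    (hr' : r' + 1 ≤ k) (hα₀r : HasOrderOn W α₀ r') {x : VFGerm (JetModel n k) u₀}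
    (hx : x ∈ alphaSymmetryGerms W α α₀ u₀) {g : ConstMot W α r u₀}
    (hg : g ∈ NullMot W α r u₀) :
    (⟨x.apply g.1, apply_mem_constMot hW hPC hr hr' hα₀r hx g.2⟩ : ConstMot W α r u₀) ∈
      NullMot W α r u₀ := by
  obtain ⟨X, U, hU, hu, hUW, hX, hXL, rfl⟩ := hx
  obtain ⟨f₀, V₀, hV₀, hv₀, hf₀, h₀⟩ := hg
  obtain ⟨f, V, hV, hv, hf, h⟩ := g.2
  -- The representative `f₀` that vanishes on solutions need not be smooth. On a smaller
  -- neighbourhood it agrees with the smooth representative `f`, to which the flow argument applies.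
  obtain ⟨O, hOf, hO, huO⟩ := eventually_nhds_iff.1 (Germ.coe_eq.1 (h.symm.trans h₀))
  have hopen : IsOpen (U ∩ V ∩ (V₀ ∩ O)) := (hU.inter hV).inter (hV₀.inter hO)
  have hX' := hX.mono (fun w hw => hw.1.1 : U ∩ V ∩ (V₀ ∩ O) ⊆ U)
  refine ⟨X.1.apply f, U ∩ V ∩ (V₀ ∩ O), hopen, ⟨⟨hu, hv⟩, hv₀, huO⟩,
    fun I γ hγ t ht hUt => ?_, congrArg (VFGerm.mk X).apply h⟩
  refine apply_eq_zero_of_vanishes hW hPC hr hr' hα₀r hopen (fun w hw => hUW hw.1.1) hX'.1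
    hX'.2.1 (fun w hw => hXL w hw.1.1) (hf.1.mono fun w hw => hw.1.2)
    (fun I γ hγ t ht hw => ?_) hγ ht hUt
  rw [hOf _ hw.2.2]
  exact hf₀ I γ hγ t ht hw.2.1

/-- The action of an `α₀`-symmetry on the germs of constants of motion. -/
def constMotAction {W : Set (Jet n M k)} (hW : IsOpen W) {u₀ : Jet n M k}
    {α α₀ : JForm n k M 1} (hPC : IsPoincareCartanOn W α α₀) {r r' : ℕ} (hr : HasOrderOn W α r)
    (hr' : r' + 1 ≤ k) (hα₀r : HasOrderOn W α₀ r') {x : VFGerm (JetModel n k) u₀}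
    (hx : x ∈ alphaSymmetryGerms W α α₀ u₀) : ConstMot W α r u₀ →ₗ[ℝ] ConstMot W α r u₀ where
  toFun g := ⟨x.apply g.1, apply_mem_constMot hW hPC hr hr' hα₀r hx g.2⟩
  map_add' := by
    rintro ⟨g, hg⟩ ⟨g', hg'⟩
    obtain ⟨f, hf, rfl⟩ := exists_eq_coe_of_mem_constMot hg
    obtain ⟨f', hf', rfl⟩ := exists_eq_coe_of_mem_constMot hg'
    exact Subtype.ext (x.apply_add hf hf')
  map_smul' := by
    rintro c ⟨g, hg⟩
    obtain ⟨f, hf, rfl⟩ := exists_eq_coe_of_mem_constMot hg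
    exact Subtype.ext (x.apply_smul c hf)

attribute [local instance] LieRing.ofAssociativeRing

/-- The representation of the Lie algebra of `α₀`-symmetries on the constants of motion modulo
those that vanish at the points of solutions. -/
def constMotRepresentation {W : Set (Jet n M k)} (hW : IsOpen W) {u₀ : Jet n M k} (hu₀ : u₀ ∈ W)
    {α α₀ : JForm n k M 1} (hα : α.SmoothOn W) (hPC : IsPoincareCartanOn W α α₀) {r r' : ℕ}
    (hr : HasOrderOn W α r) (hr' : r' + 1 ≤ k) (hα₀r : HasOrderOn W α₀ r') :
    alphaSymmetryAlgebra hW hu₀ hα hPC.1 →ₗ⁅ℝ⁆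
      Module.End ℝ (ConstMot W α r u₀ ⧸ NullMot W α r u₀) where
  toFun x := (NullMot W α r u₀).mapQ (NullMot W α r u₀)
    (constMotAction hW hPC hr hr' hα₀r x.2)
    fun _ hg => apply_mem_nullMot hW hPC hr hr' hα₀r x.2 hg
  map_add' x y := by
    refine Submodule.linearMap_qext _ (LinearMap.ext fun g => ?_)
    exact congrArg Submodule.Quotient.mk (Subtype.ext (VFGerm.add_apply x.1 y.1 g.1))
  map_smul' c x := by
    refine Submodule.linearMap_qext _ (LinearMap.ext fun g => ?_)
    exact congrArg Submodule.Quotient.mk (Subtype.ext (VFGerm.smul_apply c x.1 g.1))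
  map_lie' := by
    rintro x y
    refine Submodule.linearMap_qext _ (LinearMap.ext ?_)
    rintro ⟨g, hg⟩
    obtain ⟨f, hf, rfl⟩ := exists_eq_coe_of_mem_constMot hg
    exact congrArg Submodule.Quotient.mk (Subtype.ext (VFGerm.lie_apply x.1 y.1 hf))

end Representation

end

end JetNoether

theorem mainTheorem9 {n k : ℕ} (hn : 2 ≤ n) {M : Type*} [TopologicalSpace M] [T2Space M]
    [SecondCountableTopology M] [ChartedSpace (EuclideanSpace ℝ (Fin n)) M]
    [IsManifold (𝓡 n) ∞ M]
    (W : Set (Jet n M k)) (hW : IsOpen W) (u₀ : Jet n M k) (hu₀ : u₀ ∈ W)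
    -- the variational class `[α]`, with `α` of order `r` and locally equivalent to some `L dt`
    (α : JForm n k M 1) (r q : ℕ) (hα : α.SmoothOn W) (hr : HasOrderOn W α r)
    (hq : 2 * q ≤ k) (hαL : LocallyLagrangianOn W α q)
    -- the form `α₀` of Poincaré-Cartan type in `[α]`, of order `r' ≤ k - 1`
    (α₀ : JForm n k M 1) (hα₀ : IsPoincareCartanOn W α α₀)
    (r' : ℕ) (hr' : r' + 1 ≤ k) (hα₀r : HasOrderOn W α₀ r')
    -- the non-degeneracy conditions
    (σ : JForm n k M 2) (hσ : σ.SmoothOn W) (hσα : VarEquivOn W σ α.d) (hσs : IsSourceOn W σ)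
    (hσc : IsCanonicalSourceOn W σ) (r₀ : ℕ) (hr₀ : r₀ + 1 ≤ k) (hσr : HasOrderOn W σ r₀)
    (hreg : IsRegularOn W σ r₀) (hnv : NonvanishingOn W α₀) :
    ∃ S : LieSubalgebra ℝ (VFGerm (JetModel n k) u₀),
      (S : Set (VFGerm (JetModel n k) u₀)) = alphaSymmetryGerms W α α₀ u₀ ∧
      ∃ ρ : S →ₗ⁅ℝ⁆ Module.End ℝ (ConstMot W α r u₀ ⧸ NullMot W α r u₀),
        ∀ (X : smoothNear (JetModel n k) u₀) (hX : VFGerm.mk X ∈ S) (f : Jet n M k → ℝ)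
          (hf : (f : (𝓝 u₀).Germ ℝ) ∈ ConstMot W α r u₀),
          ∃ hXf : (VField.apply X.1 f : (𝓝 u₀).Germ ℝ) ∈ ConstMot W α r u₀,
            ρ ⟨VFGerm.mk X, hX⟩ (Submodule.Quotient.mk ⟨f, hf⟩) =
              Submodule.Quotient.mk ⟨VField.apply X.1 f, hXf⟩ := by
  refine ⟨alphaSymmetryAlgebra hW hu₀ hα hα₀.1, rfl,
    constMotRepresentation hW hu₀ hα hα₀ hr hr' hα₀r, fun X hX f hf => ?_⟩
  exact ⟨apply_mem_constMot hW hα₀ hr hr' hα₀r hX hf, rfl⟩
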